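/- **Theorem (Modulation equations).** Let $\nu>0$ and $\frac1{\sqrt2}<\sigma<1$. *Setting.* Complex functions $u$ on $\mathbb R^3$ are identified with pairs $(\Re u,\Im u)$, and all linear objects are extended to $\mathbb C^2$-valued fields. Write $(u,v)_{L^2}=\int_{\mathbb R^3}(u_1\bar v_1+u_2\bar v_2)\,dx$ and $\langle p,q\rangle=p_1\bar q_1+p_2\bar q_2$ on $\mathbb C^2$; on real pairs these are $\Re\int u\bar v$ and $\Re(p\bar q)$. Let $J=\begin{pmatrix}0&1\\-1&0\end{pmatrix}$ (multiplication by $-i$) and $\Omega(u,v)=\int(u_2\bar v_1-u_1\bar v_2)\,dx$. Let $G_\lambda(x)=\frac{e^{-\sqrt\lambda|x|}}{4\pi|x|}$, $\lambda\ge0$. The form domain $V$ consists of the $u\in L^2(\mathbb R^3;\mathbb C^2)$ of the form $u=\phi_u+q_uG_0$ with $q_u\in\mathbb C^2$ (the charge) and $\nabla\phi_u\in L^2$. For $\omega>0$ put $q_\omega=\left(\frac{\sqrt\omega}{4\pi\nu}\right)^{1/(2\sigma)}$, identified with $(q_\omega,0)$, $\Phi_\omega=(q_\omega G_\omega,0)$,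 and $$Q_{\alpha,Lin}(u,v)=(\nabla\phi_u,\nabla\phi_v)_{L^2}-\tfrac{\sqrt\omega}{4\pi}\langle q_u,q_v\rangle-\tfrac{\sigma\sqrt\omega}{2\pi}(q_u)_1\overline{(q_v)_1}+\omega(u,v)_{L^2},$$ $$Q_L(u,v)=(J\nabla\phi_u,\nabla\phi_v)_{L^2}+\tfrac{\sqrt\omega}{4\pi}\langle\mathbb T q_u,q_v\rangle+\omega(Ju,v)_{L^2},\qquad \mathbb T=\begin{pmatrix}0&-1\\2\sigma+1&0\end{pmatrix},$$ $$N(q)=-\nu|q+q_\omega|^{2\sigma}(q+q_\omega)+\nu|q_\omega|^{2\sigma}\big((2\sigma+1)q_1,\,q_2\big)+\nu|q_\omega|^{2\sigma}q_\omega\qquad(q\in\mathbb R^2).$$ Let $\xi=2\sigma\sqrt{1-\sigma^2}\,\omega$ and $$\Psi=G_{\omega-\xi}\begin{pmatrix}1\\i\end{pmatrix}-\frac{\sqrt{1-\sigma^2}+1}{\sigma}\,G_{\omega+\xi}\begin{pmatrix}1\\-i\end{pmatrix},\qquad \Psi^*=\begin{pmatrix}\Psi_1\\-\Psi_2\end{pmatrix}.$$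 The symplectic projections onto $X^0=\mathrm{span}\{J\Phi_\omega,\frac{d\Phi_\omega}{d\omega}\}$ and $X^1=\mathrm{span}\{\Psi,\Psi^*\}$ are $$P^0u=-\tfrac2\Delta\Omega\big(u,\tfrac{d\Phi_\omega}{d\omega}\big)J\Phi_\omega+\tfrac2\Delta\Omega(u,J\Phi_\omega)\tfrac{d\Phi_\omega}{d\omega},\quad \Delta=\tfrac{d}{d\omega}\|\Phi_\omega\|_{L^2}^2,\qquad P^1u=\tfrac{\Omega(u,\Psi)}{\Omega(\Psi,\Psi)}\Psi+\tfrac{\Omega(u,\Psi^*)}{\Omega(\Psi^*,\Psi^*)}\Psi^*,$$ and $P^c=1-P^0-P^1$, $X^c=\mathrm{Ran}\,P^c$; $(P^0)^*$ and $(P^c)^*$ denote $L^2$-adjoints. Everything is taken at $\omega=\omega(t)$, and $\frac{d}{d\omega}$ of $\Phi_\omega,\Psi,\Psi^*,P^0,P^c$ are derivatives with respect to the parameter (all exist). *Hypotheses.* Let $\omega,\gamma$ be continuously differentiable on $[0,\infty)$ with $\omega>0$. Let $\chi:[0,\infty)\to L^2$ be continuous with real components and $\chi(t)\in V$ for all $t\ge0$,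 and suppose that for all $v\in V$ and $t\ge0$ $$\Big(i\frac{d\chi}{dt},v\Big)_{L^2}=Q_{\alpha,Lin}(\chi,v)+\dot\gamma\,(\Phi_\omega+\chi,v)_{L^2}+\dot\omega\Big(-i\frac{d\Phi_\omega}{d\omega},v\Big)_{L^2}+\langle N(q_\chi),q_v\rangle ,$$ where $\big(i\frac{d\chi}{dt},v\big)_{L^2}$ is the time derivative of $(i\chi(t),v)_{L^2}$. Suppose $P^0\chi(t)=0$ for all $t\ge0$, and write $\chi=\psi+f$ with $\psi=z\Psi+\bar z\Psi^*$ and $f\in X^c$. *Conclusions.* Let $D=\big(\frac{d\Phi_\omega}{d\omega}-\frac{dP^0}{d\omega}\chi,\ \Phi_\omega+\chi\big)_{L^2}$. For every $t\ge0$: $$D\,\dot\omega=\big\langle JN(q_\chi),\,q_{(P^0)^*(\Phi_\omega+\chi)}\big\rangle,\qquad D\,\dot\gamma=-\big\langle JN(q_\chi),\,q_{J(\frac{d\Phi_\omega}{d\omega}-\frac{dP^0}{d\omega}\chi)}\big\rangle ;$$ in particular, whenever $D\ne0$, $$\dot\omega=\frac{\big\langle JN(q_\chi),q_{(P^0)^*(\Phi_\omega+\chi)}\big\rangle}{D},\qquad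 \dot\gamma=-\frac{\big\langle JN(q_\chi),q_{J(\frac{d\Phi_\omega}{d\omega}-\frac{dP^0}{d\omega}\chi)}\big\rangle}{D}.$$ The function $z$ is differentiable and $$(\Psi,J\Psi)_{L^2}(\dot z-i\xi z)=\langle JN(q_\chi),q_{J\Psi}\rangle+\dot\omega\Big[\Big(f,J\frac{d\Psi}{d\omega}\Big)_{L^2}-\Big(z\frac{d\Psi}{d\omega}+\bar z\frac{d\Psi^*}{d\omega},J\Psi\Big)_{L^2}\Big]+\dot\gamma\,(\chi,\Psi)_{L^2}.$$ The function $f$ takes values in $V$, and for all $v\in V$ and $\lambda>0$ $$\Big(P^c\frac{df}{dt},v\Big)_{L^2}=Q_L(f,v)+\Big(-\dot\omega\Big(zP^c\frac{d\Psi}{d\omega}+\bar zP^c\frac{d\Psi^*}{d\omega}\Big)+\dot\gamma P^cJ\chi,\,v\Big)_{L^2}+\big(8\pi\sqrt\lambda\,JN(q_\chi)G_\lambda,\,q_{(P^c)^*v}G_\lambda\big)_{L^2},$$ where $\big(P^c\frac{df}{dt},v\big)_{L^2}$ is the time derivative of $(f(s),(P^c)^*v)_{L^2}$ at $s=t$ with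 $P^c$ frozen at $\omega(t)$. Moreover, $\big(\frac{df}{dt},v\big)_{L^2}$ equals the same right-hand side plus $\dot\omega\big(\frac{dP^c}{d\omega}f,v\big)_{L^2}$. -/

import Mathlib

open MeasureTheory Set Filter Topology
open scoped ENNReal ComplexConjugate SchwartzMap

noncomputable section

namespace ConcNLS

/-! ## Two-component fields on `ℝ³`

A complex function `u` on `ℝ³` is identified with the pair `(Re u, Im u)`. All linear objects act on
the complexification, i.e. on square integrable `ℂ²`-valued fields; the original functions are the
fields with real components. Multiplication by `i` is then the matrix `-J`. -/

/-- The physical space `ℝ³`. -/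
abbrev R3 : Type := EuclideanSpace ℝ (Fin 3)

/-- The fibre `ℂ²`, the complexification of `ℂ ≃ ℝ²`. -/
abbrev C2 : Type := EuclideanSpace ℂ (Fin 2)

/-- `L²(ℝ³; ℂ²)`. -/
abbrev H : Type := Lp C2 2 (volume : Measure R3)

/-- The Hermitian product `(u, v)`, linear in `u` and antilinear in `v`: on `L²(ℝ³; ℂ²)` it is
`∫ (u₁ v̄₁ + u₂ v̄₂) dx`, on `ℂ²` it is `u₁ v̄₁ + u₂ v̄₂`. On pairs that represent complex functions
(resp. complex numbers) it is `Re ∫ u v̄ dx` (resp. `Re (u v̄)`). -/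
def ip {E : Type*} [NormedAddCommGroup E] [InnerProductSpace ℂ E] (u v : E) : ℂ := inner ℂ v u

/-- The field `u` has real components, i.e. it represents a complex function. -/
def IsRealField (u : H) : Prop := ∀ᵐ x : R3, ∀ i : Fin 2, (u x i).im = 0

/-- A `2 × 2` matrix as an operator on `ℂ²`. -/
def matC (M : Matrix (Fin 2) (Fin 2) ℂ) : C2 →L[ℂ] C2 := Matrix.toEuclideanCLM (𝕜 := ℂ) M

/-- A `2 × 2` matrix acting pointwise on fields. -/
def matH (M : Matrix (Fin 2) (Fin 2) ℂ) : H →L[ℂ] H := (matC M).compLpL 2 volume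

/-- The symplectic matrix `J`. -/
def Jmat : Matrix (Fin 2) (Fin 2) ℂ := !![0, 1; -1, 0]

/-- `J` on `ℂ²`. -/
def Jc : C2 →L[ℂ] C2 := matC Jmat

/-- `J` on fields. -/
def J : H →L[ℂ] H := matH Jmat

/-- The field with pointwise values `g`, when `g` is square integrable. -/
def ofFun (g : R3 → C2) : H := by
  classical
  exact if h : MemLp g 2 (volume : Measure R3) then h.toLp g else 0

/-! ## Green functions and the form domain -/

/-- `e^{-a|x|} / (4π|x|)`. The Green function `G_λ` is the case `a = √λ`. -/
def yukawa (a : ℝ) (x : R3) : ℝ := Real.exp (-a * ‖x‖) / (4 * Real.pi * ‖x‖)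

theorem memLp_yukawa {a : ℝ} (ha : 0 < a) (c : C2) :
    MemLp (fun x : R3 => yukawa a x • c) 2 (volume : Measure R3) := by
  have hmeas : Measurable (yukawa a) := by unfold yukawa; fun_prop
  rw [memLp_two_iff_integrable_sq_norm (by fun_prop)]
  have h1 : (fun x : R3 => ‖yukawa a x • c‖ ^ 2) = fun x : R3 =>
      (fun r : ℝ => (Real.exp (-a * r) / (4 * Real.pi * r)) ^ 2 * ‖c‖ ^ 2) ‖x‖ := by
    funext x
    simp only [yukawa, norm_smul, mul_pow, Real.norm_eq_abs, sq_abs]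
  rw [h1, integrable_fun_norm_addHaar (volume : Measure R3)
    (f := fun r : ℝ => (Real.exp (-a * r) / (4 * Real.pi * r)) ^ 2 * ‖c‖ ^ 2)]
  have h2 : IntegrableOn (fun r : ℝ => Real.exp (-(2 * a) * r)) (Ioi 0) :=
    integrableOn_exp_mul_Ioi (by linarith) 0
  refine IntegrableOn.congr_fun (f := fun r : ℝ => ‖c‖ ^ 2 / (4 * Real.pi) ^ 2 *
    Real.exp (-(2 * a) * r)) (h2.const_mul _) ?_ measurableSet_Ioi
  intro r hr
  have hr' : r ≠ 0 := ne_of_gt hr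
  have hpi := Real.pi_ne_zero
  have h3 : Real.exp (-(2 * a) * r) = Real.exp (-a * r) ^ 2 := by
    rw [← Real.exp_nat_mul]; congr 1; push_cast; ring
  simp only [finrank_euclideanSpace, Fintype.card_fin, smul_eq_mul, h3]
  field_simp

/-- The field `x ↦ e^{-a|x|} / (4π|x|) · c` with charge `c` (for `a > 0`). -/
def green (a : ℝ) (c : C2) : H := ofFun fun x => yukawa a x • c

theorem green_ae_eq {a : ℝ} (ha : 0 < a) (c : C2) :
    ∀ᵐ x : R3, green a c x = yukawa a x • c := by
  unfold green ofFun
  rw [dif_pos (memLp_yukawa ha c)]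
  exact MemLp.coeFn_toLp _

/-- `D = (∂₁φ, ∂₂φ, ∂₃φ)` in the sense of (tempered) distributions, with `D` square integrable. -/
def HasWeakGradient (φ : R3 → C2) (D : Fin 3 → H) : Prop :=
  LocallyIntegrable φ ∧ ∀ (η : 𝓢(R3, ℂ)) (j : Fin 3),
    ∫ x, (fderiv ℝ (η : R3 → ℂ) x (EuclideanSpace.single j 1)) • φ x = -∫ x, η x • D j x

/-- `u = φ + q G₀` with `G₀ = 1 / (4π|x|)` and `∇φ = D ∈ L²`. -/
def IsDecomposition (u : H) (q : C2) (D : Fin 3 → H) : Prop :=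
  HasWeakGradient (fun x => u x - yukawa 0 x • q) D

/-- The form domain `V` (complexified): square integrable `u = φ + q G₀` with `∇φ ∈ L²`. -/
def V : Set H := {u | ∃ q D, IsDecomposition u q D}

/-- The charge `q_u` of `u ∈ V` (it is determined by `u`, because `∇G₀` is not in `L²`). -/
def charge (u : H) : C2 := by
  classical
  exact if h : ∃ q D, IsDecomposition u q D then h.choose else 0

/-- The gradient `∇φ_u` of the regular part of `u ∈ V`. -/
def regGrad (u : H) : Fin 3 → H := by
  classical
  exact if h : ∃ D q, IsDecomposition u q D then h.choose else 0

/-! ## Forms and nonlinearity -/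

/-- The form `Q_{α,Lin}` of the linearization at frequency `w`. -/
def Qlin (σ w : ℝ) (u v : H) : ℂ :=
  (∑ j, ip (regGrad u j) (regGrad v j))
    - (√w / (4 * Real.pi) : ℝ) * ip (charge u) (charge v)
    - (σ * √w / (2 * Real.pi) : ℝ) * (charge u 0 * conj (charge v 0))
    + w * ip u v

/-- The matrix `𝕋`, for which `J diag(α₁, α₂) = (√w / 4π) 𝕋`. -/
def Tmat (σ : ℝ) : Matrix (Fin 2) (Fin 2) ℂ := !![0, -1; 2 * σ + 1, 0]

/-- The form `Q_L` of the generator `L = J diag(L₁, L₂)` at frequency `w`. -/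
def QL (σ w : ℝ) (u v : H) : ℂ :=
  (∑ j, ip (J (regGrad u j)) (regGrad v j))
    + (√w / (4 * Real.pi) : ℝ) * ip (matC (Tmat σ) (charge u)) (charge v)
    + w * ip (J u) v

/-- The charge `q_w = (√w / (4πν))^{1/(2σ)}` of the solitary wave. -/
def qSol (ν σ w : ℝ) : ℝ := (√w / (4 * Real.pi * ν)) ^ (1 / (2 * σ))

/-- The pair `(q_w, 0)`. -/
def qSolVec (ν σ w : ℝ) : C2 := !₂[(qSol ν σ w : ℂ), 0]

/-- The nonlinear remainder `N(q) ∈ ℝ² ⊂ ℂ²` for a charge `q = (Re q, Im q)`, so that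
`N(q, p) = ip (N(q)) p`. -/
def Nrem (ν σ w : ℝ) (q : C2) : C2 :=
  -((ν * ‖q + qSolVec ν σ w‖ ^ (2 * σ) : ℝ) : ℂ) • (q + qSolVec ν σ w)
    + ((ν * qSol ν σ w ^ (2 * σ) : ℝ) : ℂ) • !₂[(2 * (σ : ℂ) + 1) * q 0, q 1]
    + ((ν * qSol ν σ w ^ (2 * σ) : ℝ) : ℂ) • qSolVec ν σ w

/-! ## Solitary waves, eigenfunctions and spectral projections -/

/-- The solitary wave `Φ_w`, as the pair `(Φ_w, 0)`. -/
def Sol (ν σ w : ℝ) : H := green √w (qSolVec ν σ w)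

/-- `dΦ_w / dw`. -/
def dSol (ν σ w : ℝ) : H := deriv (fun s => Sol ν σ s) w

/-- The eigenfrequency `ξ = 2σ √(1 - σ²) w`. -/
def xi (σ w : ℝ) : ℝ := 2 * σ * √(1 - σ ^ 2) * w

/-- The eigenfunction `Ψ` of `L` for the eigenvalue `iξ`. -/
def Psi (σ w : ℝ) : H :=
  green √(w - xi σ w) !₂[1, Complex.I]
    - ((√(1 - σ ^ 2) + 1) / σ : ℝ) • green √(w + xi σ w) !₂[1, -Complex.I]

/-- The eigenfunction `Ψ* = (Ψ₁, -Ψ₂)` of `L` for the eigenvalue `-iξ`. -/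
def PsiStar (σ w : ℝ) : H := matH !![1, 0; 0, -1] (Psi σ w)

/-- `dΨ / dw`. -/
def dPsi (σ w : ℝ) : H := deriv (fun s => Psi σ s) w

/-- `dΨ* / dw`. -/
def dPsiStar (σ w : ℝ) : H := deriv (fun s => PsiStar σ s) w

/-- The functional `u ↦ Ω(u, v) = ∫ (u₂ v̄₁ - u₁ v̄₂) dx = -(u, J v)`. -/
def symp (v : H) : H →L[ℂ] ℂ := -innerSL ℂ (J v)

/-- `Δ = d/dw ‖Φ_w‖²`. -/
def Delta (ν σ w : ℝ) : ℝ := deriv (fun s => ‖Sol ν σ s‖ ^ 2) w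

/-- The symplectic projection onto `X⁰ = span {JΦ_w, dΦ_w/dw}`, the generalized kernel of `L`. -/
def P0 (ν σ w : ℝ) : H →L[ℂ] H :=
  (-(2 / Delta ν σ w) : ℝ) • (symp (dSol ν σ w)).smulRight (J (Sol ν σ w))
    + (2 / Delta ν σ w : ℝ) • (symp (J (Sol ν σ w))).smulRight (dSol ν σ w)

/-- The symplectic projection onto `X¹ = span {Ψ, Ψ*}`. -/
def P1 (σ w : ℝ) : H →L[ℂ] H :=
  (symp (Psi σ w) (Psi σ w))⁻¹ • (symp (Psi σ w)).smulRight (Psi σ w)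
    + (symp (PsiStar σ w) (PsiStar σ w))⁻¹ • (symp (PsiStar σ w)).smulRight (PsiStar σ w)

/-- The projection `P^c = 1 - P⁰ - P¹` onto the continuous spectral subspace. -/
def Pc (ν σ w : ℝ) : H →L[ℂ] H := ContinuousLinearMap.id ℂ H - P0 ν σ w - P1 σ w

/-- The continuous spectral subspace `X^c`. -/
def Xc (ν σ w : ℝ) : Set H := range (Pc ν σ w)

/-- `(dP⁰/dw) u`. -/
def dP0 (ν σ w : ℝ) (u : H) : H := deriv (fun s => P0 ν σ s) w u

/-- `(dP^c/dw) u`. -/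
def dPc (ν σ w : ℝ) (u : H) : H := deriv (fun s => Pc ν σ s) w u

/-- The vector `dΦ_w/dw - (dP⁰/dw) u`. -/
def modDir (ν σ w : ℝ) (u : H) : H := dSol ν σ w - dP0 ν σ w u

/-- The common denominator `(dΦ_w/dw - (dP⁰/dw) u, Φ_w + u)` of the modulation equations. -/
def modDen (ν σ w : ℝ) (u : H) : ℂ := ip (modDir ν σ w u) (Sol ν σ w + u)

/-- The adjoint `(P⁰)*` in `L²`. -/
def P0adj (ν σ w : ℝ) : H →L[ℂ] H := ContinuousLinearMap.adjoint (P0 ν σ w)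

/-- The adjoint `(P^c)*` in `L²`. -/
def Pcadj (ν σ w : ℝ) : H →L[ℂ] H := ContinuousLinearMap.adjoint (Pc ν σ w)

/-- The right-hand side of the equation for `f`, tested with `v`; `w'` and `g'` stand for the time
derivatives of `ω` and `γ`. The charge term is the functional
`v ↦ (8π√lam JN(q_χ) G_lam, q_v G_lam)` to which `P^c` is applied by duality. -/
def fRHS (ν σ lam w w' g' : ℝ) (z : ℂ) (χ f v : H) : ℂ :=
  QL σ w f v
    + ip (-(w' : ℂ) • (z • Pc ν σ w (dPsi σ w) + conj z • Pc ν σ w (dPsiStar σ w))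
        + (g' : ℂ) • Pc ν σ w (J χ)) v
    + ((8 * Real.pi * √lam : ℝ) : ℂ) *
        ip (green √lam (Jc (Nrem ν σ w (charge χ)))) (green √lam (charge (Pcadj ν σ w v)))

end ConcNLS

end

open ConcNLS

/-! ### Radial L² kernels, fields with a fixed charge vector, conjugation and the action of J -/

noncomputable section

namespace ConcNLS

/-! ## Differentiability of parameter dependent kernels -/

/-! Replacing the test vector v by -Jv turns the form equation into d/dt (χ,v) = Q_L(χ,v) +
γ'(J(Φ+χ),v) - ω'(dΦ/dω,v) + ⟨JN(q_χ),q_v⟩ for fixed v in V (`weak_flow`). Every conclusion comes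
from testing this with a vector that moves with ω and on which Q_L is explicit. Since χ is only
continuous in L², the motion of the test vector is handled by product rules that need the derivative
of χ only in the weak sense (`hasDerivWithinAt_ip`, `hasDerivWithinAt_ip_clm`).

The spectral input is Q_L(u,Φ) = 0, Q_L(u,J dΦ/dω) = -(u,Φ) and Q_L(u,JΨ) = iξ(u,JΨ) for all u in V.
These follow from formulas for Q_L(u,·) on Green functions and on exponentials (`QL_green`,
`QL_exp`). The regular part of u has only a distributional gradient, so the underlying identity is
proved first against e^{-s|x|}, by integration by parts with |x| smoothed to √(|x|²+ε²)
(`IsDecomposition.sum_mom_expGrad`), and is then integrated in the rate a, because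
∂_a(e^{-a|x|}/(4π|x|)) = -e^{-a|x|}/(4π) (`IsDecomposition.sum_mom_greenGrad`). The limit s → ∞ of
the first identity also shows that the charge is unique. Hermitian symmetry of Q_{α,Lin} then yields
the orthogonality relations between X⁰ and X¹, hence all the algebra of the projections.

Three tests give the theorem. With (P⁰)*v, differentiating P⁰χ = 0 gives γ'(P⁰J(Φ+χ),v) - ω'(m,v) +
⟨JN,q_{(P⁰)*v}⟩ = 0, where m = dΦ/dω - (dP⁰/dω)χ; the choice v = Φ+χ removes γ', and v = Jm removes
ω' (`omega_gamma_equations`). With JΨ, the relation z = (χ,JΨ)/(Ψ,JΨ) makes z differentiable and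
gives its equation. With (P^c)*v, the vectors JΦ, dΦ/dω, Ψ, Ψ* are annihilated and Q_L(χ,(P^c)*v) =
Q_L(f,v) (`QL_Pcadj`); differentiating f = P^c f then adds the term with dP^c/dω. -/

theorem abs_sub_linear_le {f f' f'' : ℝ → ℝ} {δ M : ℝ}
    (h1 : ∀ b, δ ≤ b → HasDerivAt f (f' b) b) (h2 : ∀ b, δ ≤ b → HasDerivAt f' (f'' b) b)
    (hM : ∀ b, δ ≤ b → |f'' b| ≤ M) {a b : ℝ} (ha : δ ≤ a) (hb : δ ≤ b) :
    |f b - f a - (b - a) * f' a| ≤ M * (b - a) ^ 2 := by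
  have hM0 : 0 ≤ M := (abs_nonneg _).trans (hM a ha)
  have hmem : ∀ x ∈ uIcc a b, δ ≤ x := fun x hx => (le_min ha hb).trans hx.1
  -- A first mean value bound controls f' - f'(a); a second one, for x ↦ f x - x f'(a), gives the
  -- constant M instead of the sharp M/2.
  have hd : ∀ x ∈ uIcc a b, ‖f' x - f' a‖ ≤ M * |b - a| := by
    intro x hx
    have := (convex_uIcc a b).norm_image_sub_le_of_norm_hasDerivWithin_le
      (f := f') (f' := f'') (C := M)
      (fun y hy => (h2 y (hmem y hy)).hasDerivWithinAt) (fun y hy => hM y (hmem y hy))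
      left_mem_uIcc hx
    refine this.trans ?_
    gcongr
    exact abs_sub_left_of_mem_uIcc hx
  have := (convex_uIcc a b).norm_image_sub_le_of_norm_hasDerivWithin_le
    (f := fun x => f x - x * f' a) (f' := fun x => f' x - f' a) (C := M * |b - a|)
    (fun y hy => (((h1 y (hmem y hy)).sub ((hasDerivAt_id y).mul_const (f' a))).congr_deriv
      (by ring)).hasDerivWithinAt)
    hd left_mem_uIcc right_mem_uIcc
  rw [Real.norm_eq_abs, Real.norm_eq_abs] at this
  calc |f b - f a - (b - a) * f' a| = |f b - b * f' a - (f a - a * f' a)| := by congr 1; ring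
    _ ≤ M * |b - a| * |b - a| := this
    _ = M * (b - a) ^ 2 := by rw [mul_assoc, ← sq, sq_abs]

/-- Real valued square integrable functions. -/
abbrev L2R : Type := Lp ℝ 2 (volume : Measure R3)

/-- A pointwise quadratic remainder with one square integrable majorant becomes a quadratic
remainder in norm, so differentiating a kernel in its parameter reduces to a scalar Taylor estimate.
-/
theorem hasDerivAt_L2R {F : ℝ → L2R} {F' B : L2R} {a : ℝ}
    (h : ∀ᶠ b in 𝓝 a, ∀ᵐ x : R3, |F b x - F a x - (b - a) * F' x| ≤ B x * (b - a) ^ 2) :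
    HasDerivAt F F' a := by
  rw [hasDerivAt_iff_isLittleO]
  refine (Asymptotics.IsBigO.of_bound ‖B‖ (g := fun b : ℝ => (b - a) ^ 2) ?_).trans_isLittleO ?_
  · filter_upwards [h] with b hb
    rw [mul_comm ‖B‖]
    refine Lp.norm_le_mul_norm_of_ae_le_mul ?_
    filter_upwards [hb, Lp.coeFn_sub (F b - F a) ((b - a) • F'), Lp.coeFn_sub (F b) (F a),
      Lp.coeFn_smul (b - a) F'] with x h0 h1 h2 h3
    rw [h1, Pi.sub_apply, h2, h3, Pi.sub_apply, Pi.smul_apply, smul_eq_mul, Real.norm_eq_abs]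
    refine h0.trans ?_
    rw [Real.norm_of_nonneg (sq_nonneg _), mul_comm]
    gcongr
    exact le_abs_self _
  · have := (Asymptotics.isLittleO_pow_id (𝕜 := ℝ) (n := 2) (by norm_num)).comp_tendsto
      (show Tendsto (fun b : ℝ => b - a) (𝓝 a) (𝓝 0) by
        have : Continuous fun b : ℝ => b - a := by fun_prop
        simpa using this.tendsto a)
    exact this

theorem inner_real_eq (a b : ℝ) : inner ℝ a b = a * b := by simp [mul_comm]

/-! ## Radial kernels -/

theorem integral_radial (f : ℝ → ℝ) :
    ∫ x : R3, f ‖x‖ = 4 * Real.pi * ∫ r in Ioi (0 : ℝ), r ^ 2 * f r := by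
  have h := integral_fun_norm_addHaar (volume : Measure R3) f
  rw [h]
  have : (volume : Measure R3).real (Metric.ball 0 1) = Real.pi * 4 / 3 := by
    rw [Measure.real, EuclideanSpace.volume_ball_fin_three]
    simp [ENNReal.toReal_ofReal (by positivity : (0 : ℝ) ≤ Real.pi * 4 / 3)]
  rw [this]
  simp only [finrank_euclideanSpace, Fintype.card_fin, smul_eq_mul, nsmul_eq_mul]
  push_cast
  ring

/-- The kernel `e^{-a|x|} |x|^{m-1}`. -/
def kern (m : ℕ) (a : ℝ) (x : R3) : ℝ := Real.exp (-a * ‖x‖) * ‖x‖ ^ m / ‖x‖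

theorem measurable_kern (m : ℕ) (a : ℝ) : Measurable (kern m a) := by unfold kern; fun_prop

theorem integrableOn_pow_mul_exp {c : ℝ} (hc : 0 < c) (k : ℕ) :
    IntegrableOn (fun r : ℝ => r ^ k * Real.exp (-c * r)) (Ioi 0) := by
  have := integrableOn_rpow_mul_exp_neg_mul_rpow (p := 1) (s := k) (b := c)
    (by have : (0 : ℝ) ≤ k := k.cast_nonneg
        linarith) one_pos hc
  simpa using this

theorem integral_pow_mul_exp {c : ℝ} (hc : 0 < c) (k : ℕ) :
    ∫ r in Ioi (0 : ℝ), r ^ k * Real.exp (-c * r) = k.factorial / c ^ (k + 1) := by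
  have := Real.integral_rpow_mul_exp_neg_mul_Ioi (a := k + 1) (r := c) (by positivity) hc
  simp only [add_sub_cancel_right, Real.rpow_natCast] at this
  simp only [neg_mul]
  rw [this, Real.Gamma_nat_eq_factorial]
  norm_cast
  rw [one_div, inv_pow]
  field_simp

/-- The weight r² of polar coordinates absorbs the singularity 1/r of index 0. -/
theorem memLp_kern (m : ℕ) {a : ℝ} (ha : 0 < a) :
    MemLp (kern m a) 2 (volume : Measure R3) := by
  rw [memLp_two_iff_integrable_sq_norm (measurable_kern m a).aestronglyMeasurable]
  have h1 : (fun x : R3 => ‖kern m a x‖ ^ 2) = fun x : R3 =>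
      (fun r : ℝ => (Real.exp (-a * r) * r ^ m / r) ^ 2) ‖x‖ := by
    funext x
    simp only [kern, Real.norm_eq_abs, sq_abs]
  rw [h1, integrable_fun_norm_addHaar (volume : Measure R3)
    (f := fun r : ℝ => (Real.exp (-a * r) * r ^ m / r) ^ 2)]
  refine IntegrableOn.congr_fun (integrableOn_pow_mul_exp (c := 2 * a) (by linarith) (2 * m)) ?_
    measurableSet_Ioi
  intro r hr
  have hr' : r ≠ 0 := ne_of_gt hr
  have h3 : Real.exp (-(2 * a) * r) = Real.exp (-a * r) ^ 2 := by
    rw [← Real.exp_nat_mul]; congr 1; push_cast; ring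
  simp only [finrank_euclideanSpace, Fintype.card_fin, smul_eq_mul, h3]
  field_simp
  ring

/-- The kernel `e^{-a|x|} |x|^{m-1}` as a square integrable function (for `a > 0`). -/
def kernL (m : ℕ) (a : ℝ) : L2R :=
  if h : 0 < a then (memLp_kern m h).toLp (kern m a) else 0

theorem kernL_ae (m : ℕ) {a : ℝ} (ha : 0 < a) : ∀ᵐ x : R3, kernL m a x = kern m a x := by
  unfold kernL
  rw [dif_pos ha]
  exact MemLp.coeFn_toLp _

/-- Each derivative in the rate brings down a factor -|x|, so the family is closed under
differentiation with the index raised by one. The second derivative decreases in the rate, hence is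
dominated by its value at δ. -/
theorem kern_sub_linear_le (m : ℕ) {δ a b : ℝ} (ha : δ ≤ a) (hb : δ ≤ b) (x : R3) :
    |kern m b x - kern m a x - (b - a) * (-kern (m + 1) a x)|
      ≤ kern (m + 2) δ x * (b - a) ^ 2 := by
  refine abs_sub_linear_le (f := fun b => kern m b x) (f' := fun b => -kern (m + 1) b x)
    (f'' := fun b => kern (m + 2) b x) (δ := δ) ?_ ?_ ?_ ha hb
  · intro b _
    unfold kern
    have := ((((hasDerivAt_id b).neg.mul_const ‖x‖).exp).mul_const (‖x‖ ^ m)).div_const ‖x‖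
    refine this.congr_deriv ?_
    simp only [id, Pi.neg_apply]
    ring
  · intro b _
    unfold kern
    have := ((((hasDerivAt_id b).neg.mul_const ‖x‖).exp).mul_const (‖x‖ ^ (m + 1))).div_const ‖x‖
    refine this.neg.congr_deriv ?_
    simp only [id, Pi.neg_apply]
    ring
  · intro b hb
    unfold kern
    rw [abs_of_nonneg (by positivity)]
    gcongr

theorem hasDerivAt_kernL (m : ℕ) {a : ℝ} (ha : 0 < a) :
    HasDerivAt (kernL m) (-kernL (m + 1) a) a := by
  -- The rate a/2 lies below all rates near a and is still positive, which keeps the majorant square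
  -- integrable.
  refine hasDerivAt_L2R (B := kernL (m + 2) (a / 2)) ?_
  filter_upwards [lt_mem_nhds (show a / 2 < a by linarith)] with b hb
  filter_upwards [kernL_ae m ha, kernL_ae m (show 0 < b by linarith), kernL_ae (m + 1) ha,
    kernL_ae (m + 2) (show 0 < a / 2 by linarith), Lp.coeFn_neg (kernL (m + 1) a)]
    with x h1 h2 h3 h4 h5
  rw [h5, Pi.neg_apply, h1, h2, h3, h4]
  exact kern_sub_linear_le m (by linarith) hb.le x

theorem inner_kernL {a b : ℝ} (ha : 0 < a) (hb : 0 < b) :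
    inner ℝ (kernL 0 a) (kernL 0 b) = 4 * Real.pi / (a + b) := by
  rw [L2.inner_def]
  have h1 : ∫ x : R3, inner ℝ (kernL 0 a x) (kernL 0 b x) = ∫ x : R3,
      (fun r : ℝ => Real.exp (-(a + b) * r) / r ^ 2) ‖x‖ := by
    refine integral_congr_ae ?_
    filter_upwards [kernL_ae 0 ha, kernL_ae 0 hb] with x h1 h2
    rw [h1, h2]
    simp only [kern, pow_zero, mul_one, inner_real_eq]
    rw [show -(a + b) * ‖x‖ = -a * ‖x‖ + -b * ‖x‖ by ring, Real.exp_add]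
    ring
  rw [h1, integral_radial fun r : ℝ => Real.exp (-(a + b) * r) / r ^ 2]
  have h2 : ∫ r in Ioi (0 : ℝ), r ^ 2 * (Real.exp (-(a + b) * r) / r ^ 2)
      = ∫ r in Ioi (0 : ℝ), r ^ 0 * Real.exp (-(a + b) * r) := by
    refine setIntegral_congr_fun measurableSet_Ioi fun r hr => ?_
    have hr' : r ≠ 0 := ne_of_gt hr
    field_simp
  rw [h2, integral_pow_mul_exp (by linarith) 0]
  simp [div_eq_mul_inv]

/-! ## Products of a scalar kernel and a vector -/

/-- The field `x ↦ k(x) c`. -/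
def ten (c : C2) : L2R →L[ℝ] H := (ContinuousLinearMap.toSpanSingleton ℝ c).compLpL 2 volume

theorem ten_ae (c : C2) (k : L2R) : ∀ᵐ x : R3, ten c k x = k x • c := by
  filter_upwards [(ContinuousLinearMap.toSpanSingleton ℝ c).coeFn_compLp k] with x hx
  exact hx

theorem ten_smul (z : ℂ) (c : C2) (k : L2R) : ten (z • c) k = z • ten c k := by
  apply Lp.ext
  filter_upwards [ten_ae c k, ten_ae (z • c) k, Lp.coeFn_smul z (ten c k)] with x h1 h2 h3
  rw [h3, Pi.smul_apply, h1, h2, smul_comm]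

theorem matH_ae (M : Matrix (Fin 2) (Fin 2) ℂ) (u : H) :
    ∀ᵐ x : R3, matH M u x = matC M (u x) :=
  (matC M).coeFn_compLp u

theorem matH_ten (M : Matrix (Fin 2) (Fin 2) ℂ) (c : C2) (k : L2R) :
    matH M (ten c k) = ten (matC M c) k := by
  apply Lp.ext
  filter_upwards [ten_ae c k, ten_ae (matC M c) k, matH_ae M (ten c k)] with x h1 h2 h3
  rw [h3, h1, h2, (matC M).map_smul_of_tower]

theorem green_eq {a : ℝ} (ha : 0 < a) (c : C2) :
    green a c = ten c ((1 / (4 * Real.pi)) • kernL 0 a) := by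
  apply Lp.ext
  filter_upwards [green_ae_eq ha c, ten_ae c ((1 / (4 * Real.pi)) • kernL 0 a),
    Lp.coeFn_smul (1 / (4 * Real.pi)) (kernL 0 a), kernL_ae 0 ha] with x h1 h2 h3 h4
  rw [h1, h2, h3, Pi.smul_apply, h4]
  congr 1
  simp only [yukawa, kern, smul_eq_mul]
  ring

/-- The moment `∫ k u`. -/
def mom (k : L2R) (u : H) : C2 := ∫ x : R3, k x • u x

theorem integrable_smul_field (k : L2R) (u : H) : Integrable (fun x : R3 => k x • u x) := by
  have := (Lp.memLp u).smul (r := 1) (Lp.memLp k)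
  exact memLp_one_iff_integrable.1 this

theorem ip_add_left {E : Type*} [NormedAddCommGroup E] [InnerProductSpace ℂ E] (u v w : E) :
    ip (u + v) w = ip u w + ip v w := inner_add_right _ _ _
theorem ip_add_right {E : Type*} [NormedAddCommGroup E] [InnerProductSpace ℂ E] (u v w : E) :
    ip u (v + w) = ip u v + ip u w := inner_add_left _ _ _
theorem ip_sub_left {E : Type*} [NormedAddCommGroup E] [InnerProductSpace ℂ E] (u v w : E) :
    ip (u - v) w = ip u w - ip v w := inner_sub_right _ _ _
theorem ip_sub_right {E : Type*} [NormedAddCommGroup E] [InnerProductSpace ℂ E] (u v w : E) :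
    ip u (v - w) = ip u v - ip u w := inner_sub_left _ _ _
theorem ip_neg_left {E : Type*} [NormedAddCommGroup E] [InnerProductSpace ℂ E] (u v : E) :
    ip (-u) v = -ip u v := inner_neg_right _ _
theorem ip_neg_right {E : Type*} [NormedAddCommGroup E] [InnerProductSpace ℂ E] (u v : E) :
    ip u (-v) = -ip u v := inner_neg_left _ _
theorem ip_smul_left {E : Type*} [NormedAddCommGroup E] [InnerProductSpace ℂ E] (z : ℂ) (u v : E) :
    ip (z • u) v = z * ip u v := inner_smul_right _ _ _
theorem ip_smul_right {E : Type*} [NormedAddCommGroup E] [InnerProductSpace ℂ E] (z : ℂ)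
    (u v : E) : ip u (z • v) = conj z * ip u v := inner_smul_left _ _ _
theorem ip_conj {E : Type*} [NormedAddCommGroup E] [InnerProductSpace ℂ E] (u v : E) :
    conj (ip u v) = ip v u := inner_conj_symm _ _
theorem ip_zero_left {E : Type*} [NormedAddCommGroup E] [InnerProductSpace ℂ E] (u : E) :
    ip (0 : E) u = 0 := inner_zero_right _
theorem ip_zero_right {E : Type*} [NormedAddCommGroup E] [InnerProductSpace ℂ E] (u : E) :
    ip u (0 : E) = 0 := inner_zero_left _

theorem rsmul_eq (r : ℝ) (u : H) : r • u = (r : ℂ) • u := by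
  apply Lp.ext
  filter_upwards [Lp.coeFn_smul r u, Lp.coeFn_smul (r : ℂ) u] with x h1 h2
  rw [h1, h2, Pi.smul_apply, Pi.smul_apply, Complex.coe_smul]

theorem ip_rsmul_left (r : ℝ) (u v : H) : ip (r • u) v = r * ip u v := by
  rw [rsmul_eq, ip_smul_left]
theorem ip_rsmul_right (r : ℝ) (u v : H) : ip u (r • v) = r * ip u v := by
  rw [rsmul_eq, ip_smul_right, Complex.conj_ofReal]

theorem ip_C2 (p q : C2) : ip p q = p 0 * conj (q 0) + p 1 * conj (q 1) := by
  simp [ip, PiLp.inner_apply, Fin.sum_univ_two]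

/-- Only a vector moment of u enters such a pairing, so identities between moments apply to every
charge vector at once. -/
theorem ip_ten (u : H) (c : C2) (k : L2R) : ip u (ten c k) = ip (mom k u) c := by
  unfold ip mom
  rw [← integral_inner (integrable_smul_field k u), L2.inner_def]
  refine integral_congr_ae ?_
  filter_upwards [ten_ae c k] with x hx
  rw [hx, ← Complex.coe_smul, ← Complex.coe_smul, inner_smul_left, inner_smul_right,
    Complex.conj_ofReal]

theorem mom_ten (k l : L2R) (c : C2) : mom k (ten c l) = (inner ℝ k l : ℝ) • c := by
  unfold mom
  rw [L2.inner_def, ← integral_smul_const]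
  refine integral_congr_ae ?_
  filter_upwards [ten_ae c l] with x hx
  rw [hx, smul_smul, inner_real_eq]

theorem ip_ten_ten (c d : C2) (k l : L2R) :
    ip (ten c k) (ten d l) = ((inner ℝ k l : ℝ) : ℂ) * ip c d := by
  rw [ip_ten, mom_ten, real_inner_comm, ← Complex.coe_smul, ip_smul_left]

theorem ip_green_green {a b : ℝ} (ha : 0 < a) (hb : 0 < b) (c d : C2) :
    ip (green a c) (green b d) = ((1 / (4 * Real.pi * (a + b)) : ℝ) : ℂ) * ip c d := by
  rw [green_eq ha, green_eq hb, ip_ten_ten, inner_smul_left, inner_smul_right, inner_kernL ha hb]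
  congr 2
  have := Real.pi_pos
  have : a + b ≠ 0 := by positivity
  simp
  field_simp

theorem mom_smul (r : ℝ) (k : L2R) (u : H) : mom (r • k) u = r • mom k u := by
  unfold mom
  rw [← integral_smul]
  refine integral_congr_ae ?_
  filter_upwards [Lp.coeFn_smul r k] with x hx
  rw [hx, Pi.smul_apply, smul_assoc]

/-! ## Complex conjugation of fields -/

/-- Componentwise complex conjugation on `ℂ²`. -/
def conjC : C2 →L[ℝ] C2 :=
  LinearMap.toContinuousLinearMap
    { toFun := fun c => !₂[conj (c 0), conj (c 1)]
      map_add' := fun c d => by ext i; fin_cases i <;> simp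
      map_smul' := fun r c => by ext i; fin_cases i <;> simp }

/-- Complex conjugation of fields. -/
def conjH : H →L[ℝ] H := conjC.compLpL 2 volume

theorem conjC_apply (c : C2) (i : Fin 2) : conjC c i = conj (c i) := by
  fin_cases i <;> simp [conjC]

theorem conjH_ae (u : H) : ∀ᵐ x : R3, conjH u x = conjC (u x) := conjC.coeFn_compLp u

/-- As a fixed-point condition, reality passes through J, the projections and limits; between two
such fields the Hermitian product is symmetric. -/
theorem isRealField_iff (u : H) : IsRealField u ↔ conjH u = u := by
  constructor
  · intro h
    apply Lp.ext
    filter_upwards [h, conjH_ae u] with x h1 h2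
    rw [h2]
    ext i
    rw [conjC_apply]
    exact Complex.conj_eq_iff_im.2 (h1 i)
  · intro h
    have h2 := conjH_ae u
    rw [h] at h2
    filter_upwards [h2] with x hx i
    rw [← Complex.conj_eq_iff_im, ← conjC_apply, ← hx]

theorem conjH_ten (c : C2) (k : L2R) : conjH (ten c k) = ten (conjC c) k := by
  apply Lp.ext
  filter_upwards [ten_ae c k, ten_ae (conjC c) k, conjH_ae (ten c k)] with x h1 h2 h3
  rw [h3, h1, h2, map_smul]

theorem ip_conjC (c d : C2) : ip (conjC c) (conjC d) = ip d c := by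
  rw [ip_C2, ip_C2]
  simp only [conjC_apply, Complex.conj_conj]
  ring

theorem ip_conjH (u v : H) : ip (conjH u) (conjH v) = ip v u := by
  unfold ip
  rw [L2.inner_def, L2.inner_def]
  refine integral_congr_ae ?_
  filter_upwards [conjH_ae u, conjH_ae v] with x h1 h2
  rw [h1, h2]
  exact ip_conjC _ _

theorem conjH_smul (z : ℂ) (u : H) : conjH (z • u) = conj z • conjH u := by
  apply Lp.ext
  filter_upwards [conjH_ae u, conjH_ae (z • u), Lp.coeFn_smul z u, Lp.coeFn_smul (conj z) (conjH u)]
    with x h1 h2 h3 h4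
  rw [h4, h2, h3, Pi.smul_apply, Pi.smul_apply, h1]
  ext i
  simp [conjC_apply]

theorem ip_comm_of_real {u v : H} (hu : conjH u = u) (hv : conjH v = v) : ip u v = ip v u := by
  conv_lhs => rw [← hu, ← hv]
  exact ip_conjH u v

/-! ## The symplectic matrix -/

theorem matC_apply (M : Matrix (Fin 2) (Fin 2) ℂ) (c : C2) (i : Fin 2) :
    matC M c i = M i 0 * c 0 + M i 1 * c 1 := by
  simp [matC, Matrix.mulVec, dotProduct, Fin.sum_univ_two]

theorem Jc_apply_zero (c : C2) : Jc c 0 = c 1 := by simp [Jc, matC_apply, Jmat]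
theorem Jc_apply_one (c : C2) : Jc c 1 = -c 0 := by simp [Jc, matC_apply, Jmat]

theorem Jc_Jc (c : C2) : Jc (Jc c) = -c := by
  ext i; fin_cases i <;> simp [Jc_apply_zero, Jc_apply_one]

theorem ip_Jc_left (c d : C2) : ip (Jc c) d = -ip c (Jc d) := by
  rw [ip_C2, ip_C2]; simp only [Jc_apply_zero, Jc_apply_one, map_neg]; ring

theorem J_ae (u : H) : ∀ᵐ x : R3, J u x = Jc (u x) := matH_ae Jmat u

theorem J_J (u : H) : J (J u) = -u := by
  apply Lp.ext
  filter_upwards [J_ae u, J_ae (J u), Lp.coeFn_neg u] with x h1 h2 h3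
  rw [h2, h1, h3, Jc_Jc, Pi.neg_apply]

theorem ip_J_left (u v : H) : ip (J u) v = -ip u (J v) := by
  unfold ip
  rw [L2.inner_def, L2.inner_def, ← integral_neg]
  refine integral_congr_ae ?_
  filter_upwards [J_ae u, J_ae v] with x h1 h2
  rw [h1, h2]
  exact ip_Jc_left _ _

theorem ip_J_J (u v : H) : ip (J u) (J v) = ip u v := by
  rw [ip_J_left, J_J, ip_neg_right, neg_neg]

theorem J_ten (c : C2) (k : L2R) : J (ten c k) = ten (Jc c) k := matH_ten _ _ _

theorem conjC_Jc (c : C2) : conjC (Jc c) = Jc (conjC c) := by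
  ext i; fin_cases i <;> simp [Jc_apply_zero, Jc_apply_one, conjC_apply]

theorem conjH_J (u : H) : conjH (J u) = J (conjH u) := by
  apply Lp.ext
  filter_upwards [J_ae u, J_ae (conjH u), conjH_ae (J u), conjH_ae u] with x h1 h2 h3 h4
  rw [h2, h3, h1, h4, conjC_Jc]

theorem symp_apply (u v : H) : symp v u = -ip u (J v) := by
  simp [symp, ip]

theorem matH_green (M : Matrix (Fin 2) (Fin 2) ℂ) {a : ℝ} (ha : 0 < a) (c : C2) :
    matH M (green a c) = green a (matC M c) := by
  rw [green_eq ha, green_eq ha, matH_ten]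

theorem J_green {a : ℝ} (ha : 0 < a) (c : C2) : J (green a c) = green a (Jc c) :=
  matH_green _ ha c

theorem green_smul {a : ℝ} (ha : 0 < a) (z : ℂ) (c : C2) : green a (z • c) = z • green a c := by
  rw [green_eq ha, green_eq ha, ten_smul]

end ConcNLS

end

/-! ### Square integrable gradients of e^{-s|x|} and of the regular part of a Green function -/

noncomputable section

namespace ConcNLS

/-! ## Gradient kernels -/

/-- `∂ⱼ e^{-s|x|}`. -/
def expGrad (j : Fin 3) (s : ℝ) (x : R3) : ℝ := -(s * Real.exp (-s * ‖x‖)) * (x j / ‖x‖)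

/-- `∂ⱼ (G - G₀)` for the Green function `G = e^{-a|x|} / (4π|x|)`. -/
def greenGrad (j : Fin 3) (a : ℝ) (x : R3) : ℝ :=
  (1 - (1 + a * ‖x‖) * Real.exp (-a * ‖x‖)) / (4 * Real.pi * ‖x‖ ^ 2) * (x j / ‖x‖)

theorem measurable_expGrad (j : Fin 3) (s : ℝ) : Measurable (expGrad j s) := by
  unfold expGrad; fun_prop

theorem measurable_greenGrad (j : Fin 3) (a : ℝ) : Measurable (greenGrad j a) := by
  unfold greenGrad; fun_prop

theorem abs_coord_le (x : R3) (j : Fin 3) : |x j| ≤ ‖x‖ := PiLp.norm_apply_le x j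

theorem abs_coord_div_le (x : R3) (j : Fin 3) : |x j / ‖x‖| ≤ 1 := by
  rw [abs_div, abs_norm]
  exact div_le_one_of_le₀ (abs_coord_le x j) (norm_nonneg _)

theorem ae_ne_zero : ∀ᵐ x : R3, x ≠ 0 := by
  simp [ae_iff, measure_singleton]

theorem kern_one {x : R3} (hx : x ≠ 0) (s : ℝ) : kern 1 s x = Real.exp (-s * ‖x‖) := by
  have : ‖x‖ ≠ 0 := norm_ne_zero_iff.2 hx
  unfold kern
  field_simp

theorem memLp_exp {s : ℝ} (hs : 0 < s) :
    MemLp (fun x : R3 => Real.exp (-s * ‖x‖)) 2 (volume : Measure R3) := by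
  refine (memLp_congr_ae ?_).1 (memLp_kern 1 hs)
  filter_upwards [ae_ne_zero] with x hx using kern_one hx s

theorem abs_expGrad_le (j : Fin 3) {s : ℝ} (hs : 0 ≤ s) (x : R3) :
    |expGrad j s x| ≤ s * Real.exp (-s * ‖x‖) := by
  unfold expGrad
  rw [abs_mul, abs_neg, abs_of_nonneg (by positivity)]
  exact mul_le_of_le_one_right (by positivity) (abs_coord_div_le x j)

theorem memLp_expGrad (j : Fin 3) {s : ℝ} (hs : 0 < s) :
    MemLp (expGrad j s) 2 (volume : Measure R3) := by
  refine (memLp_exp hs).of_le_mul (c := s) (measurable_expGrad j s).aestronglyMeasurable ?_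
  refine Eventually.of_forall fun x => ?_
  rw [Real.norm_eq_abs, Real.norm_of_nonneg (Real.exp_pos _).le]
  exact abs_expGrad_le j hs.le x

/-- Used with y = a|x|: the bound y² controls small |x| and the limit a → 0, the bound 1 gives the
decay |x|^{-2} at infinity. -/
theorem one_sub_bounds {y : ℝ} (hy : 0 ≤ y) :
    0 ≤ 1 - (1 + y) * Real.exp (-y) ∧ 1 - (1 + y) * Real.exp (-y) ≤ y ^ 2 ∧
      1 - (1 + y) * Real.exp (-y) ≤ 1 := by
  refine ⟨?_, ?_, ?_⟩
  · have h1 := Real.add_one_le_exp y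
    have h2 : Real.exp y * Real.exp (-y) = 1 := by rw [← Real.exp_add]; simp
    nlinarith [Real.exp_pos (-y)]
  · have h1 := Real.add_one_le_exp (-y)
    nlinarith
  · have := Real.exp_pos (-y)
    nlinarith

theorem abs_greenGrad_le_sq (j : Fin 3) {a : ℝ} (ha : 0 ≤ a) (x : R3) :
    |greenGrad j a x| ≤ a ^ 2 := by
  rcases eq_or_ne x 0 with rfl | hx
  · simp [greenGrad]; positivity
  have hr : 0 < ‖x‖ := norm_pos_iff.2 hx
  obtain ⟨h0, h1, -⟩ := one_sub_bounds (mul_nonneg ha hr.le)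
  unfold greenGrad
  rw [abs_mul, neg_mul, abs_of_nonneg (by positivity)]
  have hpi := Real.pi_gt_three
  calc _ ≤ (a * ‖x‖) ^ 2 / (1 * ‖x‖ ^ 2) * 1 := by
        gcongr
        · linarith
        · exact abs_coord_div_le x j
    _ = a ^ 2 := by field_simp

/-- A single majorant serves all rates in [0,C], both for square integrability and for dominated
convergence as a → 0. -/
theorem abs_greenGrad_le (j : Fin 3) {a C : ℝ} (ha : 0 ≤ a) (haC : a ≤ C) (hC : 1 ≤ C) (x : R3) :
    |greenGrad j a x| ≤ 4 * C ^ 2 * (1 + ‖x‖) ^ (-2 : ℝ) := by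
  rw [Real.rpow_neg (by positivity), Real.rpow_two]
  rcases le_or_gt ‖x‖ 1 with h | h
  · refine (abs_greenGrad_le_sq j ha x).trans ?_
    have : (1 + ‖x‖) ^ 2 ≤ 4 := by nlinarith [norm_nonneg x]
    rw [← div_eq_mul_inv, le_div_iff₀ (by positivity)]
    nlinarith [pow_le_pow_left₀ ha haC 2, sq_nonneg a]
  · have hr : 0 < ‖x‖ := by linarith
    obtain ⟨h0, -, h1⟩ := one_sub_bounds (mul_nonneg ha hr.le)
    unfold greenGrad
    rw [abs_mul, neg_mul, abs_of_nonneg (by positivity)]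
    have hpi := Real.pi_gt_three
    calc _ ≤ 1 / (1 * ‖x‖ ^ 2) * 1 := by
          gcongr
          · linarith
          · exact abs_coord_div_le x j
      _ ≤ 4 * ((1 + ‖x‖) ^ 2)⁻¹ := by
          rw [← div_eq_mul_inv, mul_one, one_mul, div_le_div_iff₀ (by positivity) (by positivity)]
          nlinarith
      _ ≤ _ := by
          gcongr
          nlinarith

theorem memLp_japanese :
    MemLp (fun x : R3 => (1 + ‖x‖) ^ (-2 : ℝ)) 2 (volume : Measure R3) := by
  have hm : Measurable fun x : R3 => (1 + ‖x‖) ^ (-2 : ℝ) := by fun_prop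
  rw [memLp_two_iff_integrable_sq_norm hm.aestronglyMeasurable]
  have := integrable_one_add_norm (E := R3) (μ := volume) (r := 4) (by simp; norm_num)
  refine this.congr (Eventually.of_forall fun x => ?_)
  simp only
  rw [Real.norm_of_nonneg (by positivity), ← Real.rpow_natCast, ← Real.rpow_mul (by positivity)]
  norm_num

theorem memLp_greenGrad (j : Fin 3) {a : ℝ} (ha : 0 ≤ a) :
    MemLp (greenGrad j a) 2 (volume : Measure R3) := by
  refine memLp_japanese.of_le_mul (c := 4 * (max a 1) ^ 2)
    (measurable_greenGrad j a).aestronglyMeasurable ?_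
  refine Eventually.of_forall fun x => ?_
  rw [Real.norm_eq_abs, Real.norm_of_nonneg (by positivity)]
  exact abs_greenGrad_le j ha (le_max_left _ _) (le_max_right _ _) x

/-- `∂ⱼ e^{-s|x|}` as a square integrable function (for `s > 0`). -/
def expGradL (j : Fin 3) (s : ℝ) : L2R :=
  if h : 0 < s then (memLp_expGrad j h).toLp (expGrad j s) else 0

/-- `∂ⱼ (G - G₀)` as a square integrable function (for `a ≥ 0`). -/
def greenGradL (j : Fin 3) (a : ℝ) : L2R :=
  if h : 0 ≤ a then (memLp_greenGrad j h).toLp (greenGrad j a) else 0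

theorem expGradL_ae (j : Fin 3) {s : ℝ} (hs : 0 < s) : ∀ᵐ x : R3, expGradL j s x = expGrad j s x := by
  unfold expGradL; rw [dif_pos hs]; exact MemLp.coeFn_toLp _

theorem greenGradL_ae (j : Fin 3) {a : ℝ} (ha : 0 ≤ a) :
    ∀ᵐ x : R3, greenGradL j a x = greenGrad j a x := by
  unfold greenGradL; rw [dif_pos ha]; exact MemLp.coeFn_toLp _

/-- Since ∂_a(e^{-ar}/(4πr)) = -e^{-ar}/(4π), differentiating the gradient of the Green function in
the rate gives -1/(4π) times the gradient of the exponential. -/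
theorem greenGrad_sub_linear_le (j : Fin 3) {δ a b : ℝ} (hδ : 0 < δ) (ha : δ ≤ a) (hb : δ ≤ b)
    {x : R3} (hx : x ≠ 0) :
    |greenGrad j b x - greenGrad j a x - (b - a) * (-(1 / (4 * Real.pi)) * expGrad j a x)|
      ≤ 2 * Real.exp (-(δ / 2) * ‖x‖) * (b - a) ^ 2 := by
  have hr : 0 < ‖x‖ := norm_pos_iff.2 hx
  have hpi := Real.pi_gt_three
  refine abs_sub_linear_le (f := fun b => greenGrad j b x)
    (f' := fun b => -(1 / (4 * Real.pi)) * expGrad j b x)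
    (f'' := fun b => 1 / (4 * Real.pi) * ((1 - b * ‖x‖) * Real.exp (-b * ‖x‖)) * (x j / ‖x‖))
    (δ := δ) ?_ ?_ ?_ ha hb
  · intro b _
    have h1 : HasDerivAt (fun b : ℝ => Real.exp (-b * ‖x‖)) (Real.exp (-b * ‖x‖) * (-1 * ‖x‖)) b :=
      ((hasDerivAt_id b).neg.mul_const ‖x‖).exp
    have h2 : HasDerivAt (fun b : ℝ => 1 + b * ‖x‖) (1 * ‖x‖) b :=
      ((hasDerivAt_id b).mul_const ‖x‖).const_add 1
    refine ((((h2.mul h1).const_sub 1).div_const (4 * Real.pi * ‖x‖ ^ 2)).mul_const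
      (x j / ‖x‖)).congr_deriv ?_
    unfold expGrad
    field_simp
    ring
  · intro b _
    have h1 : HasDerivAt (fun b : ℝ => Real.exp (-b * ‖x‖)) (Real.exp (-b * ‖x‖) * (-1 * ‖x‖)) b :=
      ((hasDerivAt_id b).neg.mul_const ‖x‖).exp
    refine (((((hasDerivAt_id b).mul h1).neg).mul_const (x j / ‖x‖)).const_mul
      (-(1 / (4 * Real.pi)))).congr_deriv ?_
    simp only [id]
    ring
  · intro b hb
    rw [abs_mul, abs_mul, abs_mul, abs_of_nonneg (by positivity : 0 ≤ 1 / (4 * Real.pi)),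
      abs_of_nonneg (Real.exp_pos _).le]
    have hb0 : 0 < b := by linarith
    have hy : 0 ≤ b * ‖x‖ := by positivity
    -- Half of the exponential decay is spent on the factor 1 - b|x|; the rate b/2 ≥ δ/2 remains.
    have h1 : |1 - b * ‖x‖| ≤ 2 * Real.exp (b * ‖x‖ / 2) := by
      have := Real.add_one_le_exp (b * ‖x‖ / 2)
      rw [abs_le]; constructor <;> linarith
    calc _ ≤ 1 * (2 * Real.exp (b * ‖x‖ / 2) * Real.exp (-b * ‖x‖)) * 1 := by
          gcongr
          · rw [div_le_one (by positivity)]; linarith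
          · exact abs_coord_div_le x j
      _ = 2 * Real.exp (-(b / 2) * ‖x‖) := by
          rw [one_mul, mul_one, mul_assoc, ← Real.exp_add]; ring_nf
      _ ≤ _ := by gcongr

theorem hasDerivAt_greenGradL (j : Fin 3) {a : ℝ} (ha : 0 < a) :
    HasDerivAt (greenGradL j) (-(1 / (4 * Real.pi)) • expGradL j a) a := by
  refine hasDerivAt_L2R (B := (2 : ℝ) • kernL 1 (a / 2 / 2)) ?_
  filter_upwards [lt_mem_nhds (show a / 2 < a by linarith)] with b hb
  filter_upwards [greenGradL_ae j ha.le, greenGradL_ae j (show 0 ≤ b by linarith),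
    expGradL_ae j ha, kernL_ae 1 (show 0 < a / 2 / 2 by linarith),
    Lp.coeFn_smul (-(1 / (4 * Real.pi))) (expGradL j a),
    Lp.coeFn_smul (2 : ℝ) (kernL 1 (a / 2 / 2)), ae_ne_zero] with x h1 h2 h3 h4 h5 h6 h7
  rw [h5, h6, Pi.smul_apply, Pi.smul_apply, h1, h2, h3, h4, kern_one h7, smul_eq_mul, smul_eq_mul]
  exact greenGrad_sub_linear_le j (by linarith) (by linarith) hb.le h7

theorem norm_kernL_one {s : ℝ} (hs : 0 < s) : ‖kernL 1 s‖ ^ 2 = Real.pi / s ^ 3 := by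
  rw [← real_inner_self_eq_norm_sq, L2.inner_def]
  have h1 : ∫ x : R3, inner ℝ (kernL 1 s x) (kernL 1 s x) = ∫ x : R3,
      (fun r : ℝ => Real.exp (-(2 * s) * r)) ‖x‖ := by
    refine integral_congr_ae ?_
    filter_upwards [kernL_ae 1 hs, ae_ne_zero] with x h1 h2
    rw [h1, kern_one h2, inner_real_eq, ← Real.exp_add]
    ring_nf
  rw [h1, integral_radial fun r : ℝ => Real.exp (-(2 * s) * r),
    integral_pow_mul_exp (by linarith) 2]
  simp [Nat.factorial]
  field_simp
  ring

theorem norm_expGradL_le (j : Fin 3) {s : ℝ} (hs : 0 < s) : ‖expGradL j s‖ ≤ s * ‖kernL 1 s‖ := by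
  refine Lp.norm_le_mul_norm_of_ae_le_mul ?_
  filter_upwards [expGradL_ae j hs, kernL_ae 1 hs, ae_ne_zero] with x h1 h2 h3
  rw [h1, h2, kern_one h3, Real.norm_eq_abs, Real.norm_of_nonneg (Real.exp_pos _).le]
  exact abs_expGrad_le j hs.le x

/-- The norm is at most s‖e^{-s|x|}‖ = √(π/s). This decay is what makes the charge unique. -/
theorem tendsto_norm_expGradL (j : Fin 3) :
    Tendsto (fun s => ‖expGradL j s‖) atTop (𝓝 0) := by
  have h1 : Tendsto (fun s : ℝ => √(Real.pi / s)) atTop (𝓝 0) := by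
    have := (tendsto_const_nhds (x := Real.pi)).div_atTop tendsto_id
    have h := (Real.continuous_sqrt.tendsto _).comp this
    rw [Real.sqrt_zero] at h
    exact h
  refine squeeze_zero' (Eventually.of_forall fun s => norm_nonneg _) ?_ h1
  filter_upwards [eventually_gt_atTop 0] with s hs
  refine (norm_expGradL_le j hs).trans (le_of_eq ?_)
  symm
  rw [Real.sqrt_eq_iff_mul_self_eq (by positivity) (by positivity)]
  calc _ = s ^ 2 * ‖kernL 1 s‖ ^ 2 := by rw [norm_kernL_one hs]; field_simp
    _ = _ := by ring

/-- By duality: u is paired with k c, where c is the moment itself, and Cauchy–Schwarz in L²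
applies. -/
theorem norm_mom_le (k : L2R) (u : H) : ‖mom k u‖ ≤ ‖k‖ * ‖u‖ := by
  have h : ∀ c : C2, ‖ten c k‖ ≤ ‖c‖ * ‖k‖ := fun c => by
    refine Lp.norm_le_mul_norm_of_ae_le_mul ?_
    filter_upwards [ten_ae c k] with x hx
    rw [hx, norm_smul, mul_comm]
  by_cases h0 : mom k u = 0
  · rw [h0, norm_zero]; positivity
  have h1 : ‖mom k u‖ ^ 2 = ‖ip u (ten (mom k u) k)‖ := by
    rw [ip_ten, ip, inner_self_eq_norm_sq_to_K]
    simp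
  have h2 : ‖ip u (ten (mom k u) k)‖ ≤ ‖ten (mom k u) k‖ * ‖u‖ := norm_inner_le_norm _ _
  have h3 := h (mom k u)
  have h4 : 0 < ‖mom k u‖ := norm_pos_iff.2 h0
  have h5 : ‖mom k u‖ * ‖mom k u‖ ≤ ‖mom k u‖ * (‖k‖ * ‖u‖) := by
    nlinarith [norm_nonneg u]
  exact le_of_mul_le_mul_left h5 h4

end ConcNLS

end

/-! ### Weak gradients of radial functions; exponentials and Green functions belong to V -/

noncomputable section

namespace ConcNLS

open scoped ContDiff

/-! ## Regularised norms -/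

/-- The smooth function `√(|x|² + ε²)`. -/
def rho (ε : ℝ) (x : R3) : ℝ := √(‖x‖ ^ 2 + ε ^ 2)

theorem rho_pos {ε : ℝ} (hε : 0 < ε) (x : R3) : 0 < rho ε x := Real.sqrt_pos.2 (by positivity)

theorem norm_le_rho (ε : ℝ) (x : R3) : ‖x‖ ≤ rho ε x := by
  unfold rho
  exact Real.le_sqrt_of_sq_le (by nlinarith [sq_nonneg ε])

theorem le_rho {ε : ℝ} (x : R3) : ε ≤ rho ε x := by
  unfold rho
  exact Real.le_sqrt_of_sq_le (by nlinarith [sq_nonneg ‖x‖])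

theorem contDiff_rho {ε : ℝ} (hε : 0 < ε) : ContDiff ℝ ∞ (rho ε) :=
  ((contDiff_id.norm_sq ℝ).add contDiff_const).sqrt fun x => by positivity

theorem hasFDerivAt_rho {ε : ℝ} (hε : 0 < ε) (x : R3) :
    HasFDerivAt (rho ε) ((1 / rho ε x) • innerSL ℝ x) x := by
  have := (((hasFDerivAt_id x).norm_sq).add_const (ε ^ 2)).sqrt (by simp only [id]; positivity)
  refine this.congr_fderiv ?_
  ext v
  simp [rho]
  ring

theorem tendsto_rho {ι : Type*} {l : Filter ι} {ε : ι → ℝ} (h : Tendsto ε l (𝓝 0)) (x : R3) :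
    Tendsto (fun i => rho (ε i) x) l (𝓝 ‖x‖) := by
  have h1 : Continuous fun e : ℝ => √(‖x‖ ^ 2 + e ^ 2) := by fun_prop
  have h2 := (h1.tendsto 0).comp h
  rw [zero_pow two_ne_zero, add_zero, Real.sqrt_sq (norm_nonneg x)] at h2
  exact h2

/-- The coordinate vectors. -/
abbrev eb (j : Fin 3) : R3 := EuclideanSpace.single j 1

theorem hasFDerivAt_coord (j : Fin 3) (x : R3) :
    HasFDerivAt (fun x : R3 => x j) (EuclideanSpace.proj (𝕜 := ℝ) j) x :=
  (EuclideanSpace.proj (𝕜 := ℝ) (ι := Fin 3) j).hasFDerivAt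

theorem innerSL_eb (x : R3) (j : Fin 3) : innerSL ℝ x (eb j) = x j := by
  simp [eb, EuclideanSpace.inner_single_right]

theorem abs_coord_div_rho_le (ε : ℝ) (x : R3) (j : Fin 3) : |x j / rho ε x| ≤ 1 := by
  rw [abs_div, abs_of_nonneg (a := rho ε x) (Real.sqrt_nonneg _)]
  exact div_le_one_of_le₀ ((abs_coord_le x j).trans (norm_le_rho ε x)) (Real.sqrt_nonneg _)

/-! ## Weak gradients of radial functions -/

theorem HasWeakGradient.congr {φ ψ : R3 → C2} {D : Fin 3 → H} (h : HasWeakGradient φ D)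
    (hψ : φ =ᵐ[volume] ψ) : HasWeakGradient ψ D := by
  refine ⟨h.1.congr hψ, fun η j => ?_⟩
  rw [← h.2 η j]
  refine integral_congr_ae ?_
  filter_upwards [hψ] with x hx
  rw [hx]

theorem integrable_schwartz_fderiv (η : 𝓢(R3, ℂ)) (v : R3) :
    Integrable fun x => fderiv ℝ (η : R3 → ℂ) x v := by
  have h : Integrable fun x => fderiv ℝ (η : R3 → ℂ) x :=
    (SchwartzMap.fderivCLM ℝ R3 ℂ η).integrable
  exact ((ContinuousLinearMap.apply ℝ ℂ v).integrable_comp h)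

/-- A bounded radial function with bounded continuous radial derivative is weakly differentiable. -/
theorem hasWeakGradient_radial {p p' : ℝ → ℝ} {C : ℝ} (hp : ∀ r, 0 < r → HasDerivAt p (p' r) r)
    (hpC : ∀ r, 0 < r → |p r| ≤ C) (hp'C : ∀ r, 0 < r → |p' r| ≤ C)
    (hcont : ContinuousOn p' (Ioi 0)) (hm : Measurable p) (hm' : Measurable p') (c : C2)
    {D : Fin 3 → H} (hD : ∀ j, ∀ᵐ x : R3, D j x = (p' ‖x‖ * (x j / ‖x‖)) • c) :
    HasWeakGradient (fun x => p ‖x‖ • c) D := by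
  have hbd : ∀ᵐ x : R3, ‖p ‖x‖ • c‖ ≤ C * ‖c‖ := by
    filter_upwards [ae_ne_zero] with x hx
    rw [norm_smul]
    gcongr
    exact hpC _ (norm_pos_iff.2 hx)
  have hmeas : Measurable fun x : R3 => p ‖x‖ • c := by fun_prop
  refine ⟨(memLp_top_of_bound hmeas.aestronglyMeasurable (C * ‖c‖) hbd).locallyIntegrable le_top,
    fun η j => ?_⟩
  -- Replacing |x| by √(|x|²+ε²), positive even at the origin, makes the radial function
  -- differentiable everywhere. Classical integration by parts applies for each ε, and ε → 0 by
  -- domination with the constant C.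
  let ε : ℕ → ℝ := fun n => 1 / ((n : ℝ) + 1)
  have hε : ∀ n, 0 < ε n := fun n => by positivity
  have hε0 : Tendsto ε atTop (𝓝 0) := tendsto_one_div_add_atTop_nhds_zero_nat
  have hfd : ∀ n x, HasFDerivAt (fun y => p (rho (ε n) y) • c)
      ((p' (rho (ε n) x) • ((1 / rho (ε n) x) • innerSL ℝ x)).smulRight c) x := fun n x =>
    ((hp _ (rho_pos (hε n) x)).comp_hasFDerivAt x (hasFDerivAt_rho (hε n) x)).smul_const c
  have hfde : ∀ n x, fderiv ℝ (fun y => p (rho (ε n) y) • c) x (eb j)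
      = (p' (rho (ε n) x) * (x j / rho (ε n) x)) • c := by
    intro n x
    rw [(hfd n x).fderiv]
    simp only [ContinuousLinearMap.smulRight_apply, _root_.smul_apply, innerSL_eb,
      smul_eq_mul]
    congr 1
    ring
  have hmr : ∀ n, Measurable (rho (ε n)) := fun n => (contDiff_rho (hε n)).continuous.measurable
  have hm1 : ∀ n, Measurable fun x : R3 => p (rho (ε n) x) • c := fun n =>
    (hm.comp (hmr n)).smul_const c
  have hm2 : ∀ n, Measurable fun x : R3 => (p' (rho (ε n) x) * (x j / rho (ε n) x)) • c := fun n =>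
    (((hm'.comp (hmr n)).mul ((by fun_prop : Measurable fun x : R3 => x j).div (hmr n)))).smul_const c
  have hb1 : ∀ n x, ‖p (rho (ε n) x) • c‖ ≤ C * ‖c‖ := fun n x => by
    rw [norm_smul]
    gcongr
    exact hpC _ (rho_pos (hε n) x)
  have hb2 : ∀ n x, ‖(p' (rho (ε n) x) * (x j / rho (ε n) x)) • c‖ ≤ C * ‖c‖ := fun n x => by
    rw [norm_smul, norm_mul]
    gcongr
    refine (mul_le_of_le_one_right (norm_nonneg _) (abs_coord_div_rho_le _ _ _)).trans ?_
    exact hp'C _ (rho_pos (hε n) x)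
  have hi := η.integrable (μ := volume)
  have hi' := integrable_schwartz_fderiv η (eb j)
  have key : ∀ n, ∫ x, fderiv ℝ (η : R3 → ℂ) x (eb j) • (p (rho (ε n) x) • c)
      = -∫ x, η x • ((p' (rho (ε n) x) * (x j / rho (ε n) x)) • c) := by
    intro n
    have := integral_smul_fderiv_eq_neg_fderiv_smul_of_integrable (μ := (volume : Measure R3))
      (f := (η : R3 → ℂ)) (g := fun y => p (rho (ε n) y) • c) (v := eb j)
      (hi'.smul_bdd _ (hm1 n).aestronglyMeasurable (Eventually.of_forall (hb1 n)))
      (by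
        simp only [hfde]
        exact hi.smul_bdd _ (hm2 n).aestronglyMeasurable (Eventually.of_forall (hb2 n)))
      (hi.smul_bdd _ (hm1 n).aestronglyMeasurable (Eventually.of_forall (hb1 n)))
      (fun x _ => η.differentiableAt) (fun x _ => (hfd n x).differentiableAt)
    simp only [hfde] at this
    rw [this, neg_neg]
  have lim1 : Tendsto (fun n => ∫ x, fderiv ℝ (η : R3 → ℂ) x (eb j) • (p (rho (ε n) x) • c)) atTop
      (𝓝 (∫ x, fderiv ℝ (η : R3 → ℂ) x (eb j) • (p ‖x‖ • c))) := by
    refine tendsto_integral_of_dominated_convergence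
      (fun x => ‖fderiv ℝ (η : R3 → ℂ) x (eb j)‖ * (C * ‖c‖))
      (fun n => hi'.aestronglyMeasurable.smul (hm1 n).aestronglyMeasurable)
      (hi'.norm.mul_const _) (fun n => Eventually.of_forall fun x => ?_) ?_
    · rw [norm_smul]
      gcongr
      exact hb1 n x
    · filter_upwards [ae_ne_zero] with x hx
      exact ((((hp _ (norm_pos_iff.2 hx)).continuousAt.tendsto.comp
        (tendsto_rho hε0 x))).smul_const c).const_smul _
  have lim2 : Tendsto (fun n => ∫ x, η x • ((p' (rho (ε n) x) * (x j / rho (ε n) x)) • c)) atTop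
      (𝓝 (∫ x, η x • D j x)) := by
    have : ∫ x, η x • D j x = ∫ x, η x • ((p' ‖x‖ * (x j / ‖x‖)) • c) := by
      refine integral_congr_ae ?_
      filter_upwards [hD j] with x hx
      rw [hx]
    rw [this]
    refine tendsto_integral_of_dominated_convergence
      (fun x => ‖η x‖ * (C * ‖c‖))
      (fun n => hi.aestronglyMeasurable.smul (hm2 n).aestronglyMeasurable)
      (hi.norm.mul_const _) (fun n => Eventually.of_forall fun x => ?_) ?_
    · rw [norm_smul]
      gcongr
      exact hb2 n x
    · filter_upwards [ae_ne_zero] with x hx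
      have hx' := norm_pos_iff.2 hx
      exact (((((hcont.continuousAt (Ioi_mem_nhds hx')).tendsto.comp
        (tendsto_rho hε0 x))).mul (tendsto_const_nhds.div (tendsto_rho hε0 x) hx'.ne')).smul_const
          c).const_smul _
  simp only [key] at lim1
  exact tendsto_nhds_unique lim1 lim2.neg

theorem isDecomposition_exp {a : ℝ} (ha : 0 < a) (c : C2) :
    IsDecomposition (ten c (kernL 1 a)) 0 (fun j => ten c (expGradL j a)) := by
  have := hasWeakGradient_radial (p := fun r => Real.exp (-a * r))
    (p' := fun r => -(a * Real.exp (-a * r))) (C := max 1 a) (fun r _ => by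
      refine ((((hasDerivAt_id r).const_mul (-a)).exp)).congr_deriv ?_
      simp only [id]; ring)
    (fun r hr => by
      rw [abs_of_nonneg (Real.exp_pos _).le]
      refine le_max_of_le_left (Real.exp_le_one_iff.2 ?_)
      nlinarith)
    (fun r hr => by
      rw [abs_neg, abs_of_nonneg (by positivity)]
      refine le_max_of_le_right (mul_le_of_le_one_right ha.le (Real.exp_le_one_iff.2 ?_))
      nlinarith)
    (by fun_prop) (by fun_prop) (by fun_prop) c (D := fun j => ten c (expGradL j a)) (fun j => by
      filter_upwards [ten_ae c (expGradL j a), expGradL_ae j ha] with x h1 h2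
      rw [h1, h2, expGrad])
  refine this.congr ?_
  filter_upwards [ten_ae c (kernL 1 a), kernL_ae 1 ha, ae_ne_zero] with x h1 h2 h3
  rw [h1, h2, kern_one h3, smul_zero, sub_zero]

/-- Subtracting G₀ removes the pole: the regular part (e^{-ar}-1)/(4πr) and its radial derivative
are bounded by a and a². -/
theorem isDecomposition_green {a : ℝ} (ha : 0 < a) (c : C2) :
    IsDecomposition (green a c) c (fun j => ten c (greenGradL j a)) := by
  have hpi := Real.pi_gt_three
  have := hasWeakGradient_radial (p := fun r => (Real.exp (-a * r) - 1) / (4 * Real.pi * r))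
    (p' := fun r => (1 - (1 + a * r) * Real.exp (-a * r)) / (4 * Real.pi * r ^ 2))
    (C := max a (a ^ 2)) (fun r hr => by
      have h1 : HasDerivAt (fun r => Real.exp (-a * r) - 1) (Real.exp (-a * r) * (-a * 1)) r :=
        (((hasDerivAt_id r).const_mul (-a)).exp).sub_const 1
      refine (h1.div ((hasDerivAt_id r).const_mul (4 * Real.pi)) (by simp; positivity)).congr_deriv
        ?_
      simp only [id]
      field_simp
      ring)
    (fun r hr => by
      refine le_max_of_le_left ?_
      have h1 := Real.add_one_le_exp (-a * r)
      have h2 : Real.exp (-a * r) ≤ 1 := Real.exp_le_one_iff.2 (by nlinarith)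
      rw [abs_div, abs_of_nonneg (by positivity : 0 ≤ 4 * Real.pi * r), div_le_iff₀ (by positivity),
        abs_le]
      have : 0 < a * r := by positivity
      constructor <;> nlinarith)
    (fun r hr => by
      refine le_max_of_le_right ?_
      obtain ⟨h0, h1, -⟩ := one_sub_bounds (mul_nonneg ha.le hr.le)
      rw [neg_mul, abs_of_nonneg (by positivity), div_le_iff₀ (by positivity)]
      refine h1.trans ?_
      have : 0 < a ^ 2 * r ^ 2 := by positivity
      nlinarith)
    (ContinuousOn.div (by fun_prop) (by fun_prop) fun r hr => by
      have : (0 : ℝ) < r := hr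
      positivity)
    (by fun_prop) (by fun_prop) c (D := fun j => ten c (greenGradL j a)) (fun j => by
      filter_upwards [ten_ae c (greenGradL j a), greenGradL_ae j ha.le] with x h1 h2
      rw [h1, h2, greenGrad])
  refine this.congr ?_
  filter_upwards [green_ae_eq ha c] with x h1
  rw [h1, ← sub_smul]
  congr 1
  simp only [yukawa, neg_zero, zero_mul, Real.exp_zero]
  ring

end ConcNLS

end

/-! ### Integration by parts against exponentials -/

noncomputable section

namespace ConcNLS

open scoped ContDiff

/-! ## Exponentially decaying test functions -/

theorem HasWeakGradient.test_compact {φ : R3 → C2} {D : Fin 3 → H} (h : HasWeakGradient φ D)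
    {g : R3 → ℝ} (hg : ContDiff ℝ ∞ g) (hc : HasCompactSupport g) (j : Fin 3) :
    ∫ x, fderiv ℝ g x (eb j) • φ x = -∫ x, g x • D j x := by
  have hc' : HasCompactSupport fun x => (g x : ℂ) :=
    hc.comp_left (g := fun r : ℝ => (r : ℂ)) Complex.ofReal_zero
  have hg' : ContDiff ℝ ∞ fun x => (g x : ℂ) := Complex.ofRealCLM.contDiff.comp hg
  have h1 := h.2 (hc'.toSchwartzMap hg') j
  have h2 : ((hc'.toSchwartzMap hg' : 𝓢(R3, ℂ)) : R3 → ℂ) = fun x => (g x : ℂ) := by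
    funext x
    exact HasCompactSupport.toSchwartzMap_toFun hc' hg' x
  have h3 : ∀ x, fderiv ℝ (fun x => (g x : ℂ)) x (eb j) = ((fderiv ℝ g x (eb j) : ℝ) : ℂ) := by
    intro x
    have := Complex.ofRealCLM.hasFDerivAt.comp x (hg.differentiable (by simp) x).hasFDerivAt
    rw [show (fun x => (g x : ℂ)) = Complex.ofRealCLM ∘ g from rfl, this.fderiv]
    rfl
  rw [h2] at h1
  simpa only [h3, Complex.coe_smul] using h1

/-- The test function is cut off by θ(δx) with δ → 0; the derivative falling on the cutoff carries a
factor δ and disappears in the limit. Only η and one partial derivative need decay, so no Schwartz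
seminorms have to be estimated. -/
theorem HasWeakGradient.test_exp {φ : R3 → C2} {D : Fin 3 → H} (h : HasWeakGradient φ D)
    {s C : ℝ} (hs : 0 < s) (hφ : Integrable fun x => Real.exp (-s * ‖x‖) • φ x)
    {η : R3 → ℝ} (hη : ContDiff ℝ ∞ η) (h0 : ∀ x, |η x| ≤ C * Real.exp (-s * ‖x‖)) (j : Fin 3)
    (h1 : ∀ x, |fderiv ℝ η x (eb j)| ≤ C * Real.exp (-s * ‖x‖)) :
    ∫ x, fderiv ℝ η x (eb j) • φ x = -∫ x, η x • D j x := by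
  let θ : ContDiffBump (0 : R3) := ⟨1, 2, one_pos, one_lt_two⟩
  have hθs : ContDiff ℝ ∞ (θ : R3 → ℝ) := θ.contDiff
  have hθd : Differentiable ℝ (θ : R3 → ℝ) := hθs.differentiable (by simp)
  obtain ⟨K, hK⟩ := (θ.hasCompactSupport.fderiv ℝ).exists_bound_of_continuous
    (hθs.continuous_fderiv (by simp))
  have hK0 : 0 ≤ K := (norm_nonneg _).trans (hK 0)
  have heb : ‖eb j‖ = 1 := by simp [eb]
  have hK' : ∀ y, |fderiv ℝ (θ : R3 → ℝ) y (eb j)| ≤ K := fun y => by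
    have := (fderiv ℝ (θ : R3 → ℝ) y).le_opNorm (eb j)
    rw [heb, mul_one] at this
    exact this.trans (hK y)
  have hC0 : 0 ≤ C := by
    have := (abs_nonneg _).trans (h0 0)
    simpa using this
  let δ : ℕ → ℝ := fun n => 1 / ((n : ℝ) + 1)
  have hδ : ∀ n, 0 < δ n := fun n => by positivity
  have hδ1 : ∀ n, δ n ≤ 1 := fun n => by
    have : (0 : ℝ) ≤ n := n.cast_nonneg
    exact div_le_one_of_le₀ (by linarith) (by positivity)
  have hδ0 : Tendsto δ atTop (𝓝 0) := tendsto_one_div_add_atTop_nhds_zero_nat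
  have hδx : ∀ x : R3, Tendsto (fun n => δ n • x) atTop (𝓝 0) := fun x => by
    simpa using hδ0.smul_const x
  let g : ℕ → R3 → ℝ := fun n x => η x * θ (δ n • x)
  have hsm : ∀ n, ContDiff ℝ ∞ (g n) := fun n =>
    hη.mul (hθs.comp (contDiff_id.const_smul (δ n)))
  have hcs : ∀ n, HasCompactSupport (g n) := fun n =>
    (θ.hasCompactSupport.comp_smul (hδ n).ne').mul_left
  have hfd : ∀ n x, fderiv ℝ (g n) x (eb j)
      = fderiv ℝ η x (eb j) * θ (δ n • x) + η x * (δ n * fderiv ℝ (θ : R3 → ℝ) (δ n • x) (eb j)) := by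
    intro n x
    have e1 : HasFDerivAt (fun y : R3 => δ n • y) (δ n • ContinuousLinearMap.id ℝ R3) x :=
      (hasFDerivAt_id x).const_smul (δ n)
    have e2 := (hθd (δ n • x)).hasFDerivAt.comp x e1
    have e3 := ((hη.differentiable (by simp) x).hasFDerivAt).mul e2
    rw [show g n = η * ((θ : R3 → ℝ) ∘ fun y => δ n • y) from rfl, e3.fderiv]
    simp only [_root_.add_apply, _root_.smul_apply, ContinuousLinearMap.comp_apply,
      ContinuousLinearMap.id_apply, map_smul, smul_eq_mul, Function.comp]
    ring
  have hbd : ∀ n x, |fderiv ℝ (g n) x (eb j)| ≤ (C + C * K) * Real.exp (-s * ‖x‖) := by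
    intro n x
    rw [hfd]
    have e1 : |θ (δ n • x)| ≤ 1 := by rw [abs_of_nonneg θ.nonneg]; exact θ.le_one
    have e2 : |δ n * fderiv ℝ (θ : R3 → ℝ) (δ n • x) (eb j)| ≤ K := by
      rw [abs_mul, abs_of_pos (hδ n)]
      calc _ ≤ 1 * K := by gcongr; exacts [hδ1 n, hK' _]
        _ = K := one_mul K
    calc _ ≤ |fderiv ℝ η x (eb j) * θ (δ n • x)|
          + |η x * (δ n * fderiv ℝ (θ : R3 → ℝ) (δ n • x) (eb j))| := abs_add_le _ _
      _ ≤ C * Real.exp (-s * ‖x‖) * 1 + C * Real.exp (-s * ‖x‖) * K := by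
          rw [abs_mul, abs_mul (η x)]
          gcongr
          exacts [h1 x, h0 x]
      _ = _ := by ring
  have key := fun n => h.test_compact (hsm n) (hcs n) j
  have lim1 : Tendsto (fun n => ∫ x, fderiv ℝ (g n) x (eb j) • φ x) atTop
      (𝓝 (∫ x, fderiv ℝ η x (eb j) • φ x)) := by
    refine tendsto_integral_of_dominated_convergence
      (fun x => (C + C * K) * ‖Real.exp (-s * ‖x‖) • φ x‖)
      (fun n => ?_) (hφ.norm.const_mul _) (fun n => Eventually.of_forall fun x => ?_) ?_
    · have : Continuous fun x => fderiv ℝ (g n) x (eb j) :=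
        ((hsm n).continuous_fderiv (by simp)).clm_apply continuous_const
      exact this.aestronglyMeasurable.smul h.1.aestronglyMeasurable
    · rw [norm_smul, norm_smul, Real.norm_of_nonneg (Real.exp_pos _).le, ← mul_assoc]
      gcongr
      exact hbd n x
    · refine Eventually.of_forall fun x => Tendsto.smul_const ?_ _
      simp only [hfd]
      have e1 : Tendsto (fun n => θ (δ n • x)) atTop (𝓝 1) := by
        have := (hθs.continuous.tendsto 0).comp (hδx x)
        rwa [θ.one_of_mem_closedBall (by simp [θ])] at this
      have e2 : Tendsto (fun n => δ n * fderiv ℝ (θ : R3 → ℝ) (δ n • x) (eb j)) atTop (𝓝 0) := by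
        refine squeeze_zero_norm (a := fun n => δ n * K) (fun n => ?_) (by simpa using hδ0.mul_const K)
        rw [Real.norm_eq_abs, abs_mul, abs_of_pos (hδ n)]
        gcongr
        exact hK' _
      simpa using (e1.const_mul (fderiv ℝ η x (eb j))).add (e2.const_mul (η x))
  have lim2 : Tendsto (fun n => ∫ x, g n x • D j x) atTop (𝓝 (∫ x, η x • D j x)) := by
    have hiD : Integrable fun x => Real.exp (-s * ‖x‖) • D j x :=
      memLp_one_iff_integrable.1 ((Lp.memLp (D j)).smul (r := 1) (memLp_exp hs))
    refine tendsto_integral_of_dominated_convergence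
      (fun x => C * ‖Real.exp (-s * ‖x‖) • D j x‖)
      (fun n => ?_) (hiD.norm.const_mul _) (fun n => Eventually.of_forall fun x => ?_) ?_
    · exact (hsm n).continuous.aestronglyMeasurable.smul (Lp.aestronglyMeasurable _)
    · rw [norm_smul, norm_smul, Real.norm_of_nonneg (Real.exp_pos _).le, ← mul_assoc]
      gcongr
      rw [Real.norm_eq_abs, abs_mul, abs_of_nonneg θ.nonneg]
      exact (mul_le_of_le_one_right (abs_nonneg _) θ.le_one).trans (h0 x)
    · refine Eventually.of_forall fun x => Tendsto.smul_const ?_ _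
      have e1 : Tendsto (fun n => θ (δ n • x)) atTop (𝓝 1) := by
        have := (hθs.continuous.tendsto 0).comp (hδx x)
        rwa [θ.one_of_mem_closedBall (by simp [θ])] at this
      simpa using e1.const_mul (η x)
  simp only [key] at lim1
  exact tendsto_nhds_unique lim1 lim2.neg

/-! ## Testing with exponentials -/

theorem kern_mul_yukawa_zero (m : ℕ) (s : ℝ) (x : R3) : kern m s x * yukawa 0 x =
    (fun r : ℝ => Real.exp (-s * r) * r ^ m / r * (1 / (4 * Real.pi * r))) ‖x‖ := by
  simp [kern, yukawa]

theorem integrable_kern_mul_yukawa_zero (m : ℕ) {s : ℝ} (hs : 0 < s) :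
    Integrable fun x : R3 => kern m s x * yukawa 0 x := by
  simp only [kern_mul_yukawa_zero]
  rw [integrable_fun_norm_addHaar (volume : Measure R3)
    (f := fun r : ℝ => Real.exp (-s * r) * r ^ m / r * (1 / (4 * Real.pi * r)))]
  refine IntegrableOn.congr_fun ((integrableOn_pow_mul_exp hs m).const_mul (1 / (4 * Real.pi))) ?_
    measurableSet_Ioi
  intro r hr
  have hr' : r ≠ 0 := ne_of_gt hr
  have := Real.pi_ne_zero
  simp only [finrank_euclideanSpace, Fintype.card_fin, smul_eq_mul]
  field_simp

theorem integral_kern_mul_yukawa_zero (m : ℕ) {s : ℝ} (hs : 0 < s) :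
    ∫ x : R3, kern m s x * yukawa 0 x = m.factorial / s ^ (m + 1) := by
  simp only [kern_mul_yukawa_zero]
  rw [integral_radial fun r : ℝ => Real.exp (-s * r) * r ^ m / r * (1 / (4 * Real.pi * r)),
    ← integral_pow_mul_exp hs m, ← integral_const_mul]
  refine setIntegral_congr_fun measurableSet_Ioi fun r hr => ?_
  have hr' : r ≠ 0 := ne_of_gt hr
  have := Real.pi_ne_zero
  field_simp

theorem integrable_kern_smul_field (m : ℕ) {s : ℝ} (hs : 0 < s) (u : H) :
    Integrable fun x => kern m s x • u x :=
  memLp_one_iff_integrable.1 ((Lp.memLp u).smul (r := 1) (memLp_kern m hs))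

theorem integrable_kern_smul (m : ℕ) {s : ℝ} (hs : 0 < s) (u : H) (q : C2) :
    Integrable fun x => kern m s x • (u x - yukawa 0 x • q) := by
  simp only [smul_sub, smul_smul]
  exact (integrable_kern_smul_field m hs u).sub
    ((integrable_kern_mul_yukawa_zero m hs).smul_const q)

theorem integral_kern_smul (m : ℕ) {s : ℝ} (hs : 0 < s) (u : H) (q : C2) :
    ∫ x, kern m s x • (u x - yukawa 0 x • q)
      = mom (kernL m s) u - (m.factorial / s ^ (m + 1) : ℝ) • q := by
  simp only [smul_sub, smul_smul]
  rw [integral_sub (integrable_kern_smul_field m hs u)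
    ((integrable_kern_mul_yukawa_zero m hs).smul_const q), integral_smul_const,
    integral_kern_mul_yukawa_zero m hs, mom]
  congr 1
  refine integral_congr_ae ?_
  filter_upwards [kernL_ae m hs] with x hx
  rw [hx]

/-- `∂ⱼ² e^{-sy}`, where `y` stands for `|x|` or for a regularised norm. -/
def expHess (j : Fin 3) (s y : ℝ) (x : R3) : ℝ :=
  (s ^ 2 * Real.exp (-s * y) / y + s * Real.exp (-s * y) / y ^ 2) * (x j * (x j / y))
    - s * Real.exp (-s * y) / y

theorem abs_expHess_le (j : Fin 3) {s y : ℝ} (hs : 0 ≤ s) (hy : 0 < y) {x : R3} (hx : ‖x‖ ≤ y) :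
    |expHess j s y x| ≤ s ^ 2 * Real.exp (-s * y) + 2 * s * (Real.exp (-s * y) / y) := by
  have h1 : |x j| ≤ y := (abs_coord_le x j).trans hx
  have h2 : |x j * (x j / y)| ≤ y := by
    rw [abs_mul, abs_div, abs_of_pos hy]
    exact (mul_le_of_le_one_right (abs_nonneg _) (div_le_one_of_le₀ h1 hy.le)).trans h1
  unfold expHess
  refine (abs_sub _ _).trans ?_
  rw [abs_mul, abs_of_nonneg (by positivity :
    0 ≤ s ^ 2 * Real.exp (-s * y) / y + s * Real.exp (-s * y) / y ^ 2),
    abs_of_nonneg (by positivity : 0 ≤ s * Real.exp (-s * y) / y)]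
  calc _ ≤ (s ^ 2 * Real.exp (-s * y) / y + s * Real.exp (-s * y) / y ^ 2) * y
        + s * Real.exp (-s * y) / y := by gcongr
    _ = _ := by field_simp; ring

/-- The bound is uniform in the regularised norm y ≥ |x|, as domination in the limit ε → 0 requires.
-/
theorem abs_expHess_le_kern (j : Fin 3) {s y : ℝ} (hs : 0 ≤ s) {x : R3} (hx0 : x ≠ 0)
    (hx : ‖x‖ ≤ y) : |expHess j s y x| ≤ s ^ 2 * kern 1 s x + 2 * s * kern 0 s x := by
  have hr : 0 < ‖x‖ := norm_pos_iff.2 hx0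
  refine (abs_expHess_le j hs (hr.trans_le hx) hx).trans ?_
  rw [kern_one hx0, kern, pow_zero, mul_one]
  have : Real.exp (-s * y) ≤ Real.exp (-s * ‖x‖) := Real.exp_le_exp.2 (by nlinarith)
  gcongr

/-- This is the radial Laplacian p'' + (2/r)p' of p = e^{-sr} in dimension three. -/
theorem sum_expHess {s : ℝ} {x : R3} (hx : x ≠ 0) :
    ∑ j, expHess j s ‖x‖ x = s ^ 2 * kern 1 s x - 2 * s * kern 0 s x := by
  have hr : 0 < ‖x‖ := norm_pos_iff.2 hx
  have hn : x 0 ^ 2 + x 1 ^ 2 + x 2 ^ 2 = ‖x‖ ^ 2 := by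
    rw [EuclideanSpace.real_norm_sq_eq, Fin.sum_univ_three]
  simp only [Fin.sum_univ_three, expHess]
  rw [kern_one hx, kern, pow_zero, mul_one]
  have : ∀ A B r : ℝ, A * (x 0 * (x 0 / r)) - B + (A * (x 1 * (x 1 / r)) - B)
      + (A * (x 2 * (x 2 / r)) - B) = A * ((x 0 ^ 2 + x 1 ^ 2 + x 2 ^ 2) / r) - 3 * B := by
    intros; ring
  rw [this, hn]
  field_simp
  ring

theorem IsDecomposition.mom_expGrad_apply {u : H} {q : C2} {D : Fin 3 → H}
    (h : IsDecomposition u q D) {s : ℝ} (hs : 0 < s) (j : Fin 3) :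
    ∫ x, expHess j s ‖x‖ x • (u x - yukawa 0 x • q) = -mom (expGradL j s) (D j) := by
  let ε : ℕ → ℝ := fun n => 1 / ((n : ℝ) + 1)
  have hε : ∀ n, 0 < ε n := fun n => by positivity
  have hε0 : Tendsto ε atTop (𝓝 0) := tendsto_one_div_add_atTop_nhds_zero_nat
  -- The test function is ∂ⱼ of e^{-sρ} with ρ = √(|x|²+ε²), so its own j-th derivative is the
  -- regularised second derivative.
  let η : ℕ → R3 → ℝ := fun n x =>
    -(s * Real.exp (-s * rho (ε n) x) / rho (ε n) x) * x j
  have hcd : ContDiff ℝ ∞ fun x : R3 => x j := by fun_prop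
  have hη : ∀ n, ContDiff ℝ ∞ (η n) := fun n =>
    (((contDiff_const.mul ((contDiff_const.mul (contDiff_rho (hε n))).exp)).div
      (contDiff_rho (hε n)) fun x => (rho_pos (hε n) x).ne').neg).mul hcd
  have hfd : ∀ n x, fderiv ℝ (η n) x (eb j) = expHess j s (rho (ε n) x) x := by
    intro n x
    have hρ := rho_pos (hε n) x
    have e1 : HasDerivAt (fun y : ℝ => -(s * Real.exp (-s * y) / y))
        (s ^ 2 * Real.exp (-s * rho (ε n) x) / rho (ε n) x
          + s * Real.exp (-s * rho (ε n) x) / rho (ε n) x ^ 2) (rho (ε n) x) := by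
      have e0 : HasDerivAt (fun y : ℝ => s * Real.exp (-s * y))
          (s * (Real.exp (-s * rho (ε n) x) * (-s * 1))) (rho (ε n) x) :=
        (((hasDerivAt_id _).const_mul (-s)).exp).const_mul s
      refine (e0.div (hasDerivAt_id _) hρ.ne').neg.congr_deriv ?_
      simp only [id]
      field_simp
      ring
    have e2 := (e1.comp_hasFDerivAt x (hasFDerivAt_rho (hε n) x)).mul (hasFDerivAt_coord j x)
    rw [show η n = (((fun y : ℝ => -(s * Real.exp (-s * y) / y)) ∘ rho (ε n)) *
      fun x : R3 => x j) from rfl, e2.fderiv]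
    have e3 : (EuclideanSpace.proj (𝕜 := ℝ) j : R3 →L[ℝ] ℝ) (eb j) = 1 := by simp [eb]
    simp only [_root_.add_apply, _root_.smul_apply, innerSL_eb, e3, smul_eq_mul,
      Function.comp, expHess]
    field_simp
    ring
  have hexp : ∀ n x, Real.exp (-s * rho (ε n) x) ≤ Real.exp (-s * ‖x‖) := fun n x =>
    Real.exp_le_exp.2 (by nlinarith [norm_le_rho (ε n) x])
  have hη0 : ∀ n x, |η n x| ≤ s * Real.exp (-s * ‖x‖) := by
    intro n x
    have hρ := rho_pos (hε n) x
    rw [show η n x = -(s * Real.exp (-s * rho (ε n) x)) * (x j / rho (ε n) x) by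
      simp only [η]; ring, abs_mul, abs_neg, abs_of_nonneg (by positivity)]
    exact (mul_le_of_le_one_right (by positivity) (abs_coord_div_rho_le _ _ _)).trans
      (mul_le_mul_of_nonneg_left (hexp n x) hs.le)
  have hφ : Integrable fun x => Real.exp (-s * ‖x‖) • (u x - yukawa 0 x • q) := by
    refine (integrable_kern_smul 1 hs u q).congr ?_
    filter_upwards [ae_ne_zero] with x hx
    rw [kern_one hx]
  have key : ∀ n, ∫ x, expHess j s (rho (ε n) x) x • (u x - yukawa 0 x • q)
      = -∫ x, η n x • D j x := by
    intro n
    -- This bound may blow up as ε → 0: it only justifies the integration by parts at fixed ε, and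
    -- the passage to the limit uses an ε-free majorant.
    have hb : ∀ x, |fderiv ℝ (η n) x (eb j)|
        ≤ (s + (s ^ 2 + 2 * s / ε n)) * Real.exp (-s * ‖x‖) := by
      intro x
      rw [hfd]
      have hρ := rho_pos (hε n) x
      refine (abs_expHess_le j hs.le hρ (norm_le_rho _ x)).trans ?_
      calc _ ≤ s ^ 2 * Real.exp (-s * ‖x‖) + 2 * s * (Real.exp (-s * ‖x‖) / ε n) := by
            exact add_le_add (mul_le_mul_of_nonneg_left (hexp n x) (by positivity))
              (mul_le_mul_of_nonneg_left (div_le_div₀ (Real.exp_pos _).le (hexp n x) (hε n)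
                (le_rho x)) (by positivity))
        _ ≤ _ := by
            rw [add_mul, add_mul]
            have : 0 ≤ s * Real.exp (-s * ‖x‖) := by positivity
            have e : 2 * s * (Real.exp (-s * ‖x‖) / ε n) = 2 * s / ε n * Real.exp (-s * ‖x‖) := by
              ring
            linarith
    have := HasWeakGradient.test_exp h hs hφ (hη n) (C := s + (s ^ 2 + 2 * s / ε n)) (fun x => by
      refine (hη0 n x).trans ?_
      have := hε n
      gcongr
      have : 0 ≤ s ^ 2 + 2 * s / ε n := by positivity
      linarith) j hb
    simpa only [hfd] using this
  have lim1 : Tendsto (fun n => ∫ x, expHess j s (rho (ε n) x) x • (u x - yukawa 0 x • q)) atTop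
      (𝓝 (∫ x, expHess j s ‖x‖ x • (u x - yukawa 0 x • q))) := by
    refine tendsto_integral_of_dominated_convergence
      (fun x => s ^ 2 * ‖kern 1 s x • (u x - yukawa 0 x • q)‖
        + 2 * s * ‖kern 0 s x • (u x - yukawa 0 x • q)‖)
      (fun n => ?_) (((integrable_kern_smul 1 hs u q).norm.const_mul _).add
        ((integrable_kern_smul 0 hs u q).norm.const_mul _)) (fun n => ?_) ?_
    · have : Continuous fun x => expHess j s (rho (ε n) x) x := by
        simp only [← hfd]
        exact ((hη n).continuous_fderiv (by simp)).clm_apply continuous_const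
      exact this.aestronglyMeasurable.smul h.1.aestronglyMeasurable
    · filter_upwards [ae_ne_zero] with x hx
      have e : ∀ m, 0 ≤ kern m s x := fun m => by unfold kern; positivity
      rw [norm_smul, norm_smul, norm_smul, Real.norm_of_nonneg (e 1), Real.norm_of_nonneg (e 0),
        ← mul_assoc, ← mul_assoc, ← add_mul]
      gcongr
      exact abs_expHess_le_kern j hs.le hx (norm_le_rho _ x)
    · filter_upwards [ae_ne_zero] with x hx
      have hr : 0 < ‖x‖ := norm_pos_iff.2 hx
      refine Tendsto.smul_const ?_ _
      have hc : ContinuousAt (fun y => expHess j s y x) ‖x‖ := by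
        unfold expHess
        fun_prop (disch := positivity)
      exact hc.tendsto.comp (tendsto_rho hε0 x)
  have lim2 : Tendsto (fun n => ∫ x, η n x • D j x) atTop (𝓝 (mom (expGradL j s) (D j))) := by
    have e0 : mom (expGradL j s) (D j) = ∫ x, expGrad j s x • D j x := by
      refine integral_congr_ae ?_
      filter_upwards [expGradL_ae j hs] with x hx
      rw [hx]
    rw [e0]
    have hiD : Integrable fun x => Real.exp (-s * ‖x‖) • D j x :=
      memLp_one_iff_integrable.1 ((Lp.memLp (D j)).smul (r := 1) (memLp_exp hs))
    refine tendsto_integral_of_dominated_convergence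
      (fun x => s * ‖Real.exp (-s * ‖x‖) • D j x‖)
      (fun n => (hη n).continuous.aestronglyMeasurable.smul (Lp.aestronglyMeasurable _))
      (hiD.norm.const_mul _) (fun n => Eventually.of_forall fun x => ?_) ?_
    · rw [norm_smul, norm_smul, Real.norm_of_nonneg (Real.exp_pos _).le, ← mul_assoc]
      gcongr
      exact hη0 n x
    · filter_upwards [ae_ne_zero] with x hx
      have hr : 0 < ‖x‖ := norm_pos_iff.2 hx
      refine Tendsto.smul_const ?_ _
      have hc : ContinuousAt (fun y => -(s * Real.exp (-s * y) / y) * x j) ‖x‖ := by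
        fun_prop (disch := positivity)
      have := hc.tendsto.comp (tendsto_rho hε0 x)
      rwa [show -(s * Real.exp (-s * ‖x‖) / ‖x‖) * x j = expGrad j s x by
        unfold expGrad; ring] at this
  simp only [key] at lim1
  exact tendsto_nhds_unique lim1 lim2.neg

/-- The form of the Laplacian, tested with `e^{-s|x|}`. -/
theorem IsDecomposition.sum_mom_expGrad {u : H} {q : C2} {D : Fin 3 → H}
    (h : IsDecomposition u q D) {s : ℝ} (hs : 0 < s) :
    ∑ j, mom (expGradL j s) (D j)
      = -(s ^ 2) • mom (kernL 1 s) u + (2 * s) • mom (kernL 0 s) u - q := by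
  have hi : ∀ j, Integrable fun x => expHess j s ‖x‖ x • (u x - yukawa 0 x • q) := by
    intro j
    refine (((integrable_kern_smul 1 hs u q).norm.const_mul (s ^ 2)).add
        ((integrable_kern_smul 0 hs u q).norm.const_mul (2 * s))).mono' ?_ ?_
    · have : Measurable fun x : R3 => expHess j s ‖x‖ x := by unfold expHess; fun_prop
      exact this.aestronglyMeasurable.smul h.1.aestronglyMeasurable
    · filter_upwards [ae_ne_zero] with x hx
      have e : ∀ m, 0 ≤ kern m s x := fun m => by unfold kern; positivity
      simp only [Pi.add_apply]
      rw [norm_smul, norm_smul, norm_smul, Real.norm_of_nonneg (e 1), Real.norm_of_nonneg (e 0),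
        ← mul_assoc, ← mul_assoc, ← add_mul]
      gcongr
      exact abs_expHess_le_kern j hs.le hx le_rfl
  have h1 : ∑ j, mom (expGradL j s) (D j)
      = -∫ x, ∑ j, expHess j s ‖x‖ x • (u x - yukawa 0 x • q) := by
    rw [integral_finsetSum _ fun j _ => hi j, ← Finset.sum_neg_distrib]
    refine Finset.sum_congr rfl fun j _ => ?_
    rw [h.mom_expGrad_apply hs j, neg_neg]
  have h2 : ∫ x, ∑ j, expHess j s ‖x‖ x • (u x - yukawa 0 x • q)
      = ∫ x, ((s ^ 2) • (kern 1 s x • (u x - yukawa 0 x • q))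
          - (2 * s) • (kern 0 s x • (u x - yukawa 0 x • q))) := by
    refine integral_congr_ae ?_
    filter_upwards [ae_ne_zero] with x hx
    rw [← Finset.sum_smul, sum_expHess hx, sub_smul, mul_smul, mul_smul]
  have h3 := integral_sub ((integrable_kern_smul 1 hs u q).smul (s ^ 2))
    ((integrable_kern_smul 0 hs u q).smul (2 * s))
  simp only [Pi.smul_apply] at h3
  rw [h1, h2, h3, integral_smul, integral_smul,
    integral_kern_smul 1 hs, integral_kern_smul 0 hs]
  have hs' := hs.ne'
  simp only [smul_sub, smul_smul, Nat.factorial_one, Nat.factorial_zero, Nat.cast_one]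
  -- The singular part qG₀ contributes q from the first kernel and -2q from the second, in total -q.
  rw [show s ^ 2 * (1 / s ^ (1 + 1)) = 1 by field_simp,
    show 2 * s * (1 / s ^ (0 + 1)) = 2 by rw [zero_add, pow_one]; field_simp]
  module

end ConcNLS

end

/-! ### The vector space V, uniqueness of charge and gradient, the Green identity -/

noncomputable section

namespace ConcNLS

/-! ## Linear structure of decompositions -/

/-- G₀ is not square integrable at infinity, but it differs from the square integrable G₁ by a
bounded function; both parts can be integrated against Schwartz functions. -/
theorem abs_yukawa_sub_le (x : R3) : |yukawa 0 x - yukawa 1 x| ≤ 1 := by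
  rcases eq_or_ne x 0 with rfl | hx
  · simp [yukawa]
  have hr : 0 < ‖x‖ := norm_pos_iff.2 hx
  have hpi := Real.pi_gt_three
  have h1 := Real.add_one_le_exp (-‖x‖)
  have h2 : Real.exp (-‖x‖) ≤ 1 := Real.exp_le_one_iff.2 (by linarith)
  simp only [yukawa, neg_zero, zero_mul, Real.exp_zero, neg_mul, one_mul]
  rw [← sub_div, abs_of_nonneg (div_nonneg (by linarith) (by positivity)),
    div_le_one (by positivity)]
  nlinarith

theorem measurable_yukawa (a : ℝ) : Measurable (yukawa a) := by unfold yukawa; fun_prop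

theorem integrable_schwartz_smul (k : 𝓢(R3, ℂ)) (u : H) (q : C2) :
    Integrable fun x => k x • (u x - yukawa 0 x • q) := by
  have hk2 : MemLp k 2 (volume : Measure R3) := k.memLp 2 volume
  have h1 : Integrable fun x => k x • u x :=
    memLp_one_iff_integrable.1 ((Lp.memLp u).smul (r := 1) hk2)
  have h2 : Integrable fun x => k x • (yukawa 1 x • q) :=
    memLp_one_iff_integrable.1 ((memLp_yukawa one_pos q).smul (r := 1) hk2)
  have h3 : Integrable fun x => k x • ((yukawa 0 x - yukawa 1 x) • q) := by
    refine k.integrable.smul_bdd (1 * ‖q‖) ?_ (Eventually.of_forall fun x => ?_)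
    · exact (((measurable_yukawa 0).sub (measurable_yukawa 1)).smul_const q).aestronglyMeasurable
    · rw [norm_smul]
      gcongr
      exact abs_yukawa_sub_le x
  refine ((h1.sub h2).sub h3).congr (Eventually.of_forall fun x => ?_)
  simp only [Pi.sub_apply, sub_smul, smul_sub]
  abel

theorem integrable_schwartz_smul_field (k : 𝓢(R3, ℂ)) (u : H) :
    Integrable fun x => k x • u x := by
  simpa using integrable_schwartz_smul k u 0

theorem integrable_schwartz_fderiv_smul (k : 𝓢(R3, ℂ)) (v : R3) (u : H) (q : C2) :
    Integrable fun x => fderiv ℝ (k : R3 → ℂ) x v • (u x - yukawa 0 x • q) := by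
  have := integrable_schwartz_smul
    (SchwartzMap.postcompCLM (𝕜 := ℝ) (ContinuousLinearMap.apply ℝ ℂ v)
      (SchwartzMap.fderivCLM ℝ R3 ℂ k)) u q
  exact this

theorem IsDecomposition.add {u v : H} {q p : C2} {D E : Fin 3 → H} (hu : IsDecomposition u q D)
    (hv : IsDecomposition v p E) : IsDecomposition (u + v) (q + p) (D + E) := by
  have h : HasWeakGradient (fun x => (u x - yukawa 0 x • q) + (v x - yukawa 0 x • p)) (D + E) := by
    refine ⟨hu.1.add hv.1, fun η j => ?_⟩
    have e : ∫ x, η x • (D + E) j x = ∫ x, (η x • D j x + η x • E j x) := by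
      refine integral_congr_ae ?_
      filter_upwards [Lp.coeFn_add (D j) (E j)] with x hx
      rw [Pi.add_apply, hx, Pi.add_apply, smul_add]
    rw [e, integral_add (integrable_schwartz_smul_field _ _) (integrable_schwartz_smul_field _ _)]
    simp only [smul_add]
    rw [integral_add (integrable_schwartz_fderiv_smul _ _ _ _)
      (integrable_schwartz_fderiv_smul _ _ _ _), hu.2 η j, hv.2 η j, neg_add]
  refine h.congr ?_
  filter_upwards [Lp.coeFn_add u v] with x hx
  rw [hx, Pi.add_apply, smul_add]
  abel

theorem IsDecomposition.smul {u : H} {q : C2} {D : Fin 3 → H} (hu : IsDecomposition u q D) (z : ℂ) :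
    IsDecomposition (z • u) (z • q) (fun j => z • D j) := by
  have h : HasWeakGradient (fun x => z • (u x - yukawa 0 x • q)) (fun j => z • D j) := by
    refine ⟨hu.1.smul z, fun η j => ?_⟩
    have e : ∫ x, η x • (z • D j) x = ∫ x, z • (η x • D j x) := by
      refine integral_congr_ae ?_
      filter_upwards [Lp.coeFn_smul z (D j)] with x hx
      rw [hx, Pi.smul_apply, smul_comm]
    rw [e, integral_smul, ← smul_neg, ← hu.2 η j, ← integral_smul]
    simp only [smul_comm z]
  refine h.congr ?_
  filter_upwards [Lp.coeFn_smul z u] with x hx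
  rw [hx, Pi.smul_apply, smul_sub, smul_comm z]

theorem IsDecomposition.matH {u : H} {q : C2} {D : Fin 3 → H} (hu : IsDecomposition u q D)
    (M : Matrix (Fin 2) (Fin 2) ℂ) :
    IsDecomposition (matH M u) (matC M q) (fun j => ConcNLS.matH M (D j)) := by
  have h : HasWeakGradient (fun x => matC M (u x - yukawa 0 x • q))
      (fun j => ConcNLS.matH M (D j)) := by
    refine ⟨fun x => ?_, fun η j => ?_⟩
    · obtain ⟨s, hs, hi⟩ := hu.1 x
      exact ⟨s, hs, (matC M).integrable_comp hi⟩
    · have e : ∫ x, η x • ConcNLS.matH M (D j) x = ∫ x, matC M (η x • D j x) := by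
        refine integral_congr_ae ?_
        filter_upwards [matH_ae M (D j)] with x hx
        rw [hx, map_smul]
      rw [e, (matC M).integral_comp_comm (integrable_schwartz_smul_field _ _), ← map_neg,
        ← hu.2 η j, ← (matC M).integral_comp_comm (integrable_schwartz_fderiv_smul _ _ _ _)]
      simp only [map_smul]
  refine h.congr ?_
  filter_upwards [matH_ae M u] with x hx
  rw [hx, map_sub, (matC M).map_smul_of_tower]

theorem IsDecomposition.J {u : H} {q : C2} {D : Fin 3 → H} (hu : IsDecomposition u q D) :
    IsDecomposition (J u) (Jc q) (fun j => ConcNLS.J (D j)) := hu.matH Jmat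

theorem IsDecomposition.sub {u v : H} {q p : C2} {D E : Fin 3 → H} (hu : IsDecomposition u q D)
    (hv : IsDecomposition v p E) : IsDecomposition (u - v) (q - p) (D - E) := by
  have := hu.add (hv.smul (-1))
  simpa only [neg_one_smul, ← sub_eq_add_neg,
    show (D + fun j => -E j) = D - E from (sub_eq_add_neg D E).symm] using this

/-! ## Uniqueness of the charge and of the gradient -/

theorem mom_zero_right (k : L2R) : mom k 0 = 0 :=
  norm_le_zero_iff.1 ((norm_mom_le k 0).trans (by simp))

/-- For u = 0 the exponential identity expresses -q through moments of D against the gradient of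
e^{-s|x|}, and these kernels tend to zero in L² as s → ∞. -/
theorem IsDecomposition.charge_eq_zero {q : C2} {D : Fin 3 → H} (h : IsDecomposition 0 q D) :
    q = 0 := by
  have h1 : ∀ s : ℝ, 0 < s → ‖q‖ ≤ ∑ j, ‖expGradL j s‖ * ‖D j‖ := by
    intro s hs
    have := h.sum_mom_expGrad hs
    rw [mom_zero_right, mom_zero_right, smul_zero, smul_zero, add_zero, zero_sub] at this
    rw [← norm_neg, ← this]
    exact (norm_sum_le _ _).trans (Finset.sum_le_sum fun j _ => norm_mom_le _ _)
  have h2 : Tendsto (fun s => ∑ j, ‖expGradL j s‖ * ‖D j‖) atTop (𝓝 0) := by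
    have := tendsto_finsetSum (Finset.univ : Finset (Fin 3)) fun j _ =>
      (tendsto_norm_expGradL j).mul_const ‖D j‖
    simpa using this
  refine norm_le_zero_iff.1 (ge_of_tendsto h2 ?_)
  filter_upwards [eventually_gt_atTop 0] with s hs using h1 s hs

theorem IsDecomposition.grad_eq_zero {D : Fin 3 → H} (h : IsDecomposition 0 0 D) : D = 0 := by
  have hae : (fun x => (0 : H) x - yukawa 0 x • (0 : C2)) =ᵐ[volume] fun _ => (0 : C2) := by
    filter_upwards [Lp.coeFn_zero C2 2 (volume : Measure R3)] with x hx
    rw [hx]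
    simp
  have h0 : HasWeakGradient (fun _ => (0 : C2)) D := HasWeakGradient.congr h hae
  funext j
  rw [Pi.zero_apply, Lp.eq_zero_iff_ae_eq_zero]
  refine ae_eq_zero_of_integral_contDiff_smul_eq_zero
    ((Lp.memLp (D j)).locallyIntegrable (by norm_num)) fun g hg hc => ?_
  have := h0.test_compact hg hc j
  simpa using this.symm

theorem IsDecomposition.unique {u : H} {q p : C2} {D E : Fin 3 → H} (h1 : IsDecomposition u q D)
    (h2 : IsDecomposition u p E) : q = p ∧ D = E := by
  have h := h1.sub h2
  rw [sub_self] at h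
  have hq := h.charge_eq_zero
  rw [hq] at h
  exact ⟨sub_eq_zero.1 hq, sub_eq_zero.1 h.grad_eq_zero⟩

theorem IsDecomposition.mem_V {u : H} {q : C2} {D : Fin 3 → H} (h : IsDecomposition u q D) :
    u ∈ V := ⟨q, D, h⟩

theorem IsDecomposition.charge_eq {u : H} {q : C2} {D : Fin 3 → H} (h : IsDecomposition u q D) :
    charge u = q := by
  have h' : ∃ q D, IsDecomposition u q D := ⟨q, D, h⟩
  unfold charge
  rw [dif_pos h']
  exact (h'.choose_spec.choose_spec.unique h).1

theorem IsDecomposition.regGrad_eq {u : H} {q : C2} {D : Fin 3 → H} (h : IsDecomposition u q D) :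
    regGrad u = D := by
  have h' : ∃ D q, IsDecomposition u q D := ⟨D, q, h⟩
  unfold regGrad
  rw [dif_pos h']
  exact (h'.choose_spec.choose_spec.unique h).2

/-- By uniqueness, the separate choices made in `charge` and `regGrad` belong to one decomposition.
-/
theorem isDecomposition_of_mem {u : H} (h : u ∈ V) : IsDecomposition u (charge u) (regGrad u) := by
  obtain ⟨q, D, h⟩ := h
  rwa [h.charge_eq, h.regGrad_eq]

theorem add_mem_V {u v : H} (hu : u ∈ V) (hv : v ∈ V) : u + v ∈ V :=
  ((isDecomposition_of_mem hu).add (isDecomposition_of_mem hv)).mem_V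
theorem sub_mem_V {u v : H} (hu : u ∈ V) (hv : v ∈ V) : u - v ∈ V :=
  ((isDecomposition_of_mem hu).sub (isDecomposition_of_mem hv)).mem_V
theorem smul_mem_V {u : H} (z : ℂ) (hu : u ∈ V) : z • u ∈ V :=
  ((isDecomposition_of_mem hu).smul z).mem_V
theorem J_mem_V {u : H} (hu : u ∈ V) : J u ∈ V := (isDecomposition_of_mem hu).J.mem_V
theorem neg_mem_V {u : H} (hu : u ∈ V) : -u ∈ V := by
  rw [← neg_one_smul ℂ u]; exact smul_mem_V _ hu
theorem green_mem_V {a : ℝ} (ha : 0 < a) (c : C2) : green a c ∈ V :=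
  (isDecomposition_green ha c).mem_V

theorem charge_J {u : H} (hu : u ∈ V) : charge (J u) = Jc (charge u) :=
  (isDecomposition_of_mem hu).J.charge_eq
theorem charge_smul {u : H} (z : ℂ) (hu : u ∈ V) : charge (z • u) = z • charge u :=
  ((isDecomposition_of_mem hu).smul z).charge_eq
theorem charge_neg {u : H} (hu : u ∈ V) : charge (-u) = -charge u := by
  rw [← neg_one_smul ℂ u, charge_smul _ hu, neg_one_smul]
theorem charge_add {u v : H} (hu : u ∈ V) (hv : v ∈ V) : charge (u + v) = charge u + charge v :=
  ((isDecomposition_of_mem hu).add (isDecomposition_of_mem hv)).charge_eq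
theorem regGrad_J {u : H} (hu : u ∈ V) (j : Fin 3) : regGrad (J u) j = J (regGrad u j) := by
  rw [(isDecomposition_of_mem hu).J.regGrad_eq]
theorem regGrad_smul {u : H} (z : ℂ) (hu : u ∈ V) (j : Fin 3) :
    regGrad (z • u) j = z • regGrad u j := by
  rw [((isDecomposition_of_mem hu).smul z).regGrad_eq]
theorem regGrad_add {u v : H} (hu : u ∈ V) (hv : v ∈ V) (j : Fin 3) :
    regGrad (u + v) j = regGrad u j + regGrad v j := by
  rw [((isDecomposition_of_mem hu).add (isDecomposition_of_mem hv)).regGrad_eq, Pi.add_apply]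

/-! ## Testing with Green functions -/

theorem mom_add_left (k l : L2R) (u : H) : mom (k + l) u = mom k u + mom l u := by
  unfold mom
  rw [← integral_add (integrable_smul_field k u) (integrable_smul_field l u)]
  refine integral_congr_ae ?_
  filter_upwards [Lp.coeFn_add k l] with x hx
  rw [hx, Pi.add_apply, add_smul]

/-- The moment as a continuous linear function of the kernel. -/
def momL (u : H) : L2R →L[ℝ] C2 :=
  LinearMap.mkContinuous
    { toFun := fun k => mom k u
      map_add' := fun k l => mom_add_left k l u
      map_smul' := fun r k => mom_smul r k u } ‖u‖ fun k => by
        rw [mul_comm]; exact norm_mom_le k u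

theorem momL_apply (u : H) (k : L2R) : momL u k = mom k u := rfl

theorem tendsto_mom_greenGradL (j : Fin 3) (u : H) :
    Tendsto (fun a => mom (greenGradL j a) u) (𝓝[>] 0) (𝓝 0) := by
  have h0 : ∀ᶠ a : ℝ in 𝓝[>] 0, a ∈ Ioc (0 : ℝ) 1 := Ioc_mem_nhdsGT one_pos
  have h1 : ∀ᶠ a : ℝ in 𝓝[>] 0, ∫ x, greenGrad j a x • u x = mom (greenGradL j a) u := by
    filter_upwards [h0] with a ha
    refine integral_congr_ae ?_
    filter_upwards [greenGradL_ae j ha.1.le] with x hx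
    rw [hx]
  refine Tendsto.congr' h1 ?_
  have h2 : Integrable fun x : R3 => (1 + ‖x‖) ^ (-2 : ℝ) • u x :=
    memLp_one_iff_integrable.1 ((Lp.memLp u).smul (r := 1) memLp_japanese)
  rw [show (0 : C2) = ∫ _ : R3, (0 : C2) by simp]
  refine tendsto_integral_filter_of_dominated_convergence
    (fun x : R3 => 4 * 1 ^ 2 * ‖(1 + ‖x‖) ^ (-2 : ℝ) • u x‖)
    (Eventually.of_forall fun a => (measurable_greenGrad j a).aestronglyMeasurable.smul
      (Lp.aestronglyMeasurable u)) ?_ (h2.norm.const_mul _) (Eventually.of_forall fun x => ?_)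
  · filter_upwards [h0] with a ha
    refine Eventually.of_forall fun x => ?_
    rw [norm_smul, norm_smul, ← mul_assoc, Real.norm_of_nonneg (by positivity : 0 ≤ (1 + ‖x‖) ^ (-2 : ℝ))]
    gcongr
    exact abs_greenGrad_le j ha.1.le ha.2 le_rfl x
  · have : Tendsto (fun a => greenGrad j a x) (𝓝[>] 0) (𝓝 0) := by
      have e : Tendsto (fun a : ℝ => a ^ 2) (𝓝[>] 0) (𝓝 0) := by
        have : Continuous fun a : ℝ => a ^ 2 := by fun_prop
        simpa using (this.tendsto 0).mono_left nhdsWithin_le_nhds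
      refine squeeze_zero_norm' ?_ e
      filter_upwards [h0] with a ha
      exact abs_greenGrad_le_sq j ha.1.le x
    simpa using this.smul_const (u x)

theorem norm_kernL_zero {a : ℝ} (ha : 0 < a) : ‖kernL 0 a‖ = √(2 * Real.pi / a) := by
  rw [eq_comm, Real.sqrt_eq_iff_mul_self_eq (by positivity) (norm_nonneg _),
    ← real_inner_self_eq_norm_mul_norm, inner_kernL ha ha]
  field_simp
  ring

theorem tendsto_sq_smul_mom_kernL (u : H) :
    Tendsto (fun a : ℝ => (a ^ 2 / (4 * Real.pi)) • mom (kernL 0 a) u) (𝓝[>] 0) (𝓝 0) := by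
  have hc : Tendsto (fun a : ℝ => a * √(2 * Real.pi * a) * ‖u‖) (𝓝[>] 0) (𝓝 0) := by
    have : Continuous fun a : ℝ => a * √(2 * Real.pi * a) * ‖u‖ := by fun_prop
    simpa using (this.tendsto 0).mono_left nhdsWithin_le_nhds
  refine squeeze_zero_norm' ?_ hc
  filter_upwards [self_mem_nhdsWithin] with a ha
  have ha : 0 < a := ha
  have hpi := Real.pi_gt_three
  have e : a * √(2 * Real.pi / a) = √(2 * Real.pi * a) := by
    rw [← Real.sqrt_sq ha.le, ← Real.sqrt_mul (sq_nonneg a), Real.sqrt_sq ha.le]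
    congr 1
    field_simp
  rw [norm_smul, Real.norm_of_nonneg (by positivity)]
  calc _ ≤ a ^ 2 / 1 * (√(2 * Real.pi / a) * ‖u‖) := by
        gcongr
        · linarith
        · rw [← norm_kernL_zero ha]; exact norm_mom_le _ _
    _ = _ := by rw [← e]; ring

/-- The form of the Laplacian, tested with a Green function. -/
theorem IsDecomposition.sum_mom_greenGrad {u : H} {q : C2} {D : Fin 3 → H}
    (h : IsDecomposition u q D) {a : ℝ} (ha : 0 < a) :
    ∑ j, mom (greenGradL j a) (D j)
      = -((a ^ 2 / (4 * Real.pi)) • mom (kernL 0 a) u) + (a / (4 * Real.pi)) • q := by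
  have hpi := Real.pi_ne_zero
  -- F is the difference of the two sides as a function of the rate. Its derivative vanishes by the
  -- exponential identity, and F tends to 0 as the rate does, which fixes the constant.
  let F : ℝ → C2 := fun a => ∑ j, mom (greenGradL j a) (D j)
    + (a ^ 2 / (4 * Real.pi)) • mom (kernL 0 a) u - (a / (4 * Real.pi)) • q
  have hF : ∀ b, 0 < b → HasDerivAt F 0 b := by
    intro b hb
    have e1 : HasDerivAt (fun a => ∑ j, mom (greenGradL j a) (D j))
        (∑ j, momL (D j) (-(1 / (4 * Real.pi)) • expGradL j b)) b :=
      HasDerivAt.fun_sum fun j _ =>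
        (momL (D j)).hasFDerivAt.comp_hasDerivAt b (hasDerivAt_greenGradL j hb)
    have e2 : HasDerivAt (fun a => mom (kernL 0 a) u) (momL u (-kernL 1 b)) b :=
      (momL u).hasFDerivAt.comp_hasDerivAt b (hasDerivAt_kernL 0 hb)
    have e3 : HasDerivAt (fun a : ℝ => a ^ 2 / (4 * Real.pi)) (2 * b / (4 * Real.pi)) b := by
      simpa using (hasDerivAt_pow 2 b).div_const (4 * Real.pi)
    have e4 : HasDerivAt (fun a : ℝ => (a / (4 * Real.pi)) • q) ((1 / (4 * Real.pi)) • q) b :=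
      ((hasDerivAt_id b).div_const (4 * Real.pi)).smul_const q
    refine ((e1.add (e3.smul e2)).sub e4).congr_deriv ?_
    simp only [map_smul, map_neg, momL_apply]
    rw [← Finset.smul_sum, h.sum_mom_expGrad hb]
    module
  have hconst : ∀ b, 0 < b → F b = F a := fun b hb =>
    isOpen_Ioi.is_const_of_deriv_eq_zero isPreconnected_Ioi
      (fun c hc => (hF c hc).differentiableAt.differentiableWithinAt)
      (fun c hc => (hF c hc).deriv) (mem_Ioi.2 hb) (mem_Ioi.2 ha)
  have hlim : Tendsto F (𝓝[>] 0) (𝓝 0) := by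
    have e1 : Tendsto (fun a => ∑ j, mom (greenGradL j a) (D j)) (𝓝[>] 0) (𝓝 0) := by
      simpa using tendsto_finsetSum (Finset.univ : Finset (Fin 3)) fun j _ =>
        tendsto_mom_greenGradL j (D j)
    have e2 : Tendsto (fun a : ℝ => (a / (4 * Real.pi)) • q) (𝓝[>] 0) (𝓝 0) := by
      have : Continuous fun a : ℝ => (a / (4 * Real.pi)) • q := by fun_prop
      simpa using (this.tendsto 0).mono_left nhdsWithin_le_nhds
    simpa using (e1.add (tendsto_sq_smul_mom_kernL u)).sub e2
  have hFa : F a = 0 := by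
    refine tendsto_nhds_unique (Tendsto.congr' ?_ tendsto_const_nhds) hlim
    filter_upwards [self_mem_nhdsWithin] with b hb using (hconst b hb).symm
  have : ∑ j, mom (greenGradL j a) (D j) = F a - (a ^ 2 / (4 * Real.pi)) • mom (kernL 0 a) u
      + (a / (4 * Real.pi)) • q := by simp only [F]; abel
  rw [this, hFa, zero_sub]

end ConcNLS

end

/-! ### The form Q_L on explicit test vectors and the generalised kernel -/

noncomputable section

namespace ConcNLS

/-! ## The forms -/

theorem sum_ip_left {ι : Type*} (s : Finset ι) (x : ι → C2) (c : C2) :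
    ∑ j ∈ s, ip (x j) c = ip (∑ j ∈ s, x j) c := by
  simp only [ip, inner_sum]

theorem Qlin_conj (σ w : ℝ) (u v : H) : conj (Qlin σ w u v) = Qlin σ w v u := by
  simp only [Qlin, map_add, map_sub, map_mul, map_sum, ip_conj, Complex.conj_ofReal,
    Complex.conj_conj]
  ring

theorem QL_add_left (σ w : ℝ) {u u' : H} (hu : u ∈ V) (hu' : u' ∈ V) (v : H) :
    QL σ w (u + u') v = QL σ w u v + QL σ w u' v := by
  simp only [QL, regGrad_add hu hu', charge_add hu hu', map_add, ip_add_left,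
    Finset.sum_add_distrib]
  ring

theorem QL_smul_left (σ w : ℝ) (z : ℂ) {u : H} (hu : u ∈ V) (v : H) :
    QL σ w (z • u) v = z * QL σ w u v := by
  simp only [QL, regGrad_smul z hu, charge_smul z hu, map_smul, ip_smul_left, ← Finset.mul_sum]
  ring

theorem QL_add_right (σ w : ℝ) (u : H) {v v' : H} (hv : v ∈ V) (hv' : v' ∈ V) :
    QL σ w u (v + v') = QL σ w u v + QL σ w u v' := by
  simp only [QL, regGrad_add hv hv', charge_add hv hv', ip_add_right, Finset.sum_add_distrib]
  ring

theorem QL_smul_right (σ w : ℝ) (z : ℂ) (u : H) {v : H} (hv : v ∈ V) :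
    QL σ w u (z • v) = conj z * QL σ w u v := by
  simp only [QL, regGrad_smul z hv, charge_smul z hv, ip_smul_right, ← Finset.mul_sum]
  ring

theorem QL_sub_right (σ w : ℝ) (u : H) {v v' : H} (hv : v ∈ V) (hv' : v' ∈ V) :
    QL σ w u (v - v') = QL σ w u v - QL σ w u v' := by
  rw [sub_eq_add_neg, ← neg_one_smul ℂ v', QL_add_right σ w u hv (smul_mem_V _ hv'),
    QL_smul_right σ w _ u hv']
  simp
  ring

theorem matC_Tmat_apply_zero (σ : ℝ) (c : C2) : matC (Tmat σ) c 0 = -c 1 := by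
  simp [matC_apply, Tmat]
theorem matC_Tmat_apply_one (σ : ℝ) (c : C2) : matC (Tmat σ) c 1 = (2 * σ + 1) * c 0 := by
  simp [matC_apply, Tmat]

/-- J is anti-Hermitian and can be moved to the second slot, where it also matches the charge
matrices. The symmetry of Q_{α,Lin} thereby becomes available for Q_L. -/
theorem QL_eq_Qlin (σ w : ℝ) (u : H) {v : H} (hv : v ∈ V) : QL σ w u v = Qlin σ w u (-J v) := by
  have hJ := J_mem_V hv
  have h1 : ∀ j, ip (J (regGrad u j)) (regGrad v j) = ip (regGrad u j) (regGrad (-J v) j) := by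
    intro j
    rw [← neg_one_smul ℂ (J v), regGrad_smul _ hJ, regGrad_J hv, ip_J_left, neg_one_smul,
      ip_neg_right]
  simp only [QL, Qlin, h1, charge_neg hJ, charge_J hv, ip_C2, ip_neg_right, ip_J_left,
    matC_Tmat_apply_zero, matC_Tmat_apply_one, PiLp.neg_apply, Jc_apply_zero, Jc_apply_one,
    map_neg]
  have hpi : (Real.pi : ℂ) ≠ 0 := by exact_mod_cast Real.pi_ne_zero
  push_cast
  field_simp
  ring

/-- The Laplacian acts on the Green function as multiplication by a², up to its point charge. Only
an L² pairing with factor w - a² and charge terms remain, so eigenvalue relations become linear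
algebra in ℂ². -/
theorem QL_green (σ w : ℝ) {u : H} (hu : u ∈ V) {a : ℝ} (ha : 0 < a) (c : C2) :
    QL σ w u (green a c) = ((w - a ^ 2 : ℝ) : ℂ) * ip (J u) (green a c)
      + ((a / (4 * Real.pi) : ℝ) : ℂ) * ip (Jc (charge u)) c
      + ((√w / (4 * Real.pi) : ℝ) : ℂ) * ip (matC (Tmat σ) (charge u)) c := by
  have hg := isDecomposition_green ha c
  have h1 : ∑ j, ip (J (regGrad u j)) (regGrad (green a c) j)
      = -((a ^ 2 : ℝ) : ℂ) * ip (J u) (green a c)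
        + ((a / (4 * Real.pi) : ℝ) : ℂ) * ip (Jc (charge u)) c := by
    rw [hg.regGrad_eq]
    simp only [ip_ten]
    rw [sum_ip_left, (isDecomposition_of_mem hu).J.sum_mom_greenGrad ha, ip_add_left, ip_neg_left,
      ← Complex.coe_smul, ← Complex.coe_smul, ip_smul_left, ip_smul_left, green_eq ha, map_smul,
      ip_rsmul_right, ip_ten]
    push_cast
    ring
  unfold QL
  rw [h1, hg.charge_eq]
  push_cast
  ring

/-- Needed because dΦ/dω contains e^{-√ω|x|}, which has charge zero; only the charge of u enters,
through the Green identity. -/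
theorem QL_exp (σ w : ℝ) {u : H} (hu : u ∈ V) {a : ℝ} (ha : 0 < a) (c : C2) :
    QL σ w u (ten c (kernL 1 a)) = ((w - a ^ 2 : ℝ) : ℂ) * ip (J u) (ten c (kernL 1 a))
      + ((8 * Real.pi * a : ℝ) : ℂ) * ip (J u) (green a c) - ip (Jc (charge u)) c := by
  have hg := isDecomposition_exp ha c
  have hpi : (Real.pi : ℂ) ≠ 0 := by exact_mod_cast Real.pi_ne_zero
  have h1 : ∑ j, ip (J (regGrad u j)) (regGrad (ten c (kernL 1 a)) j)
      = -((a ^ 2 : ℝ) : ℂ) * ip (J u) (ten c (kernL 1 a))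
        + ((8 * Real.pi * a : ℝ) : ℂ) * ip (J u) (green a c) - ip (Jc (charge u)) c := by
    rw [hg.regGrad_eq]
    simp only [ip_ten]
    rw [sum_ip_left, (isDecomposition_of_mem hu).J.sum_mom_expGrad ha, ip_sub_left, ip_add_left,
      ← Complex.coe_smul, ← Complex.coe_smul, ip_smul_left, ip_smul_left, green_eq ha, map_smul,
      ip_rsmul_right, ip_ten]
    push_cast
    field_simp
    ring
  unfold QL
  rw [h1, hg.charge_eq, ip_zero_right]
  push_cast
  ring

/-! ## Parameter derivatives of Green functions -/

theorem hasDerivAt_green {a : ℝ} (ha : 0 < a) (c : C2) :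
    HasDerivAt (fun b => green b c) (-(1 / (4 * Real.pi)) • ten c (kernL 1 a)) a := by
  have h1 : HasDerivAt (fun b => ten c ((1 / (4 * Real.pi)) • kernL 0 b))
      (ten c ((1 / (4 * Real.pi)) • -kernL 1 a)) a :=
    (ten c).hasFDerivAt.comp_hasDerivAt a ((hasDerivAt_kernL 0 ha).fun_const_smul _)
  rw [smul_neg, ← neg_smul, map_smul] at h1
  refine h1.congr_of_eventuallyEq ?_
  filter_upwards [lt_mem_nhds ha] with b hb using green_eq hb c

theorem hasDerivAt_green_sqrt {f : ℝ → ℝ} {f' w : ℝ} (hf : HasDerivAt f f' w) (hw : 0 < f w)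
    (c : C2) : HasDerivAt (fun s => green √(f s) c)
      ((f' / (2 * √(f w))) • -(1 / (4 * Real.pi)) • ten c (kernL 1 √(f w))) w :=
  HasDerivAt.scomp (g₁ := fun b => green b c) (h := fun s => √(f s)) w
    (hasDerivAt_green (Real.sqrt_pos.2 hw) c) (hf.sqrt hw.ne')

/-! ## Solitary waves -/

/-- The first coordinate vector. -/
def e1 : C2 := !₂[1, 0]

theorem qSolVec_eq (ν σ w : ℝ) : qSolVec ν σ w = (qSol ν σ w : ℂ) • e1 := by
  ext i; fin_cases i <;> simp [qSolVec, e1]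

theorem qSol_pos {ν σ w : ℝ} (hν : 0 < ν) (hw : 0 < w) : 0 < qSol ν σ w :=
  Real.rpow_pos_of_pos (by have := Real.pi_pos; have := Real.sqrt_pos.2 hw; positivity) _

/-- The charge is a constant multiple of w^{1/(4σ)}. -/
theorem hasDerivAt_qSol {ν σ w : ℝ} (hν : 0 < ν) (hσ : 0 < σ) (hw : 0 < w) :
    HasDerivAt (qSol ν σ) (qSol ν σ w / (4 * σ * w)) w := by
  have hpi := Real.pi_pos
  have hs := Real.sqrt_pos.2 hw
  have hb : 0 < √w / (4 * Real.pi * ν) := by positivity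
  have h1 : HasDerivAt (fun s => √s / (4 * Real.pi * ν)) (1 / (2 * √w) / (4 * Real.pi * ν)) w :=
    (Real.hasDerivAt_sqrt hw.ne').div_const _
  refine (h1.rpow_const (p := 1 / (2 * σ)) (Or.inl hb.ne')).congr_deriv ?_
  rw [Real.rpow_sub_one hb.ne', qSol]
  have : √w * √w = w := Real.mul_self_sqrt hw.le
  field_simp
  rw [Real.sq_sqrt hw.le]
  ring

theorem Sol_eq {ν σ w : ℝ} (hw : 0 < w) : Sol ν σ w = qSol ν σ w • green √w e1 := by
  rw [Sol, qSolVec_eq, green_smul (Real.sqrt_pos.2 hw), rsmul_eq]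

theorem hasDerivAt_Sol {ν σ w : ℝ} (hν : 0 < ν) (hσ : 0 < σ) (hw : 0 < w) :
    HasDerivAt (Sol ν σ) ((qSol ν σ w / (4 * σ * w)) • green √w e1
      - (qSol ν σ w / (8 * Real.pi * √w)) • ten e1 (kernL 1 √w)) w := by
  have hpi := Real.pi_pos
  have hs := Real.sqrt_pos.2 hw
  have h := (hasDerivAt_qSol hν hσ hw).smul (hasDerivAt_green_sqrt (hasDerivAt_id w) hw e1)
  refine (h.congr_of_eventuallyEq ?_).congr_deriv ?_
  · filter_upwards [lt_mem_nhds hw] with s hs using Sol_eq hs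
  · rw [add_comm, sub_eq_add_neg, ← neg_smul, smul_smul, smul_smul]
    simp only [id]
    congr 2
    field_simp
    ring

theorem dSol_eq {ν σ w : ℝ} (hν : 0 < ν) (hσ : 0 < σ) (hw : 0 < w) :
    dSol ν σ w = (qSol ν σ w / (4 * σ * w)) • green √w e1
      - (qSol ν σ w / (8 * Real.pi * √w)) • ten e1 (kernL 1 √w) :=
  (hasDerivAt_Sol hν hσ hw).deriv

theorem differentiableAt_dSol {ν σ w : ℝ} (hν : 0 < ν) (hσ : 0 < σ) (hw : 0 < w) :
    DifferentiableAt ℝ (dSol ν σ) w := by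
  have hpi := Real.pi_pos
  have hs := Real.sqrt_pos.2 hw
  have hd : DifferentiableAt ℝ (fun w => (qSol ν σ w / (4 * σ * w)) • green √w e1
      - (qSol ν σ w / (8 * Real.pi * √w)) • ten e1 (kernL 1 √w)) w := by
    have h1 := (hasDerivAt_qSol hν hσ hw).differentiableAt
    have h2 := (hasDerivAt_green_sqrt (hasDerivAt_id w) hw e1).differentiableAt
    have h3 : DifferentiableAt ℝ (fun w => √w) w := (Real.hasDerivAt_sqrt hw.ne').differentiableAt
    have h4 : DifferentiableAt ℝ (fun w => ten e1 (kernL 1 √w)) w :=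
      (ten e1).differentiableAt.comp w
        ((hasDerivAt_kernL 1 hs).differentiableAt.comp w h3)
    exact ((h1.div (by fun_prop) (by positivity)).smul h2).sub
      ((h1.div (h3.const_mul _) (by positivity)).smul h4)
  refine hd.congr_of_eventuallyEq ?_
  filter_upwards [lt_mem_nhds hw] with s hs using dSol_eq hν hσ hs

theorem Sol_mem_V {ν σ w : ℝ} (hw : 0 < w) : Sol ν σ w ∈ V :=
  green_mem_V (Real.sqrt_pos.2 hw) _

theorem dSol_mem_V {ν σ w : ℝ} (hν : 0 < ν) (hσ : 0 < σ) (hw : 0 < w) : dSol ν σ w ∈ V := by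
  have hs := Real.sqrt_pos.2 hw
  rw [dSol_eq hν hσ hw, rsmul_eq, rsmul_eq]
  exact sub_mem_V (smul_mem_V _ (green_mem_V hs _))
    (smul_mem_V _ (isDecomposition_exp hs e1).mem_V)

theorem conjC_e1 : conjC e1 = e1 := by
  ext i; fin_cases i <;> simp [conjC_apply, e1]

theorem conjH_green {a : ℝ} (ha : 0 < a) (c : C2) : conjH (green a c) = green a (conjC c) := by
  rw [green_eq ha, green_eq ha, conjH_ten]

theorem conjH_Sol {ν σ w : ℝ} (hw : 0 < w) : conjH (Sol ν σ w) = Sol ν σ w := by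
  rw [Sol_eq hw, map_smul, conjH_green (Real.sqrt_pos.2 hw), conjC_e1]

theorem conjH_dSol {ν σ w : ℝ} (hν : 0 < ν) (hσ : 0 < σ) (hw : 0 < w) :
    conjH (dSol ν σ w) = dSol ν σ w := by
  rw [dSol_eq hν hσ hw, map_sub, map_smul, map_smul, conjH_green (Real.sqrt_pos.2 hw), conjH_ten,
    conjC_e1]

/-- The rate √w makes the factor w - a² vanish, and against a charge in the first component J and 𝕋
contribute opposite terms. -/
theorem QL_Sol {ν σ w : ℝ} (hw : 0 < w) {u : H} (hu : u ∈ V) : QL σ w u (Sol ν σ w) = 0 := by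
  rw [Sol, QL_green σ w hu (Real.sqrt_pos.2 hw), Real.sq_sqrt hw.le]
  simp only [ip_C2, qSolVec, matC_Tmat_apply_zero, Jc_apply_zero]
  simp

/-- This is the weak form of L₁ dΦ/dω = -Φ. The exponential part of dΦ/dω produces -(u,Φ), and its
charge term cancels that of the Green part precisely because dq/dw = q/(4σw). -/
theorem QL_J_dSol {ν σ w : ℝ} (hν : 0 < ν) (hσ : 0 < σ) (hw : 0 < w) {u : H} (hu : u ∈ V) :
    QL σ w u (J (dSol ν σ w)) = -ip u (Sol ν σ w) := by
  have hs := Real.sqrt_pos.2 hw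
  have hpi : (Real.pi : ℂ) ≠ 0 := by exact_mod_cast Real.pi_ne_zero
  have hs' : (√w : ℂ) ≠ 0 := by exact_mod_cast hs.ne'
  have hσ' : (σ : ℂ) ≠ 0 := by exact_mod_cast hσ.ne'
  have hw2 : (√w : ℂ) ^ 2 = w := by exact_mod_cast Real.sq_sqrt hw.le
  have hw' : (w : ℂ) ≠ 0 := by exact_mod_cast hw.ne'
  rw [dSol_eq hν hσ hw, map_sub, rsmul_eq, rsmul_eq, map_smul, map_smul, J_green hs, J_ten,
    QL_sub_right σ w u (smul_mem_V _ (green_mem_V hs _))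
      (smul_mem_V _ (isDecomposition_exp hs (Jc e1)).mem_V),
    QL_smul_right σ w _ u (green_mem_V hs _),
    QL_smul_right σ w _ u (isDecomposition_exp hs (Jc e1)).mem_V,
    QL_green σ w hu hs, QL_exp σ w hu hs, Real.sq_sqrt hw.le, ← J_green hs, ip_J_J, Sol_eq hw,
    ip_rsmul_right]
  simp only [ip_C2, Jc_apply_zero, Jc_apply_one, matC_Tmat_apply_zero, matC_Tmat_apply_one, e1]
  simp only [Complex.conj_ofReal, sub_self, Complex.ofReal_zero, zero_mul, zero_add]
  simp
  field_simp
  rw [← hw2]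
  ring

end ConcNLS

end

/-! ### The eigenvalues ±iξ and symplectic orthogonality -/

noncomputable section

namespace ConcNLS

/-! ## Eigenfunctions -/

section parameters

variable {σ : ℝ}

theorem sigma_pos (hσ : 1 / √2 < σ) : 0 < σ := lt_trans (by positivity) hσ

theorem half_lt_sq (hσ : 1 / √2 < σ) : 1 / 2 < σ ^ 2 := by
  have h := pow_lt_pow_left₀ hσ (by positivity) two_ne_zero
  rwa [div_pow, one_pow, Real.sq_sqrt (by norm_num)] at h

theorem one_sub_sq_pos (hσ : 1 / √2 < σ) (hσ1 : σ < 1) : 0 < 1 - σ ^ 2 := by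
  nlinarith [sigma_pos hσ]

theorem sq_sqrt_one_sub (hσ : 1 / √2 < σ) (hσ1 : σ < 1) : √(1 - σ ^ 2) ^ 2 = 1 - σ ^ 2 :=
  Real.sq_sqrt (one_sub_sq_pos hσ hσ1).le

theorem sqrt_one_sub_pos (hσ : 1 / √2 < σ) (hσ1 : σ < 1) : 0 < √(1 - σ ^ 2) :=
  Real.sqrt_pos.2 (one_sub_sq_pos hσ hσ1)

theorem sqrt_one_sub_lt (hσ : 1 / √2 < σ) : √(1 - σ ^ 2) < σ := by
  rw [Real.sqrt_lt' (sigma_pos hσ)]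
  linarith [half_lt_sq hσ]

/-- With s = √(1-σ²), the relation σ²+s² = 1 makes 1 ∓ 2σs a perfect square. The condition σ > 1/√2
means s < σ, so both rates become √w(σ ∓ s) and the eigenvalue conditions become polynomial. -/
theorem sub_xi_eq (hσ : 1 / √2 < σ) (hσ1 : σ < 1) (w : ℝ) :
    w - xi σ w = w * (σ - √(1 - σ ^ 2)) ^ 2 := by
  unfold xi
  linear_combination (-w) * sq_sqrt_one_sub hσ hσ1

theorem add_xi_eq (hσ : 1 / √2 < σ) (hσ1 : σ < 1) (w : ℝ) :
    w + xi σ w = w * (σ + √(1 - σ ^ 2)) ^ 2 := by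
  unfold xi
  linear_combination (-w) * sq_sqrt_one_sub hσ hσ1

theorem sub_xi_pos (hσ : 1 / √2 < σ) (hσ1 : σ < 1) {w : ℝ} (hw : 0 < w) : 0 < w - xi σ w := by
  rw [sub_xi_eq hσ hσ1]
  have := sub_pos.2 (sqrt_one_sub_lt hσ)
  positivity

theorem add_xi_pos (hσ : 1 / √2 < σ) (hσ1 : σ < 1) {w : ℝ} (hw : 0 < w) : 0 < w + xi σ w := by
  rw [add_xi_eq hσ hσ1]
  have := sigma_pos hσ
  have := sqrt_one_sub_pos hσ hσ1
  positivity

theorem xi_pos (hσ : 1 / √2 < σ) (hσ1 : σ < 1) {w : ℝ} (hw : 0 < w) : 0 < xi σ w := by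
  have := sigma_pos hσ
  have := sqrt_one_sub_pos hσ hσ1
  unfold xi
  positivity

theorem sqrt_sub_xi (hσ : 1 / √2 < σ) (hσ1 : σ < 1) {w : ℝ} (hw : 0 < w) :
    √(w - xi σ w) = √w * (σ - √(1 - σ ^ 2)) := by
  rw [sub_xi_eq hσ hσ1, Real.sqrt_mul hw.le, Real.sqrt_sq (sub_pos.2 (sqrt_one_sub_lt hσ)).le]

theorem sqrt_add_xi (hσ : 1 / √2 < σ) (hσ1 : σ < 1) {w : ℝ} (hw : 0 < w) :
    √(w + xi σ w) = √w * (σ + √(1 - σ ^ 2)) := by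
  rw [add_xi_eq hσ hσ1, Real.sqrt_mul hw.le, Real.sqrt_sq
    (add_pos (sigma_pos hσ) (sqrt_one_sub_pos hσ hσ1)).le]

end parameters

/-- The coefficient `(√(1-σ²) + 1) / σ`. -/
def kap (σ : ℝ) : ℝ := (√(1 - σ ^ 2) + 1) / σ

/-- The vector `(1, τ)`. -/
def e2 (τ : ℂ) : C2 := !₂[1, τ]

/-- The eigenfunctions `Ψ` (for `τ = i`) and `Ψ*` (for `τ = -i`). -/
def PsiT (τ : ℂ) (σ w : ℝ) : H :=
  green √(w - xi σ w) (e2 τ) - kap σ • green √(w + xi σ w) (e2 (-τ))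

theorem Psi_eq (σ : ℝ) : Psi σ = PsiT Complex.I σ := rfl

section eigen

variable {σ w : ℝ} {τ : ℂ}

theorem PsiStar_eq (hσ : 1 / √2 < σ) (hσ1 : σ < 1) (hw : 0 < w) :
    PsiStar σ w = PsiT (-Complex.I) σ w := by
  have ha := Real.sqrt_pos.2 (sub_xi_pos hσ hσ1 hw)
  have hb := Real.sqrt_pos.2 (add_xi_pos hσ hσ1 hw)
  have h : ∀ z : ℂ, matC !![1, 0; 0, -1] (e2 z) = e2 (-z) := fun z => by
    ext i; fin_cases i <;> simp [matC_apply, e2]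
  rw [PsiStar, Psi_eq, PsiT, PsiT, map_sub, matH_green _ ha, rsmul_eq, map_smul, matH_green _ hb,
    h, h, ← rsmul_eq]

theorem PsiT_mem_V (hσ : 1 / √2 < σ) (hσ1 : σ < 1) (hw : 0 < w) : PsiT τ σ w ∈ V := by
  have ha := Real.sqrt_pos.2 (sub_xi_pos hσ hσ1 hw)
  have hb := Real.sqrt_pos.2 (add_xi_pos hσ hσ1 hw)
  rw [PsiT, rsmul_eq]
  exact sub_mem_V (green_mem_V ha _) (smul_mem_V _ (green_mem_V hb _))

theorem differentiableAt_PsiT (hσ : 1 / √2 < σ) (hσ1 : σ < 1) (hw : 0 < w) :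
    DifferentiableAt ℝ (PsiT τ σ) w := by
  have h1 : HasDerivAt (fun s => xi σ s) (2 * σ * √(1 - σ ^ 2) * 1) w :=
    (hasDerivAt_id w).const_mul (2 * σ * √(1 - σ ^ 2))
  have h2 := (hasDerivAt_green_sqrt ((hasDerivAt_id w).sub h1) (sub_xi_pos hσ hσ1 hw)
    (e2 τ)).differentiableAt
  have h3 := (hasDerivAt_green_sqrt ((hasDerivAt_id w).add h1) (add_xi_pos hσ hσ1 hw)
    (e2 (-τ))).differentiableAt
  exact h2.sub (h3.const_smul (kap σ))

theorem Jc_e2 (hτ : τ ^ 2 = -1) : Jc (e2 τ) = τ • e2 τ := by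
  ext i; fin_cases i
  · simp [Jc_apply_zero, e2]
  · simp [Jc_apply_one, e2, ← sq, hτ]

theorem J_PsiT (hσ : 1 / √2 < σ) (hσ1 : σ < 1) (hw : 0 < w) (hτ : τ ^ 2 = -1) :
    J (PsiT τ σ w) = τ • green √(w - xi σ w) (e2 τ)
      + (τ * kap σ) • green √(w + xi σ w) (e2 (-τ)) := by
  have ha := Real.sqrt_pos.2 (sub_xi_pos hσ hσ1 hw)
  have hb := Real.sqrt_pos.2 (add_xi_pos hσ hσ1 hw)
  rw [PsiT, map_sub, J_green ha, rsmul_eq, map_smul, J_green hb, Jc_e2 hτ,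
    Jc_e2 (by rw [neg_sq, hτ]), green_smul ha, green_smul hb, smul_smul]
  module

/-- J acts on (1,±τ) as ±τ, while w - a² equals ±ξ at the two rates; the signs multiply to the same
factor for both Green functions. Cancellation of the charge terms is what fixes ξ and the
coefficient `kap`. -/
theorem QL_J_PsiT (hσ : 1 / √2 < σ) (hσ1 : σ < 1) (hw : 0 < w) (hτ : τ ^ 2 = -1)
    (hτc : conj τ = -τ) {u : H} (hu : u ∈ V) :
    QL σ w u (J (PsiT τ σ w)) = τ * xi σ w * ip u (J (PsiT τ σ w)) := by
  have hwa := sub_xi_pos hσ hσ1 hw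
  have hwb := add_xi_pos hσ hσ1 hw
  have ha := Real.sqrt_pos.2 hwa
  have hb := Real.sqrt_pos.2 hwb
  have hpi : (Real.pi : ℂ) ≠ 0 := by exact_mod_cast Real.pi_ne_zero
  have hσ0 : σ ≠ 0 := (sigma_pos hσ).ne'
  have hs := sq_sqrt_one_sub hσ hσ1
  -- R1 and R2 are the coefficients of the second and of the first component of the charge of u.
  have R1 : √(w - xi σ w) - √w + kap σ * (√(w + xi σ w) - √w) = 0 := by
    rw [sqrt_sub_xi hσ hσ1 hw, sqrt_add_xi hσ hσ1 hw, kap]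
    field_simp
    linear_combination √w * hs
  have R2 : -√(w - xi σ w) + √w * (2 * σ + 1) + kap σ * (√(w + xi σ w) - √w * (2 * σ + 1)) = 0 := by
    rw [sqrt_sub_xi hσ hσ1 hw, sqrt_add_xi hσ hσ1 hw, kap]
    field_simp
    linear_combination √w * hs
  have R1' : (√(w - xi σ w) : ℂ) - √w + kap σ * (√(w + xi σ w) - √w) = 0 := by exact_mod_cast R1
  have R2' : -(√(w - xi σ w) : ℂ) + √w * (2 * σ + 1)
      + kap σ * (√(w + xi σ w) - √w * (2 * σ + 1)) = 0 := by exact_mod_cast R2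
  rw [J_PsiT hσ hσ1 hw hτ, QL_add_right σ w u (smul_mem_V _ (green_mem_V ha _))
    (smul_mem_V _ (green_mem_V hb _)), QL_smul_right _ _ _ _ (green_mem_V ha _),
    QL_smul_right _ _ _ _ (green_mem_V hb _), QL_green _ _ hu ha, QL_green _ _ hu hb,
    ip_add_right, ip_smul_right, ip_smul_right, Real.sq_sqrt hwa.le, Real.sq_sqrt hwb.le,
    ip_J_left, ip_J_left, J_green ha, J_green hb, Jc_e2 hτ, Jc_e2 (τ := -τ) (by rw [neg_sq, hτ]),
    green_smul ha, green_smul hb, ip_smul_right, ip_smul_right]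
  simp only [ip_C2, matC_Tmat_apply_zero, matC_Tmat_apply_one, Jc_apply_zero, Jc_apply_one, e2]
  simp only [map_mul, map_neg, hτc, Complex.conj_ofReal]
  simp [hτc]
  generalize charge u 0 = x
  generalize charge u 1 = y
  generalize ip u (green √(w - xi σ w) _) = A
  generalize ip u (green √(w + xi σ w) _) = B
  field_simp
  ring_nf
  simp only [hτ]
  linear_combination (-τ * y) * R1' - x * R2'

/-- Hermitian symmetry of Q_{α,Lin} carries the eigenvalue relation from the second slot to the
first. -/
theorem QL_PsiT_left (hσ : 1 / √2 < σ) (hσ1 : σ < 1) (hw : 0 < w) (hτ : τ ^ 2 = -1)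
    (hτc : conj τ = -τ) {v : H} (hv : v ∈ V) :
    QL σ w (PsiT τ σ w) v = τ * xi σ w * ip (PsiT τ σ w) v := by
  have hP : PsiT τ σ w ∈ V := PsiT_mem_V hσ hσ1 hw
  have hJv := neg_mem_V (J_mem_V hv)
  have h1 := QL_eq_Qlin σ w (-J v) (J_mem_V hP)
  rw [J_J, neg_neg, QL_J_PsiT hσ hσ1 hw hτ hτc hJv] at h1
  rw [QL_eq_Qlin σ w _ hv, ← Qlin_conj, ← h1, ip_neg_left, ip_J_J]
  simp only [map_mul, map_neg, hτc, Complex.conj_ofReal, ip_conj]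
  ring

theorem I_sq' : Complex.I ^ 2 = -1 := Complex.I_sq
theorem neg_I_sq : (-Complex.I) ^ 2 = -1 := by simp
theorem conj_neg_I : conj (-Complex.I) = -(-Complex.I) := by simp

/-! ## Orthogonality relations -/

theorem ip_PsiT_Sol {ν : ℝ} (hσ : 1 / √2 < σ) (hσ1 : σ < 1) (hw : 0 < w) (hτ : τ ^ 2 = -1)
    (hτc : conj τ = -τ) : ip (PsiT τ σ w) (Sol ν σ w) = 0 := by
  have h := QL_PsiT_left hσ hσ1 hw hτ hτc (Sol_mem_V (ν := ν) (σ := σ) hw)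
  rw [QL_Sol hw (PsiT_mem_V hσ hσ1 hw)] at h
  have hτ0 : τ ≠ 0 := by rintro rfl; simp at hτ
  have hx : (xi σ w : ℂ) ≠ 0 := by exact_mod_cast (xi_pos hσ hσ1 hw).ne'
  simpa [hτ0, hx] using h.symm

theorem ip_PsiT_J_dSol {ν : ℝ} (hν : 0 < ν) (hσ : 1 / √2 < σ) (hσ1 : σ < 1) (hw : 0 < w)
    (hτ : τ ^ 2 = -1) (hτc : conj τ = -τ) : ip (PsiT τ σ w) (J (dSol ν σ w)) = 0 := by
  have h := QL_PsiT_left hσ hσ1 hw hτ hτc (J_mem_V (dSol_mem_V hν (sigma_pos hσ) hw))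
  rw [QL_J_dSol hν (sigma_pos hσ) hw (PsiT_mem_V hσ hσ1 hw), ip_PsiT_Sol hσ hσ1 hw hτ hτc] at h
  have hτ0 : τ ≠ 0 := by rintro rfl; simp at hτ
  have hx : (xi σ w : ℂ) ≠ 0 := by exact_mod_cast (xi_pos hσ hσ1 hw).ne'
  simpa [hτ0, hx] using h.symm

/-- Evaluating Q_L from its two slots gives the factors τξ and -τξ for the same pairing, and ξ ≠ 0.
-/
theorem ip_PsiT_J_PsiT_neg (hσ : 1 / √2 < σ) (hσ1 : σ < 1) (hw : 0 < w) (hτ : τ ^ 2 = -1)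
    (hτc : conj τ = -τ) : ip (PsiT τ σ w) (J (PsiT (-τ) σ w)) = 0 := by
  have hτ' : (-τ) ^ 2 = -1 := by rw [neg_sq, hτ]
  have hτc' : conj (-τ) = -(-τ) := by rw [map_neg, hτc]
  have h := QL_PsiT_left hσ hσ1 hw hτ hτc (J_mem_V (PsiT_mem_V (τ := -τ) hσ hσ1 hw))
  rw [QL_J_PsiT hσ hσ1 hw hτ' hτc' (PsiT_mem_V hσ hσ1 hw)] at h
  have hτ0 : τ ≠ 0 := by rintro rfl; simp at hτ
  have hx : (xi σ w : ℂ) ≠ 0 := by exact_mod_cast (xi_pos hσ hσ1 hw).ne'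
  have h2 : (2 * τ * xi σ w) * ip (PsiT τ σ w) (J (PsiT (-τ) σ w)) = 0 := by
    linear_combination -h
  exact (mul_eq_zero.1 h2).resolve_left (by simp [hτ0, hx])

/-- With a, b the two rates the pairing is -τ(b - `kap`² a)/(4πab); by σ²+s² = 1 it could vanish
only if s(1-σ) = 0. -/
theorem ip_PsiT_J_PsiT_ne (hσ : 1 / √2 < σ) (hσ1 : σ < 1) (hw : 0 < w) (hτ : τ ^ 2 = -1)
    (hτc : conj τ = -τ) : ip (PsiT τ σ w) (J (PsiT τ σ w)) ≠ 0 := by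
  have hwa := sub_xi_pos hσ hσ1 hw
  have hwb := add_xi_pos hσ hσ1 hw
  have ha := Real.sqrt_pos.2 hwa
  have hb := Real.sqrt_pos.2 hwb
  have hs0 := sqrt_one_sub_pos hσ hσ1
  have hsσ := sqrt_one_sub_lt hσ
  have hs := sq_sqrt_one_sub hσ hσ1
  have hσ0 := sigma_pos hσ
  have hτ0 : τ ≠ 0 := by rintro rfl; simp at hτ
  have key : √(w + xi σ w) - kap σ ^ 2 * √(w - xi σ w) ≠ 0 := by
    rw [sqrt_sub_xi hσ hσ1 hw, sqrt_add_xi hσ hσ1 hw, kap]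
    set s := √(1 - σ ^ 2)
    have hr := Real.sqrt_pos.2 hw
    have h0 : s * (1 - σ) ≠ 0 := by
      have : 0 < 1 - σ := by linarith
      positivity
    intro h
    field_simp at h
    rw [mul_zero] at h
    have h1 := (mul_eq_zero.1 h).resolve_left hr.ne'
    have h2 : (1 + s) * 2 * (s * (1 - σ)) = 0 := by linear_combination h1 - (σ + s) * hs
    exact h0 ((mul_eq_zero.1 h2).resolve_left (by positivity))
  have e : ip (PsiT τ σ w) (J (PsiT τ σ w)) = -τ * ((1 / (4 * Real.pi * √(w - xi σ w)
      * √(w + xi σ w)) * (√(w + xi σ w) - kap σ ^ 2 * √(w - xi σ w)) : ℝ) : ℂ) := by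
    have i1 : ip (e2 τ) (e2 τ) = 2 := by
      simp [ip_C2, e2, hτc, ← sq, hτ]; norm_num
    have i2 : ip (e2 (-τ)) (e2 (-τ)) = 2 := by
      simp [ip_C2, e2, hτc, ← sq, hτ]; norm_num
    have i3 : ip (e2 τ) (e2 (-τ)) = 0 := by
      simp [ip_C2, e2, hτc, ← sq, hτ]
    have i4 : ip (e2 (-τ)) (e2 τ) = 0 := by
      simp [ip_C2, e2, hτc, ← sq, hτ]
    have ha' : (√(w - xi σ w) : ℂ) ≠ 0 := by exact_mod_cast ha.ne'
    have hb' : (√(w + xi σ w) : ℂ) ≠ 0 := by exact_mod_cast hb.ne'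
    have hpi : (Real.pi : ℂ) ≠ 0 := by exact_mod_cast Real.pi_ne_zero
    rw [J_PsiT hσ hσ1 hw hτ, PsiT]
    simp only [ip_sub_left, ip_add_right, ip_smul_right, ip_rsmul_left, ip_green_green ha ha,
      ip_green_green hb hb, ip_green_green ha hb, ip_green_green hb ha, i1, i2, i3, i4, map_mul,
      hτc, Complex.conj_ofReal]
    push_cast
    field_simp
    ring
  rw [e]
  refine mul_ne_zero (neg_ne_zero.2 hτ0) ?_
  rw [Complex.ofReal_ne_zero]
  have := Real.pi_pos
  exact mul_ne_zero (by positivity) key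

end eigen

end ConcNLS

end

/-! ### Algebra and parameter dependence of the symplectic projections -/

noncomputable section

namespace ConcNLS

/-! ## The symplectic projections -/

section solitary

variable {ν σ w : ℝ}

theorem ip_e1 : ip e1 e1 = 1 := by simp [ip_C2, e1]

theorem ip_Sol_Sol {s : ℝ} (hs : 0 < s) (hw : 0 < w) : ip (Sol ν σ s) (Sol ν σ w)
    = ((qSol ν σ s * qSol ν σ w / (4 * Real.pi * (√s + √w)) : ℝ) : ℂ) := by
  rw [Sol_eq hs, Sol_eq hw, ip_rsmul_left, ip_rsmul_right,
    ip_green_green (Real.sqrt_pos.2 hs) (Real.sqrt_pos.2 hw), ip_e1]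
  push_cast
  ring

/-- The squared norm is q²/(8π√w), a multiple of w^{1/(2σ)-1/2}; its derivative is nonzero exactly
because σ ≠ 1. -/
theorem Delta_eq (hν : 0 < ν) (hσ : 0 < σ) (hw : 0 < w) :
    Delta ν σ w = qSol ν σ w ^ 2 / (16 * Real.pi * w * √w) * (1 / σ - 1) := by
  have hpi := Real.pi_pos
  have hr := Real.sqrt_pos.2 hw
  have h1 : (fun s => ‖Sol ν σ s‖ ^ 2) =ᶠ[𝓝 w] fun s => qSol ν σ s ^ 2 / (8 * Real.pi * √s) := by
    filter_upwards [lt_mem_nhds hw] with s hs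
    have h := ip_Sol_Sol (ν := ν) (σ := σ) hs hs
    rw [ip, inner_self_eq_norm_sq_to_K] at h
    have h' : ‖Sol ν σ s‖ ^ 2 = qSol ν σ s * qSol ν σ s / (4 * Real.pi * (√s + √s)) := by
      apply Complex.ofReal_injective
      rw [← h]
      simp
    rw [h']
    congr 1 <;> ring
  have h2 : HasDerivAt (fun s => qSol ν σ s ^ 2 / (8 * Real.pi * √s)) _ w :=
    ((hasDerivAt_qSol hν hσ hw).pow 2).div
      ((Real.hasDerivAt_sqrt hw.ne').const_mul (8 * Real.pi)) (by positivity)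
  rw [Delta, h1.deriv_eq, h2.deriv]
  have hw2 : √w ^ 2 = w := Real.sq_sqrt hw.le
  simp only [Pi.pow_apply]
  rw [show w = √w ^ 2 from hw2.symm, Real.sqrt_sq hr.le]
  field_simp
  ring

theorem Delta_ne (hν : 0 < ν) (hσ : 0 < σ) (hσ1 : σ < 1) (hw : 0 < w) : Delta ν σ w ≠ 0 := by
  rw [Delta_eq hν hσ hw]
  have hpi := Real.pi_pos
  have hr := Real.sqrt_pos.2 hw
  have hq := qSol_pos (σ := σ) hν hw
  have : 0 < 1 / σ - 1 := by rw [sub_pos, lt_div_iff₀ hσ]; linarith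
  positivity

theorem differentiableAt_Delta (hν : 0 < ν) (hσ : 0 < σ) (hw : 0 < w) :
    DifferentiableAt ℝ (Delta ν σ) w := by
  have hpi := Real.pi_pos
  have hr := Real.sqrt_pos.2 hw
  have h1 := (hasDerivAt_qSol hν hσ hw).differentiableAt
  have h3 : DifferentiableAt ℝ (fun w => √w) w := (Real.hasDerivAt_sqrt hw.ne').differentiableAt
  have hd : DifferentiableAt ℝ
      (fun w => qSol ν σ w ^ 2 / (16 * Real.pi * w * √w) * (1 / σ - 1)) w :=
    ((h1.pow 2).div (((by fun_prop : DifferentiableAt ℝ (fun w => 16 * Real.pi * w) w)).mul h3)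
      (by simp only [Pi.mul_apply]; positivity)).mul_const _
  refine hd.congr_of_eventuallyEq ?_
  filter_upwards [lt_mem_nhds hw] with s hs using Delta_eq hν hσ hs

/-- The functional `u ↦ (u, v)` as a real linear one. -/
def ipL (v : H) : H →L[ℝ] ℂ := (innerSL ℂ v).restrictScalars ℝ

theorem ip_dSol_Sol (hν : 0 < ν) (hσ : 0 < σ) (hw : 0 < w) :
    ip (dSol ν σ w) (Sol ν σ w) = ((Delta ν σ w / 2 : ℝ) : ℂ) := by
  have hpi := Real.pi_pos
  have hr := Real.sqrt_pos.2 hw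
  have h1 : HasDerivAt (fun s => ip (Sol ν σ s) (Sol ν σ w)) (ip (dSol ν σ w) (Sol ν σ w)) w :=
    (ipL (Sol ν σ w)).hasFDerivAt.comp_hasDerivAt w
      (hasDerivAt_Sol hν hσ hw).differentiableAt.hasDerivAt
  have h2 : HasDerivAt (fun s => qSol ν σ s * qSol ν σ w / (4 * Real.pi * (√s + √w))) _ w :=
    ((hasDerivAt_qSol hν hσ hw).mul_const _).div
      (((Real.hasDerivAt_sqrt hw.ne').add_const _).const_mul (4 * Real.pi)) (by positivity)
  have h3 := h1.congr_of_eventuallyEq (f₁ := fun s =>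
    ((qSol ν σ s * qSol ν σ w / (4 * Real.pi * (√s + √w)) : ℝ) : ℂ)) (by
      filter_upwards [lt_mem_nhds hw] with s hs using (ip_Sol_Sol hs hw).symm)
  rw [h3.unique h2.ofReal_comp, Delta_eq hν hσ hw]
  congr 1
  have hw2 : √w ^ 2 = w := Real.sq_sqrt hw.le
  rw [show w = √w ^ 2 from hw2.symm, Real.sqrt_sq hr.le]
  field_simp
  ring

theorem ip_J_self_of_real {u : H} (hu : conjH u = u) : ip u (J u) = 0 := by
  have hJ : conjH (J u) = J u := by rw [conjH_J, hu]
  have h := ip_comm_of_real hu hJ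
  rw [ip_J_left] at h
  exact self_eq_neg.1 h

theorem P0_apply (u : H) : P0 ν σ w u = ((2 / Delta ν σ w : ℝ) : ℂ) •
    (ip u (J (dSol ν σ w)) • J (Sol ν σ w) + ip u (Sol ν σ w) • dSol ν σ w) := by
  simp only [P0, add_apply, smul_apply, ContinuousLinearMap.smulRight_apply, symp_apply, J_J,
    ip_neg_right, rsmul_eq]
  push_cast
  module

theorem P1_apply (hσ : 1 / √2 < σ) (hσ1 : σ < 1) (hw : 0 < w) (u : H) : P1 σ w u =
    ((ip (PsiT Complex.I σ w) (J (PsiT Complex.I σ w)))⁻¹ * ip u (J (PsiT Complex.I σ w)))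
        • PsiT Complex.I σ w
      + ((ip (PsiT (-Complex.I) σ w) (J (PsiT (-Complex.I) σ w)))⁻¹
        * ip u (J (PsiT (-Complex.I) σ w))) • PsiT (-Complex.I) σ w := by
  simp only [P1, add_apply, smul_apply, ContinuousLinearMap.smulRight_apply, symp_apply,
    PsiStar_eq hσ hσ1 hw, Psi_eq, smul_smul, inv_neg, neg_mul_neg]

theorem Pc_apply (u : H) : Pc ν σ w u = u - P0 ν σ w u - P1 σ w u := by
  simp [Pc]

theorem adjoint_eq_of {A : H →L[ℂ] H} {v x : H} (h : ∀ u, ip (A u) v = ip u x) :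
    ContinuousLinearMap.adjoint A v = x := by
  refine ext_inner_right ℂ fun u => ?_
  rw [ContinuousLinearMap.adjoint_inner_left]
  exact h u

theorem ip_P0adj (u v : H) : ip u (P0adj ν σ w v) = ip (P0 ν σ w u) v :=
  ContinuousLinearMap.adjoint_inner_left _ _ _

theorem ip_Pcadj (u v : H) : ip u (Pcadj ν σ w v) = ip (Pc ν σ w u) v :=
  ContinuousLinearMap.adjoint_inner_left _ _ _

theorem P0adj_apply (v : H) : P0adj ν σ w v =
    (((2 / Delta ν σ w : ℝ) : ℂ) * ip v (J (Sol ν σ w))) • J (dSol ν σ w)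
      + (((2 / Delta ν σ w : ℝ) : ℂ) * ip v (dSol ν σ w)) • Sol ν σ w := by
  refine adjoint_eq_of fun u => ?_
  rw [P0_apply]
  simp only [ip_smul_left, ip_add_left, ip_add_right, ip_smul_right, map_mul, ip_conj,
    Complex.conj_ofReal]
  ring

/-- In this form the adjoint only subtracts combinations of Φ, J dΦ/dω, JΨ and JΨ*, all in V. Hence
it preserves V although it is defined by L² duality. -/
theorem Pcadj_apply (hσ : 1 / √2 < σ) (hσ1 : σ < 1) (hw : 0 < w) (v : H) : Pcadj ν σ w v =
    v - P0adj ν σ w v -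
      ((conj (ip (PsiT Complex.I σ w) (J (PsiT Complex.I σ w)))⁻¹ * ip v (PsiT Complex.I σ w))
        • J (PsiT Complex.I σ w)
      + (conj (ip (PsiT (-Complex.I) σ w) (J (PsiT (-Complex.I) σ w)))⁻¹
        * ip v (PsiT (-Complex.I) σ w)) • J (PsiT (-Complex.I) σ w)) := by
  refine adjoint_eq_of fun u => ?_
  rw [Pc_apply, P1_apply hσ hσ1 hw, ip_sub_left, ip_sub_left, ip_sub_right, ip_sub_right,
    ip_P0adj]
  simp only [ip_smul_left, ip_add_left, ip_add_right, ip_smul_right, map_mul, ip_conj,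
    Complex.conj_conj]
  ring

theorem P0adj_mem_V (hν : 0 < ν) (hσ : 0 < σ) (hw : 0 < w) (v : H) : P0adj ν σ w v ∈ V := by
  rw [P0adj_apply]
  exact add_mem_V (smul_mem_V _ (J_mem_V (dSol_mem_V hν hσ hw))) (smul_mem_V _ (Sol_mem_V hw))

theorem Pcadj_mem_V (hν : 0 < ν) (hσ : 1 / √2 < σ) (hσ1 : σ < 1) (hw : 0 < w) {v : H}
    (hv : v ∈ V) : Pcadj ν σ w v ∈ V := by
  rw [Pcadj_apply hσ hσ1 hw]
  exact sub_mem_V (sub_mem_V hv (P0adj_mem_V hν (sigma_pos hσ) hw v))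
    (add_mem_V (smul_mem_V _ (J_mem_V (PsiT_mem_V hσ hσ1 hw)))
      (smul_mem_V _ (J_mem_V (PsiT_mem_V hσ hσ1 hw))))

theorem P0_mem_V (hν : 0 < ν) (hσ : 0 < σ) (hw : 0 < w) (u : H) : P0 ν σ w u ∈ V := by
  rw [P0_apply]
  exact smul_mem_V _ (add_mem_V (smul_mem_V _ (J_mem_V (Sol_mem_V hw)))
    (smul_mem_V _ (dSol_mem_V hν hσ hw)))

theorem ip_Sol_dSol (hν : 0 < ν) (hσ : 0 < σ) (hw : 0 < w) :
    ip (Sol ν σ w) (dSol ν σ w) = ((Delta ν σ w / 2 : ℝ) : ℂ) := by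
  rw [← ip_conj, ip_dSol_Sol hν hσ hw, Complex.conj_ofReal]

theorem two_div_mul_half {Δ : ℝ} (h : Δ ≠ 0) : ((2 / Δ : ℝ) : ℂ) * ((Δ / 2 : ℝ) : ℂ) = 1 := by
  norm_cast
  field_simp

theorem P0_J_Sol (hν : 0 < ν) (hσ : 0 < σ) (hσ1 : σ < 1) (hw : 0 < w) :
    P0 ν σ w (J (Sol ν σ w)) = J (Sol ν σ w) := by
  rw [P0_apply, ip_J_J, ip_Sol_dSol hν hσ hw, ip_J_left, ip_J_self_of_real (conjH_Sol hw),
    neg_zero, zero_smul, add_zero, smul_smul, two_div_mul_half (Delta_ne hν hσ hσ1 hw), one_smul]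

theorem P0_dSol (hν : 0 < ν) (hσ : 0 < σ) (hσ1 : σ < 1) (hw : 0 < w) :
    P0 ν σ w (dSol ν σ w) = dSol ν σ w := by
  rw [P0_apply, ip_J_self_of_real (conjH_dSol hν hσ hw), ip_dSol_Sol hν hσ hw,
    zero_smul, zero_add, smul_smul, two_div_mul_half (Delta_ne hν hσ hσ1 hw), one_smul]

theorem P0_P0 (hν : 0 < ν) (hσ : 0 < σ) (hσ1 : σ < 1) (hw : 0 < w) (u : H) :
    P0 ν σ w (P0 ν σ w u) = P0 ν σ w u := by
  conv_lhs => rw [P0_apply u]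
  rw [map_smul, map_add, map_smul, map_smul, P0_J_Sol hν hσ hσ1 hw, P0_dSol hν hσ hσ1 hw,
    ← P0_apply]

/-- The range of (P⁰)* is spanned by Φ and J dΦ/dω, where Q_L(u,·) takes the values 0 and -(u,Φ). -/
theorem QL_P0adj (hν : 0 < ν) (hσ : 0 < σ) (hw : 0 < w) {u : H} (hu : u ∈ V)
    (h : ip u (Sol ν σ w) = 0) (v : H) : QL σ w u (P0adj ν σ w v) = 0 := by
  have hJ := J_mem_V (dSol_mem_V (ν := ν) hν hσ hw)
  have hS : Sol ν σ w ∈ V := Sol_mem_V hw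
  rw [P0adj_apply, QL_add_right _ _ _ (smul_mem_V _ hJ) (smul_mem_V _ hS),
    QL_smul_right _ _ _ _ hJ, QL_smul_right _ _ _ _ hS, QL_Sol hw hu, QL_J_dSol hν hσ hw hu, h]
  simp

/-- Vectors without component in `X⁰`. -/
theorem P0_eq_zero_iff (hν : 0 < ν) (hσ : 0 < σ) (hσ1 : σ < 1) (hw : 0 < w) (u : H) :
    P0 ν σ w u = 0 ↔ ip u (J (dSol ν σ w)) = 0 ∧ ip u (Sol ν σ w) = 0 := by
  constructor
  · intro h
    have h2 : ((2 / Delta ν σ w : ℝ) : ℂ) ≠ 0 := by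
      exact_mod_cast div_ne_zero two_ne_zero (Delta_ne hν hσ hσ1 hw)
    rw [P0_apply, smul_eq_zero_iff_right h2] at h
    have hΔ : ((Delta ν σ w / 2 : ℝ) : ℂ) ≠ 0 := by
      exact_mod_cast div_ne_zero (Delta_ne hν hσ hσ1 hw) two_ne_zero
    constructor
    · have := congrArg (fun x => ip x (J (dSol ν σ w))) h
      simp only [ip_add_left, ip_smul_left, ip_J_J, ip_Sol_dSol hν hσ hw,
        ip_J_self_of_real (conjH_dSol hν hσ hw), mul_zero, add_zero, ip_zero_left] at this
      exact (mul_eq_zero.1 this).resolve_right hΔ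
    · have := congrArg (fun x => ip x (Sol ν σ w)) h
      simp only [ip_add_left, ip_smul_left, ip_J_left, ip_dSol_Sol hν hσ hw,
        ip_J_self_of_real (conjH_Sol hw), mul_zero, neg_zero, zero_add, ip_zero_left] at this
      exact (mul_eq_zero.1 this).resolve_right hΔ
  · rintro ⟨h1, h2⟩
    rw [P0_apply, h1, h2, zero_smul, zero_smul, add_zero, smul_zero]

theorem P1_eq_zero {u : H} (hσ : 1 / √2 < σ) (hσ1 : σ < 1) (hw : 0 < w)
    (h1 : ip u (J (PsiT Complex.I σ w)) = 0) (h2 : ip u (J (PsiT (-Complex.I) σ w)) = 0) :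
    P1 σ w u = 0 := by
  rw [P1_apply hσ hσ1 hw, h1, h2]
  simp

theorem P0_PsiT {τ : ℂ} (hν : 0 < ν) (hσ : 1 / √2 < σ) (hσ1 : σ < 1) (hw : 0 < w)
    (hτ : τ ^ 2 = -1) (hτc : conj τ = -τ) : P0 ν σ w (PsiT τ σ w) = 0 :=
  (P0_eq_zero_iff hν (sigma_pos hσ) hσ1 hw _).2
    ⟨ip_PsiT_J_dSol hν hσ hσ1 hw hτ hτc, ip_PsiT_Sol hσ hσ1 hw hτ hτc⟩

theorem ip_J_Sol_J_PsiT {τ : ℂ} (hσ : 1 / √2 < σ) (hσ1 : σ < 1) (hw : 0 < w)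
    (hτ : τ ^ 2 = -1) (hτc : conj τ = -τ) : ip (J (Sol ν σ w)) (J (PsiT τ σ w)) = 0 := by
  rw [ip_J_J, ← ip_conj, ip_PsiT_Sol hσ hσ1 hw hτ hτc, map_zero]

theorem ip_dSol_J_PsiT {τ : ℂ} (hν : 0 < ν) (hσ : 1 / √2 < σ) (hσ1 : σ < 1) (hw : 0 < w)
    (hτ : τ ^ 2 = -1) (hτc : conj τ = -τ) : ip (dSol ν σ w) (J (PsiT τ σ w)) = 0 := by
  have h := ip_J_left (dSol ν σ w) (PsiT τ σ w)
  rw [← ip_conj, ip_PsiT_J_dSol hν hσ hσ1 hw hτ hτc, map_zero] at h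
  exact neg_eq_zero.1 h.symm

theorem Pc_J_Sol (hν : 0 < ν) (hσ : 1 / √2 < σ) (hσ1 : σ < 1) (hw : 0 < w) :
    Pc ν σ w (J (Sol ν σ w)) = 0 := by
  rw [Pc_apply, P0_J_Sol hν (sigma_pos hσ) hσ1 hw, P1_eq_zero hσ hσ1 hw
    (ip_J_Sol_J_PsiT hσ hσ1 hw I_sq' Complex.conj_I)
    (ip_J_Sol_J_PsiT hσ hσ1 hw neg_I_sq conj_neg_I)]
  simp

theorem Pc_dSol (hν : 0 < ν) (hσ : 1 / √2 < σ) (hσ1 : σ < 1) (hw : 0 < w) :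
    Pc ν σ w (dSol ν σ w) = 0 := by
  rw [Pc_apply, P0_dSol hν (sigma_pos hσ) hσ1 hw, P1_eq_zero hσ hσ1 hw
    (ip_dSol_J_PsiT hν hσ hσ1 hw I_sq' Complex.conj_I)
    (ip_dSol_J_PsiT hν hσ hσ1 hw neg_I_sq conj_neg_I)]
  simp

theorem ip_PsiI_J_PsiNeg (hσ : 1 / √2 < σ) (hσ1 : σ < 1) (hw : 0 < w) :
    ip (PsiT Complex.I σ w) (J (PsiT (-Complex.I) σ w)) = 0 :=
  ip_PsiT_J_PsiT_neg hσ hσ1 hw I_sq' Complex.conj_I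

theorem ip_PsiNeg_J_PsiI (hσ : 1 / √2 < σ) (hσ1 : σ < 1) (hw : 0 < w) :
    ip (PsiT (-Complex.I) σ w) (J (PsiT Complex.I σ w)) = 0 := by
  have := ip_PsiT_J_PsiT_neg hσ hσ1 hw neg_I_sq conj_neg_I
  rwa [neg_neg] at this

theorem Pc_PsiI (hν : 0 < ν) (hσ : 1 / √2 < σ) (hσ1 : σ < 1) (hw : 0 < w) :
    Pc ν σ w (PsiT Complex.I σ w) = 0 := by
  rw [Pc_apply, P0_PsiT hν hσ hσ1 hw I_sq' Complex.conj_I, P1_apply hσ hσ1 hw,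
    ip_PsiI_J_PsiNeg hσ hσ1 hw, inv_mul_cancel₀ (ip_PsiT_J_PsiT_ne hσ hσ1 hw I_sq' Complex.conj_I)]
  simp

theorem Pc_PsiNeg (hν : 0 < ν) (hσ : 1 / √2 < σ) (hσ1 : σ < 1) (hw : 0 < w) :
    Pc ν σ w (PsiT (-Complex.I) σ w) = 0 := by
  rw [Pc_apply, P0_PsiT hν hσ hσ1 hw neg_I_sq conj_neg_I, P1_apply hσ hσ1 hw,
    ip_PsiNeg_J_PsiI hσ hσ1 hw, inv_mul_cancel₀ (ip_PsiT_J_PsiT_ne hσ hσ1 hw neg_I_sq conj_neg_I)]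
  simp

theorem P1_P1 (hσ : 1 / √2 < σ) (hσ1 : σ < 1) (hw : 0 < w) {u : H} {τ : ℂ}
    (hτ : τ = Complex.I ∨ τ = -Complex.I) :
    ip (P1 σ w u) (J (PsiT τ σ w)) = ip u (J (PsiT τ σ w)) := by
  rw [P1_apply hσ hσ1 hw]
  have h1 := ip_PsiT_J_PsiT_ne hσ hσ1 hw I_sq' Complex.conj_I
  have h2 := ip_PsiT_J_PsiT_ne hσ hσ1 hw neg_I_sq conj_neg_I
  rcases hτ with rfl | rfl
  · simp only [ip_add_left, ip_smul_left, ip_PsiNeg_J_PsiI hσ hσ1 hw]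
    field_simp
    ring
  · simp only [ip_add_left, ip_smul_left, ip_PsiI_J_PsiNeg hσ hσ1 hw]
    field_simp
    ring

/-- Vectors in `X^c` have no component in `X⁰` and `X¹`. -/
theorem Xc_orthogonal (hν : 0 < ν) (hσ : 1 / √2 < σ) (hσ1 : σ < 1) (hw : 0 < w) {f : H}
    (hf : f ∈ Xc ν σ w) : ip f (J (dSol ν σ w)) = 0 ∧ ip f (Sol ν σ w) = 0 ∧
      ip f (J (PsiT Complex.I σ w)) = 0 ∧ ip f (J (PsiT (-Complex.I) σ w)) = 0 := by
  obtain ⟨u, rfl⟩ := hf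
  have hσ0 := sigma_pos hσ
  have h0 : P0 ν σ w (Pc ν σ w u) = 0 := by
    rw [Pc_apply, map_sub, map_sub, P0_P0 hν hσ0 hσ1 hw, sub_self, zero_sub, P1_apply hσ hσ1 hw,
      map_add, map_smul, map_smul, P0_PsiT hν hσ hσ1 hw I_sq' Complex.conj_I,
      P0_PsiT hν hσ hσ1 hw neg_I_sq conj_neg_I]
    simp
  obtain ⟨h1, h2⟩ := (P0_eq_zero_iff hν hσ0 hσ1 hw _).1 h0
  have h3 : ∀ τ : ℂ, τ = Complex.I ∨ τ = -Complex.I → τ ^ 2 = -1 → conj τ = -τ →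
      ip (Pc ν σ w u) (J (PsiT τ σ w)) = 0 := by
    intro τ hτ hτ2 hτc
    rw [Pc_apply, ip_sub_left, ip_sub_left, P1_P1 hσ hσ1 hw hτ, P0_apply, ip_smul_left,
      ip_add_left, ip_smul_left, ip_smul_left, ip_J_Sol_J_PsiT hσ hσ1 hw hτ2 hτc,
      ip_dSol_J_PsiT hν hσ hσ1 hw hτ2 hτc]
    ring
  exact ⟨h1, h2, h3 _ (Or.inl rfl) I_sq' Complex.conj_I, h3 _ (Or.inr rfl) neg_I_sq conj_neg_I⟩

theorem Pc_of_mem_Xc (hν : 0 < ν) (hσ : 1 / √2 < σ) (hσ1 : σ < 1) (hw : 0 < w) {f : H}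
    (hf : f ∈ Xc ν σ w) : Pc ν σ w f = f := by
  obtain ⟨h1, h2, h3, h4⟩ := Xc_orthogonal hν hσ hσ1 hw hf
  rw [Pc_apply, (P0_eq_zero_iff hν (sigma_pos hσ) hσ1 hw f).2 ⟨h1, h2⟩,
    P1_eq_zero hσ hσ1 hw h3 h4, sub_zero, sub_zero]

/-- On the four vectors subtracted by (P^c)*, the form Q_L(f,·) reduces to L² pairings, all of which
vanish on X^c. -/
theorem QL_Pcadj (hν : 0 < ν) (hσ : 1 / √2 < σ) (hσ1 : σ < 1) (hw : 0 < w) {f : H}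
    (hf : f ∈ Xc ν σ w) (hfV : f ∈ V) {v : H} (hv : v ∈ V) :
    QL σ w f (Pcadj ν σ w v) = QL σ w f v := by
  obtain ⟨h1, h2, h3, h4⟩ := Xc_orthogonal hν hσ hσ1 hw hf
  have hP0 := P0adj_mem_V hν (sigma_pos hσ) hw v
  have hJ1 := J_mem_V (PsiT_mem_V (τ := Complex.I) hσ hσ1 hw)
  have hJ2 := J_mem_V (PsiT_mem_V (τ := -Complex.I) hσ hσ1 hw)
  rw [Pcadj_apply hσ hσ1 hw, QL_sub_right _ _ _ (sub_mem_V hv hP0)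
      (add_mem_V (smul_mem_V _ hJ1) (smul_mem_V _ hJ2)),
    QL_sub_right _ _ _ hv hP0, QL_P0adj hν (sigma_pos hσ) hw hfV h2,
    QL_add_right _ _ _ (smul_mem_V _ hJ1) (smul_mem_V _ hJ2), QL_smul_right _ _ _ _ hJ1,
    QL_smul_right _ _ _ _ hJ2, QL_J_PsiT hσ hσ1 hw I_sq' Complex.conj_I hfV,
    QL_J_PsiT hσ hσ1 hw neg_I_sq conj_neg_I hfV, h3, h4]
  ring

end solitary

/-! ## Differentiability of the projections -/

/-- The functional depends antilinearly on its vector, so bilinearity holds over ℝ only; this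
suffices to differentiate the projections in ω. -/
theorem isBoundedBilinearMap_rankOne :
    IsBoundedBilinearMap ℝ fun p : H × H => (symp p.1).smulRight p.2 where
  add_left u v b := by
    ext1 x
    simp only [ContinuousLinearMap.smulRight_apply, symp_apply, add_apply, map_add, ip_add_right]
    module
  smul_left r u b := by
    ext1 x
    simp only [ContinuousLinearMap.smulRight_apply, symp_apply, smul_apply, rsmul_eq, map_smul,
      ip_smul_right, Complex.conj_ofReal]
    module
  add_right u b c := by
    ext1 x
    simp only [ContinuousLinearMap.smulRight_apply, symp_apply, add_apply, smul_add]
  smul_right r u b := by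
    ext1 x
    simp only [ContinuousLinearMap.smulRight_apply, symp_apply, smul_apply, rsmul_eq]
    module
  bound := by
    refine ⟨‖J‖ + 1, by positivity, fun u b => ?_⟩
    rw [ContinuousLinearMap.norm_smulRight_apply, symp, norm_neg, innerSL_apply_norm]
    gcongr
    refine (J.le_opNorm u).trans ?_
    gcongr
    linarith

theorem differentiableAt_rankOne {a b : ℝ → H} {w : ℝ} (ha : DifferentiableAt ℝ a w)
    (hb : DifferentiableAt ℝ b w) :
    DifferentiableAt ℝ (fun s => (symp (a s)).smulRight (b s)) w := by
  have h1 : DifferentiableAt ℝ (fun s => (a s, b s)) w := ha.prodMk hb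
  have h2 : DifferentiableAt ℝ (fun p : H × H => (symp p.1).smulRight p.2) (a w, b w) :=
    isBoundedBilinearMap_rankOne.differentiableAt (a w, b w)
  have h3 := h2.comp w h1
  exact h3

/-- `J` as a real linear operator. -/
def JR : H →L[ℝ] H :=
  { toFun := J, map_add' := map_add J, map_smul' := fun r u => by
      simp only [rsmul_eq, map_smul, RingHom.id_apply], cont := J.continuous }

theorem DifferentiableAt.J_comp {a : ℝ → H} {w : ℝ} (ha : DifferentiableAt ℝ a w) :
    DifferentiableAt ℝ (fun s => J (a s)) w :=
  JR.differentiableAt.comp w ha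

theorem differentiableAt_P0 {ν σ w : ℝ} (hν : 0 < ν) (hσ : 0 < σ) (hσ1 : σ < 1) (hw : 0 < w) :
    DifferentiableAt ℝ (P0 ν σ) w := by
  have h1 := (hasDerivAt_Sol hν hσ hw).differentiableAt
  have h2 := differentiableAt_dSol hν hσ hw
  have h3 : DifferentiableAt ℝ (fun s => 2 / Delta ν σ s) w :=
    (differentiableAt_const 2).div (differentiableAt_Delta hν hσ hw) (Delta_ne hν hσ hσ1 hw)
  exact (h3.neg.smul (differentiableAt_rankOne h2 (DifferentiableAt.J_comp h1))).add
    (h3.smul (differentiableAt_rankOne (DifferentiableAt.J_comp h1) h2))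

theorem differentiableAt_symp {a : ℝ → H} {w : ℝ} (ha : DifferentiableAt ℝ a w) :
    DifferentiableAt ℝ (fun s => symp (a s) (a s)) w := by
  simp only [symp_apply, ip]
  exact ((DifferentiableAt.J_comp ha).inner ℂ ha).neg

theorem differentiableAt_P1 {σ w : ℝ} (hσ : 1 / √2 < σ) (hσ1 : σ < 1) (hw : 0 < w) :
    DifferentiableAt ℝ (P1 σ) w := by
  have h : ∀ τ : ℂ, τ ^ 2 = -1 → conj τ = -τ → DifferentiableAt ℝ (fun s =>
      (symp (PsiT τ σ s) (PsiT τ σ s))⁻¹ • (symp (PsiT τ σ s)).smulRight (PsiT τ σ s)) w := by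
    intro τ hτ hτc
    have h1 : DifferentiableAt ℝ (PsiT τ σ) w := differentiableAt_PsiT hσ hσ1 hw
    refine (DifferentiableAt.inv (differentiableAt_symp h1) ?_).smul
      (differentiableAt_rankOne h1 h1)
    rw [symp_apply, neg_ne_zero]
    exact ip_PsiT_J_PsiT_ne hσ hσ1 hw hτ hτc
  refine ((h _ I_sq' Complex.conj_I).add (h _ neg_I_sq conj_neg_I)).congr_of_eventuallyEq ?_
  filter_upwards [lt_mem_nhds hw] with s hs
  simp only [P1, PsiStar_eq hσ hσ1 hs, Psi_eq, Pi.add_apply]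

theorem differentiableAt_Pc {ν σ w : ℝ} (hν : 0 < ν) (hσ : 1 / √2 < σ) (hσ1 : σ < 1) (hw : 0 < w) :
    DifferentiableAt ℝ (Pc ν σ) w :=
  ((differentiableAt_const _).sub (differentiableAt_P0 hν (sigma_pos hσ) hσ1 hw)).sub
    (differentiableAt_P1 hσ hσ1 hw)

theorem differentiableAt_PsiStar {σ w : ℝ} (hσ : 1 / √2 < σ) (hσ1 : σ < 1) (hw : 0 < w) :
    DifferentiableAt ℝ (PsiStar σ) w := by
  refine (differentiableAt_PsiT (τ := -Complex.I) hσ hσ1 hw).congr_of_eventuallyEq ?_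
  filter_upwards [lt_mem_nhds hw] with s hs using PsiStar_eq hσ hσ1 hs

end ConcNLS

end

/-! ### Differentiation along the flow and the modulation system -/

noncomputable section

namespace ConcNLS

/-! ## Product rules -/

theorem tendsto_clm_apply {ι : Type*} {l : Filter ι} {T : ι → H →L[ℂ] H} {T₀ : H →L[ℂ] H}
    {x : ι → H} {x₀ : H} (hT : Tendsto T l (𝓝 T₀)) (hx : Tendsto x l (𝓝 x₀)) :
    Tendsto (fun i => T i (x i)) l (𝓝 (T₀ x₀)) :=
  (isBoundedBilinearMap_apply.continuous.tendsto (T₀, x₀)).comp (hT.prodMk_nhds hx)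

theorem tendsto_slope_apply {T : ℝ → H →L[ℂ] H} {T' : H →L[ℂ] H} {S : Set ℝ} {t : ℝ}
    (hT : HasDerivWithinAt T T' S t) {x : ℝ → H} (hx : ContinuousWithinAt x S t) :
    Tendsto (fun s => slope T t s (x s)) (𝓝[S \ {t}] t) (𝓝 (T' (x t))) :=
  tendsto_clm_apply (hasDerivWithinAt_iff_tendsto_slope.1 hT)
    (hx.tendsto.mono_left (nhdsWithin_mono _ sdiff_subset))

theorem hasDerivWithinAt_clm_apply_const {T : ℝ → H →L[ℂ] H} {T' : H →L[ℂ] H} {S : Set ℝ} {t : ℝ}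
    (hT : HasDerivWithinAt T T' S t) (x : H) : HasDerivWithinAt (fun s => T s x) (T' x) S t := by
  rw [hasDerivWithinAt_iff_tendsto_slope]
  refine (tendsto_slope_apply hT (x := fun _ => x) continuousWithinAt_const).congr fun s => ?_
  simp only [slope, vsub_eq_sub, smul_apply, sub_apply]

/-- The first factor has no strong derivative. Writing g(s) = g(t) + (g(s)-g(t)), the first part is
differentiable by assumption, and in the second the strongly convergent slope of g meets a merely
continuous χ. -/
theorem hasDerivWithinAt_ip {χ g : ℝ → H} {g' : H} {d : ℂ} {S : Set ℝ} {t : ℝ}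
    (hg : HasDerivWithinAt g g' S t) (hχ : ContinuousWithinAt χ S t)
    (h : HasDerivWithinAt (fun s => ip (χ s) (g t)) d S t) :
    HasDerivWithinAt (fun s => ip (χ s) (g s)) (d + ip (χ t) g') S t := by
  have h2 : HasDerivWithinAt (fun s => ip (χ s) (g s - g t)) (ip (χ t) g') S t := by
    rw [hasDerivWithinAt_iff_tendsto_slope]
    have hl := Tendsto.inner (𝕜 := ℂ) (hasDerivWithinAt_iff_tendsto_slope.1 hg)
      (hχ.tendsto.mono_left (nhdsWithin_mono _ sdiff_subset))
    refine hl.congr fun s => ?_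
    have e : inner ℂ (slope g t s) (χ s) = ip (χ s) (slope g t s) := rfl
    rw [e]
    simp only [slope, vsub_eq_sub, sub_self, ip_rsmul_right, ip_zero_right, sub_zero,
      Complex.real_smul]
  refine (h.add h2).congr_of_eventuallyEq (Eventually.of_forall fun s => ?_) ?_
  · simp only [Pi.add_apply]; rw [← ip_add_right, add_sub_cancel]
  · simp only [Pi.add_apply]; rw [← ip_add_right, add_sub_cancel]

theorem hasDerivWithinAt_ip_clm {T : ℝ → H →L[ℂ] H} {T' : H →L[ℂ] H} {χ : ℝ → H} {v : H} {d : ℂ}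
    {S : Set ℝ} {t : ℝ} (hT : HasDerivWithinAt T T' S t) (hχ : ContinuousWithinAt χ S t)
    (h : HasDerivWithinAt (fun s => ip (T t (χ s)) v) d S t) :
    HasDerivWithinAt (fun s => ip (T s (χ s)) v) (d + ip (T' (χ t)) v) S t := by
  have h2 : HasDerivWithinAt (fun s => ip ((T s - T t) (χ s)) v) (ip (T' (χ t)) v) S t := by
    rw [hasDerivWithinAt_iff_tendsto_slope]
    have hl := Tendsto.inner (𝕜 := ℂ) (tendsto_const_nhds (x := v)) (tendsto_slope_apply hT hχ)
    refine hl.congr fun s => ?_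
    have e : inner ℂ v (slope T t s (χ s)) = ip (slope T t s (χ s)) v := rfl
    rw [e]
    simp only [slope, vsub_eq_sub, sub_self, smul_apply, ip_rsmul_left, zero_apply, ip_zero_left,
      sub_zero, Complex.real_smul]
  refine (h.add h2).congr_of_eventuallyEq (Eventually.of_forall fun s => ?_) ?_
  · simp only [Pi.add_apply]; rw [← ip_add_left, sub_apply, add_sub_cancel]
  · simp only [Pi.add_apply]; rw [← ip_add_left, sub_apply, add_sub_cancel]

/-! ## The derivative of the projection onto the generalised kernel -/

section

variable {ν σ w : ℝ}

theorem hasDerivAt_P0_apply (hν : 0 < ν) (hσ : 0 < σ) (hσ1 : σ < 1) (hw : 0 < w) (u : H) :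
    HasDerivAt (fun s => P0 ν σ s u) (dP0 ν σ w u) w := by
  have h := (differentiableAt_P0 hν hσ hσ1 hw).hasDerivAt
  rw [← hasDerivWithinAt_univ] at h ⊢
  exact hasDerivWithinAt_clm_apply_const h u

/-- As P⁰u = 0 at w, the difference quotients of s ↦ P⁰u are fixed by P⁰ at s; the relation survives
the limit s → w. -/
theorem P0_dP0 (hν : 0 < ν) (hσ : 0 < σ) (hσ1 : σ < 1) (hw : 0 < w) {u : H}
    (hu : P0 ν σ w u = 0) : P0 ν σ w (dP0 ν σ w u) = dP0 ν σ w u := by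
  have h1 := hasDerivAt_iff_tendsto_slope.1 (hasDerivAt_P0_apply hν hσ hσ1 hw u)
  have h2 : Tendsto (P0 ν σ) (𝓝[≠] w) (𝓝 (P0 ν σ w)) :=
    ((differentiableAt_P0 hν hσ hσ1 hw).continuousAt.tendsto).mono_left nhdsWithin_le_nhds
  refine tendsto_nhds_unique (Tendsto.congr' ?_ (tendsto_clm_apply h2 h1)) h1
  filter_upwards [mem_nhdsWithin_of_mem_nhds (lt_mem_nhds hw)] with s hs
  simp only [slope, vsub_eq_sub, hu, sub_zero, rsmul_eq, map_smul, P0_P0 hν hσ hσ1 hs]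

theorem conjH_P0 (hν : 0 < ν) (hσ : 0 < σ) (hw : 0 < w) {u : H} (hu : conjH u = u) :
    conjH (P0 ν σ w u) = P0 ν σ w u := by
  have hS : conjH (Sol ν σ w) = Sol ν σ w := conjH_Sol hw
  have hd : conjH (dSol ν σ w) = dSol ν σ w := conjH_dSol hν hσ hw
  have hJd : conjH (J (dSol ν σ w)) = J (dSol ν σ w) := by rw [conjH_J, hd]
  rw [P0_apply]
  simp only [conjH_smul, map_add, conjH_J, hS, hd, ip_conj, Complex.conj_ofReal]
  rw [ip_comm_of_real hJd hu, ip_comm_of_real hS hu]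

theorem conjH_dP0 (hν : 0 < ν) (hσ : 0 < σ) (hσ1 : σ < 1) (hw : 0 < w) {u : H}
    (hu : conjH u = u) : conjH (dP0 ν σ w u) = dP0 ν σ w u := by
  have h1 := hasDerivAt_P0_apply hν hσ hσ1 hw u
  have h2 : HasDerivAt (fun s => conjH (P0 ν σ s u)) (conjH (dP0 ν σ w u)) w :=
    conjH.hasFDerivAt.comp_hasDerivAt w h1
  refine (h2.congr_of_eventuallyEq ?_).unique h1
  filter_upwards [lt_mem_nhds hw] with s hs using (conjH_P0 hν hσ hs hu).symm

theorem conjH_modDir (hν : 0 < ν) (hσ : 0 < σ) (hσ1 : σ < 1) (hw : 0 < w) {u : H}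
    (hu : conjH u = u) : conjH (modDir ν σ w u) = modDir ν σ w u := by
  rw [modDir, map_sub, conjH_dSol hν hσ hw, conjH_dP0 hν hσ hσ1 hw hu]

theorem P0_modDir (hν : 0 < ν) (hσ : 0 < σ) (hσ1 : σ < 1) (hw : 0 < w) {u : H}
    (hu : P0 ν σ w u = 0) : P0 ν σ w (modDir ν σ w u) = modDir ν σ w u := by
  rw [modDir, map_sub, P0_dSol hν hσ hσ1 hw, P0_dP0 hν hσ hσ1 hw hu]

/-- A parameter derivative taken in L² could leave V; being fixed by P⁰ brings the vector back,
since the range of P⁰ lies in V. -/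
theorem modDir_mem_V (hν : 0 < ν) (hσ : 0 < σ) (hσ1 : σ < 1) (hw : 0 < w) {u : H}
    (hu : P0 ν σ w u = 0) : modDir ν σ w u ∈ V := by
  rw [← P0_modDir hν hσ hσ1 hw hu]
  exact P0_mem_V hν hσ hw _

theorem P0adj_J (u : H) : P0adj ν σ w (J u) = J (P0 ν σ w u) := by
  rw [P0adj_apply, P0_apply, ip_J_J, ip_J_left]
  simp only [map_smul, map_add, J_J]
  module

/-- On real fields (P⁰Ju,v) is 2/Δ times the determinant of the pairings of u and v with dΦ/dω and
JΦ, hence antisymmetric. -/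
theorem ip_P0_J_self (hν : 0 < ν) (hσ : 0 < σ) (hw : 0 < w) {u : H} (hu : conjH u = u) :
    ip (P0 ν σ w (J u)) u = 0 := by
  have hS : conjH (Sol ν σ w) = Sol ν σ w := conjH_Sol hw
  have hd : conjH (dSol ν σ w) = dSol ν σ w := conjH_dSol hν hσ hw
  have hJS : conjH (J (Sol ν σ w)) = J (Sol ν σ w) := by rw [conjH_J, hS]
  rw [P0_apply, ip_J_J, ip_J_left, ip_smul_left, ip_add_left, ip_smul_left, ip_smul_left,
    ip_comm_of_real hJS hu, ip_comm_of_real hd hu]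
  ring

/-- Two test vectors decouple the system: Φ+u removes b by antisymmetry, and J applied to `modDir`
removes a, since (m,Jm) = 0 for real m. By the invariance of m under P⁰, the surviving coefficient
is the same denominator up to sign. -/
theorem omega_gamma_equations (hν : 0 < ν) (hσ : 0 < σ) (hσ1 : σ < 1) (hw : 0 < w) {u : H}
    (hu : conjH u = u) (hP0 : P0 ν σ w u = 0) {a b : ℝ} {p : C2}
    (h : ∀ v, (b : ℂ) * ip (P0 ν σ w (J (Sol ν σ w + u))) v - (a : ℂ) * ip (modDir ν σ w u) v
      + ip p (charge (P0adj ν σ w v)) = 0) :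
    modDen ν σ w u * a = ip p (charge (P0adj ν σ w (Sol ν σ w + u))) ∧
      modDen ν σ w u * b = -ip p (charge (J (modDir ν σ w u))) := by
  have hreal : conjH (Sol ν σ w + u) = Sol ν σ w + u := by rw [map_add, conjH_Sol hw, hu]
  have hm := conjH_modDir hν hσ hσ1 hw hu
  constructor
  · have h1 := h (Sol ν σ w + u)
    rw [ip_P0_J_self hν hσ hw hreal] at h1
    rw [modDen]
    linear_combination -h1
  · have h1 := h (J (modDir ν σ w u))
    rw [← ip_P0adj, P0adj_J, P0_modDir hν hσ hσ1 hw hP0, ip_J_J, ip_J_self_of_real hm,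
      ip_comm_of_real hreal hm] at h1
    rw [modDen]
    linear_combination h1

end

/-! ## The linear flow tested with fixed vectors -/

theorem weak_flow {ν σ w a b : ℝ} {χ : ℝ → H} {S : Set ℝ} {t : ℝ}
    (h : ∀ v ∈ V, HasDerivWithinAt (fun s => ip (-J (χ s)) v)
        (Qlin σ w (χ t) v + (b : ℂ) * ip (Sol ν σ w + χ t) v + (a : ℂ) * ip (J (dSol ν σ w)) v
          + ip (Nrem ν σ w (charge (χ t))) (charge v)) S t) {v : H} (hv : v ∈ V) :
    HasDerivWithinAt (fun s => ip (χ s) v)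
      (QL σ w (χ t) v + (b : ℂ) * ip (J (Sol ν σ w + χ t)) v - (a : ℂ) * ip (dSol ν σ w) v
        + ip (Jc (Nrem ν σ w (charge (χ t)))) (charge v)) S t := by
  have h1 := h _ (neg_mem_V (J_mem_V hv))
  rw [← QL_eq_Qlin σ w _ hv, charge_neg (J_mem_V hv), charge_J hv] at h1
  simp only [ip_neg_left, ip_neg_right, ip_J_J, neg_neg] at h1
  refine h1.congr_deriv ?_
  rw [ip_J_left, ip_Jc_left]
  ring

theorem QL_PsiT_Pcadj {ν σ w : ℝ} (hν : 0 < ν) (hσ : 1 / √2 < σ) (hσ1 : σ < 1) (hw : 0 < w)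
    {v : H} (hv : v ∈ V) : QL σ w (PsiT Complex.I σ w) (Pcadj ν σ w v) = 0 ∧
      QL σ w (PsiT (-Complex.I) σ w) (Pcadj ν σ w v) = 0 := by
  have hP := Pcadj_mem_V hν hσ hσ1 hw hv
  rw [QL_PsiT_left hσ hσ1 hw I_sq' Complex.conj_I hP, QL_PsiT_left hσ hσ1 hw neg_I_sq conj_neg_I hP,
    ip_Pcadj, ip_Pcadj, Pc_PsiI hν hσ hσ1 hw, Pc_PsiNeg hν hσ hσ1 hw, ip_zero_left, mul_zero,
    mul_zero]
  exact ⟨rfl, rfl⟩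

/-- Since (G_λ,G_λ) = 1/(8π√λ), the charge term in the equation for f does not depend on λ. -/
theorem ip_green_self {lam : ℝ} (hlam : 0 < lam) (p q : C2) :
    ((8 * Real.pi * √lam : ℝ) : ℂ) * ip (green √lam p) (green √lam q) = ip p q := by
  have hs := Real.sqrt_pos.2 hlam
  have hpi := Real.pi_pos
  rw [ip_green_green hs hs, ← mul_assoc, ← Complex.ofReal_mul,
    show 8 * Real.pi * √lam * (1 / (4 * Real.pi * (√lam + √lam))) = 1 by field_simp; norm_num,
    Complex.ofReal_one, one_mul]

theorem hasDerivAt_PsiI {σ w : ℝ} (hσ : 1 / √2 < σ) (hσ1 : σ < 1) (hw : 0 < w) :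
    HasDerivAt (PsiT Complex.I σ) (dPsi σ w) w :=
  (differentiableAt_PsiT hσ hσ1 hw).hasDerivAt

theorem hasDerivAt_PsiNeg {σ w : ℝ} (hσ : 1 / √2 < σ) (hσ1 : σ < 1) (hw : 0 < w) :
    HasDerivAt (PsiT (-Complex.I) σ) (dPsiStar σ w) w := by
  refine (differentiableAt_PsiStar hσ hσ1 hw).hasDerivAt.congr_of_eventuallyEq ?_
  filter_upwards [lt_mem_nhds hw] with s hs using (PsiStar_eq hσ hσ1 hs).symm

theorem hasDerivAt_J {g : ℝ → H} {g' : H} {w : ℝ} (hg : HasDerivAt g g' w) :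
    HasDerivAt (fun s => J (g s)) (J g') w :=
  JR.hasFDerivAt.comp_hasDerivAt w hg

theorem hasDerivAt_ip_ip {g k : ℝ → H} {g' k' : H} {w : ℝ} (hg : HasDerivAt g g' w)
    (hk : HasDerivAt k k' w) :
    HasDerivAt (fun s => ip (g s) (k s)) (ip g' (k w) + ip (g w) k') w :=
  (hk.inner ℂ hg).congr_deriv (add_comm _ _ |>.trans (by simp only [ip]; ring))

/-- `(Ψ*, J Ψ) = 0`, differentiated. -/
theorem ip_PsiNeg_J_dPsi {σ w : ℝ} (hσ : 1 / √2 < σ) (hσ1 : σ < 1) (hw : 0 < w) :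
    ip (dPsiStar σ w) (J (PsiT Complex.I σ w)) + ip (PsiT (-Complex.I) σ w) (J (dPsi σ w)) = 0 := by
  have h1 := hasDerivAt_ip_ip (hasDerivAt_PsiNeg hσ hσ1 hw) (hasDerivAt_J (hasDerivAt_PsiI hσ hσ1 hw))
  have h2 : HasDerivAt (fun _ : ℝ => (0 : ℂ)) 0 w := hasDerivAt_const _ _
  refine h1.unique (h2.congr_of_eventuallyEq ?_)
  filter_upwards [lt_mem_nhds hw] with s hs using ip_PsiNeg_J_PsiI hσ hσ1 hs

end ConcNLS

end

/-! ### The modulation equations -/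

theorem mainTheorem6 (ν σ : ℝ) (hν : 0 < ν) (hσ : 1 / √2 < σ) (hσ1 : σ < 1)
    -- `ω` and `γ` are continuously differentiable on `[0, ∞)`, with derivatives `ω'` and `γ'`
    (ω γ ω' γ' : ℝ → ℝ)
    (hω : ∀ t, 0 ≤ t → HasDerivWithinAt ω (ω' t) (Ici 0) t) (hω' : ContinuousOn ω' (Ici 0))
    (hγ : ∀ t, 0 ≤ t → HasDerivWithinAt γ (γ' t) (Ici 0) t) (hγ' : ContinuousOn γ' (Ici 0))
    (hωpos : ∀ t, 0 ≤ t → 0 < ω t)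
    (χ : ℝ → H) (hχcont : ContinuousOn χ (Ici 0))
    (hχreal : ∀ t, 0 ≤ t → IsRealField (χ t))
    (hχV : ∀ t, 0 ≤ t → χ t ∈ V)
    -- the form equation, with multiplication by `i` written as `-J`
    (hχeq : ∀ t, 0 ≤ t → ∀ v ∈ V,
      HasDerivWithinAt (fun s => ip (-J (χ s)) v)
        (Qlin σ (ω t) (χ t) v
          + ((γ' t : ℝ) : ℂ) * ip (Sol ν σ (ω t) + χ t) v
          + ((ω' t : ℝ) : ℂ) * ip (J (dSol ν σ (ω t))) v
          + ip (Nrem ν σ (ω t) (charge (χ t))) (charge v)) (Ici 0) t)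
    (hχorth : ∀ t, 0 ≤ t → P0 ν σ (ω t) (χ t) = 0)
    -- the decomposition `χ = z Ψ + z̄ Ψ* + f` with `f ∈ X^c`
    (z : ℝ → ℂ) (f : ℝ → H) (hf : ∀ t, 0 ≤ t → f t ∈ Xc ν σ (ω t))
    (hχdec : ∀ t, 0 ≤ t →
      χ t = z t • Psi σ (ω t) + conj (z t) • PsiStar σ (ω t) + f t) :
    ∀ t, 0 ≤ t →
      -- every derivative and every charge below is a genuine one
      (DifferentiableAt ℝ (Sol ν σ) (ω t) ∧ DifferentiableAt ℝ (Psi σ) (ω t) ∧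
        DifferentiableAt ℝ (PsiStar σ) (ω t) ∧ DifferentiableAt ℝ (P0 ν σ) (ω t) ∧
        DifferentiableAt ℝ (Pc ν σ) (ω t)) ∧
      (P0adj ν σ (ω t) (Sol ν σ (ω t) + χ t) ∈ V ∧
        J (modDir ν σ (ω t) (χ t)) ∈ V ∧ J (Psi σ (ω t)) ∈ V ∧ f t ∈ V ∧
        ∀ v ∈ V, Pcadj ν σ (ω t) v ∈ V) ∧
      -- the equation for `ω`
      (modDen ν σ (ω t) (χ t) * ((ω' t : ℝ) : ℂ) =
          ip (Jc (Nrem ν σ (ω t) (charge (χ t))))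
            (charge (P0adj ν σ (ω t) (Sol ν σ (ω t) + χ t))) ∧
        (modDen ν σ (ω t) (χ t) ≠ 0 →
          ((ω' t : ℝ) : ℂ) =
            ip (Jc (Nrem ν σ (ω t) (charge (χ t))))
              (charge (P0adj ν σ (ω t) (Sol ν σ (ω t) + χ t)))
            / modDen ν σ (ω t) (χ t))) ∧
      -- the equation for `γ`
      (modDen ν σ (ω t) (χ t) * ((γ' t : ℝ) : ℂ) =
          -ip (Jc (Nrem ν σ (ω t) (charge (χ t))))
            (charge (J (modDir ν σ (ω t) (χ t)))) ∧
        (modDen ν σ (ω t) (χ t) ≠ 0 →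
          ((γ' t : ℝ) : ℂ) =
            -ip (Jc (Nrem ν σ (ω t) (charge (χ t))))
              (charge (J (modDir ν σ (ω t) (χ t))))
            / modDen ν σ (ω t) (χ t))) ∧
      -- the equation for `z`
      (∃ z' : ℂ, HasDerivWithinAt z z' (Ici 0) t ∧
        ip (Psi σ (ω t)) (J (Psi σ (ω t))) * (z' - Complex.I * xi σ (ω t) * z t) =
          ip (Jc (Nrem ν σ (ω t) (charge (χ t)))) (charge (J (Psi σ (ω t))))
          + ((ω' t : ℝ) : ℂ) *
            (ip (f t) (J (dPsi σ (ω t)))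
              - ip (z t • dPsi σ (ω t) + conj (z t) • dPsiStar σ (ω t)) (J (Psi σ (ω t))))
          + ((γ' t : ℝ) : ℂ) * ip (χ t) (Psi σ (ω t))) ∧
      -- the equation for `f`: first for `P^c (df/dt)`, then for `df/dt` itself
      (∀ lam : ℝ, 0 < lam → ∀ v ∈ V,
        HasDerivWithinAt (fun s => ip (f s) (Pcadj ν σ (ω t) v))
          (fRHS ν σ lam (ω t) (ω' t) (γ' t)
            (z t) (χ t) (f t) v) (Ici 0) t ∧
        HasDerivWithinAt (fun s => ip (f s) v)
          (fRHS ν σ lam (ω t) (ω' t) (γ' t)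
              (z t) (χ t) (f t) v
            + ((ω' t : ℝ) : ℂ) * ip (dPc ν σ (ω t) (f t)) v) (Ici 0) t) := by
  have hσ0 : 0 < σ := sigma_pos hσ
  have hflow : ∀ t, 0 ≤ t → ∀ v ∈ V, HasDerivWithinAt (fun s => ip (χ s) v)
      (QL σ (ω t) (χ t) v + ((γ' t : ℝ) : ℂ) * ip (J (Sol ν σ (ω t) + χ t)) v
        - ((ω' t : ℝ) : ℂ) * ip (dSol ν σ (ω t)) v
        + ip (Jc (Nrem ν σ (ω t) (charge (χ t)))) (charge v)) (Ici 0) t :=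
    fun t ht v hv => weak_flow (hχeq t ht) hv
  simp only [Psi_eq] at hχdec ⊢
  have hdec : ∀ t, 0 ≤ t → χ t = z t • PsiT Complex.I σ (ω t)
      + conj (z t) • PsiT (-Complex.I) σ (ω t) + f t := fun t ht => by
    rw [← PsiStar_eq hσ hσ1 (hωpos t ht)]; exact hχdec t ht
  clear hχdec hχeq
  intro t ht
  have hw := hωpos t ht
  have hreal : conjH (χ t) = χ t := (isRealField_iff _).1 (hχreal t ht)
  have hP0 := hχorth t ht
  have hχc : ContinuousWithinAt χ (Ici 0) t := hχcont t ht
  -- Derivatives within [0,∞) are unique even at t = 0, where they are one-sided.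
  have hud : UniqueDiffWithinAt ℝ (Ici (0 : ℝ)) t := uniqueDiffOn_Ici 0 t ht
  have hI : PsiT Complex.I σ (ω t) ∈ V := PsiT_mem_V hσ hσ1 hw
  have hN : PsiT (-Complex.I) σ (ω t) ∈ V := PsiT_mem_V hσ hσ1 hw
  have hfeq : ∀ s, 0 ≤ s → f s = χ s - (z s • PsiT Complex.I σ (ω s)
      + conj (z s) • PsiT (-Complex.I) σ (ω s)) := fun s hs => by rw [hdec s hs]; abel
  have hfV : f t ∈ V := by
    rw [hfeq t ht]
    exact sub_mem_V (hχV t ht) (add_mem_V (smul_mem_V _ hI) (smul_mem_V _ hN))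
  obtain ⟨-, -, hf3, -⟩ := Xc_orthogonal hν hσ hσ1 hw (hf t ht)
  have hm : modDir ν σ (ω t) (χ t) ∈ V := modDir_mem_V hν hσ0 hσ1 hw hP0
  have dI := (hasDerivAt_PsiI hσ hσ1 hw).scomp_hasDerivWithinAt t (hω t ht)
  have dN := (hasDerivAt_PsiNeg hσ hσ1 hw).scomp_hasDerivWithinAt t (hω t ht)
  have dJ := (hasDerivAt_J (hasDerivAt_PsiI hσ hσ1 hw)).scomp_hasDerivWithinAt t (hω t ht)
  -- the modulation equations for `ω` and `γ`
  obtain ⟨hωeq, hγeq⟩ := omega_gamma_equations hν hσ0 hσ1 hw hreal hP0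
      (a := ω' t) (b := γ' t) (p := Jc (Nrem ν σ (ω t) (charge (χ t)))) (fun v => by
    -- P⁰(ω(s))χ(s) vanishes identically; its derivative by the product rule is a linear relation
    -- between ω' and γ'.
    have dP := (differentiableAt_P0 hν hσ0 hσ1 hw).hasDerivAt.scomp_hasDerivWithinAt t (hω t ht)
    have h1 := hflow t ht _ (P0adj_mem_V hν hσ0 hw v)
    simp only [ip_P0adj] at h1
    have h2 := hasDerivWithinAt_ip_clm (T := P0 ν σ ∘ ω) dP hχc h1
    have h3 : HasDerivWithinAt (fun s => ip ((P0 ν σ ∘ ω) s (χ s)) v) 0 (Ici 0) t := by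
      refine (hasDerivWithinAt_const t (Ici 0) (0 : ℂ)).congr (fun s hs => ?_) ?_
      · rw [Function.comp, hχorth s hs, ip_zero_left]
      · rw [Function.comp, hP0, ip_zero_left]
    have h4 := hud.eq_deriv _ h2 h3
    rw [smul_apply, ip_rsmul_left, QL_P0adj hν hσ0 hw (hχV t ht)
      ((P0_eq_zero_iff hν hσ0 hσ1 hw _).1 hP0).2, P0_dSol hν hσ0 hσ1 hw] at h4
    rw [modDir, ip_sub_left, dP0]
    linear_combination h4)
  -- the equation for `z`
  have hcne : ∀ s, 0 ≤ s → ip (PsiT Complex.I σ (ω s)) (J (PsiT Complex.I σ (ω s))) ≠ 0 :=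
    fun s hs => ip_PsiT_J_PsiT_ne hσ hσ1 (hωpos s hs) I_sq' Complex.conj_I
  -- Pairing with JΨ annihilates Ψ* and f, so z is a quotient of differentiable functions.
  have hx : ∀ s, 0 ≤ s → ip (χ s) (J (PsiT Complex.I σ (ω s)))
      = z s * ip (PsiT Complex.I σ (ω s)) (J (PsiT Complex.I σ (ω s))) := by
    intro s hs
    have h := (Xc_orthogonal hν hσ hσ1 (hωpos s hs) (hf s hs)).2.2.1
    conv_lhs => rw [hdec s hs]
    rw [ip_add_left, ip_add_left, ip_smul_left, ip_smul_left, h,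
      ip_PsiNeg_J_PsiI hσ hσ1 (hωpos s hs)]
    ring
  have dx := hasDerivWithinAt_ip dJ hχc (hflow t ht _ (J_mem_V hI))
  have dc := ((hasDerivAt_ip_ip (hasDerivAt_PsiI hσ hσ1 hw)
    (hasDerivAt_J (hasDerivAt_PsiI hσ hσ1 hw))).scomp_hasDerivWithinAt t (hω t ht))
  have dz := (dx.div dc (hcne t ht)).congr (f₁ := z)
    (fun s hs => (eq_div_iff (hcne s hs)).2 (hx s hs).symm)
    ((eq_div_iff (hcne t ht)).2 (hx t ht).symm)
  obtain ⟨z', hz', dz'⟩ : ∃ z', z' = _ ∧ HasDerivWithinAt z z' (Ici 0) t := ⟨_, rfl, dz⟩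
  clear dz
  have hzeq : ip (PsiT Complex.I σ (ω t)) (J (PsiT Complex.I σ (ω t)))
        * (z' - Complex.I * xi σ (ω t) * z t) =
      ip (Jc (Nrem ν σ (ω t) (charge (χ t)))) (charge (J (PsiT Complex.I σ (ω t))))
      + ((ω' t : ℝ) : ℂ) * (ip (f t) (J (dPsi σ (ω t)))
        - ip (z t • dPsi σ (ω t) + conj (z t) • dPsiStar σ (ω t)) (J (PsiT Complex.I σ (ω t))))
      + ((γ' t : ℝ) : ℂ) * ip (χ t) (PsiT Complex.I σ (ω t)) := by
    have hc := hcne t ht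
    have hxt := hx t ht
    simp only [Function.comp_apply] at hz'
    -- In ω'(χ,J dΨ/dω) the Ψ-part cancels against half of the derivative of (Ψ,JΨ), and the Ψ*-part
    -- is rewritten by differentiating (Ψ*,JΨ) = 0.
    have hexp : ip (χ t) (J (dPsi σ (ω t))) = z t * ip (PsiT Complex.I σ (ω t)) (J (dPsi σ (ω t)))
        + conj (z t) * ip (PsiT (-Complex.I) σ (ω t)) (J (dPsi σ (ω t)))
        + ip (f t) (J (dPsi σ (ω t))) := by
      conv_lhs => rw [hdec t ht]
      rw [ip_add_left, ip_add_left, ip_smul_left, ip_smul_left]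
    have hcr := ip_PsiNeg_J_dPsi hσ hσ1 hw
    rw [eq_div_iff (pow_ne_zero 2 hc), QL_J_PsiT hσ hσ1 hw I_sq' Complex.conj_I (hχV t ht),
      map_add, ip_add_left, ip_J_Sol_J_PsiT hσ hσ1 hw I_sq' Complex.conj_I,
      ip_dSol_J_PsiT hν hσ hσ1 hw I_sq' Complex.conj_I, ip_rsmul_right, hexp, ip_J_J, hxt,
      Complex.real_smul] at hz'
    rw [ip_add_left, ip_smul_left, ip_smul_left]
    refine mul_left_cancel₀ hc ?_
    linear_combination hz' + ((ω' t : ℝ) : ℂ) * conj (z t)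
      * ip (PsiT Complex.I σ (ω t)) (J (PsiT Complex.I σ (ω t))) * hcr
  -- the equation for `f`
  have hfc : ContinuousWithinAt f (Ici 0) t := by
    -- Continuity of f in L² is all that the product rule with the moving P^c requires.
    have h := hχc.sub ((dz'.continuousWithinAt.smul dI.continuousWithinAt).add
      (((Complex.continuous_conj.continuousAt.comp_continuousWithinAt
        dz'.continuousWithinAt)).smul dN.continuousWithinAt))
    exact h.congr (fun s hs => hfeq s hs) (hfeq t ht)
  have hfrozen : ∀ lam : ℝ, 0 < lam → ∀ v ∈ V,
      HasDerivWithinAt (fun s => ip (f s) (Pcadj ν σ (ω t) v))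
        (fRHS ν σ lam (ω t) (ω' t) (γ' t) (z t) (χ t) (f t) v) (Ici 0) t := by
    intro lam hlam v hv
    have hv' := Pcadj_mem_V hν hσ hσ1 hw hv
    obtain ⟨hQ1, hQ2⟩ := QL_PsiT_Pcadj hν hσ hσ1 hw hv
    -- The discrete part zΨ + z̄Ψ* drops out because P^c annihilates both eigenfunctions.
    have hQ : QL σ (ω t) (χ t) (Pcadj ν σ (ω t) v) = QL σ (ω t) (f t) v := by
      have hzI := smul_mem_V (z t) hI
      have hzN := smul_mem_V (conj (z t)) hN
      rw [hdec t ht, QL_add_left _ _ (add_mem_V hzI hzN) hfV, QL_add_left _ _ hzI hzN,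
        QL_smul_left _ _ _ hI, QL_smul_left _ _ _ hN, hQ1, hQ2,
        QL_Pcadj hν hσ hσ1 hw (hf t ht) hfV hv]
      ring
    have e1 := (ipL (Pcadj ν σ (ω t) v)).hasFDerivAt.comp_hasDerivWithinAt t dI
    have e2 := (ipL (Pcadj ν σ (ω t) v)).hasFDerivAt.comp_hasDerivWithinAt t dN
    have dzc : HasDerivWithinAt (fun s => conj (z s)) (conj z') (Ici 0) t :=
      Complex.conjCLE.toContinuousLinearMap.hasFDerivAt.comp_hasDerivWithinAt t dz'
    refine (((hflow t ht _ hv').sub ((dz'.mul e1).add (dzc.mul e2))).congr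
      (fun s hs => ?_) ?_).congr_deriv ?_
    · rw [hfeq s hs, ip_sub_left, ip_add_left, ip_smul_left, ip_smul_left]
      rfl
    · rw [hfeq t ht, ip_sub_left, ip_add_left, ip_smul_left, ip_smul_left]
      rfl
    · rw [fRHS, ip_green_self hlam, hQ]
      change _ - ((z' * ip (PsiT Complex.I σ (ω t)) (Pcadj ν σ (ω t) v)
        + z t * ip (ω' t • dPsi σ (ω t)) (Pcadj ν σ (ω t) v))
        + (conj z' * ip (PsiT (-Complex.I) σ (ω t)) (Pcadj ν σ (ω t) v)
        + conj (z t) * ip (ω' t • dPsiStar σ (ω t)) (Pcadj ν σ (ω t) v))) = _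
      rw [ip_rsmul_left, ip_rsmul_left]
      -- P^cΨ = P^cΨ* = 0 removes z' and its conjugate; P^cJΦ = P^c dΦ/dω = 0 leaves only the Jχ
      -- term and the derivatives of Ψ, Ψ*.
      simp only [ip_Pcadj, map_add, Pc_J_Sol hν hσ hσ1 hw, Pc_dSol hν hσ hσ1 hw,
        Pc_PsiI hν hσ hσ1 hw, Pc_PsiNeg hν hσ hσ1 hw, ip_zero_left, ip_smul_left, ip_add_left]
      ring
  refine ⟨⟨(hasDerivAt_Sol hν hσ0 hw).differentiableAt, differentiableAt_PsiT hσ hσ1 hw,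
      differentiableAt_PsiStar hσ hσ1 hw, differentiableAt_P0 hν hσ0 hσ1 hw,
      differentiableAt_Pc hν hσ hσ1 hw⟩,
    ⟨P0adj_mem_V hν hσ0 hw _, J_mem_V hm, J_mem_V hI, hfV,
      fun v hv => Pcadj_mem_V hν hσ hσ1 hw hv⟩,
    ⟨hωeq, fun h => ?_⟩, ⟨hγeq, fun h => ?_⟩, ⟨z', dz', hzeq⟩,
    fun lam hlam v hv => ⟨hfrozen lam hlam v hv, ?_⟩⟩
  · rw [eq_div_iff h, mul_comm]; exact hωeq
  · rw [eq_div_iff h, mul_comm]; exact hγeq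
  · have dP := (differentiableAt_Pc hν hσ hσ1 hw).hasDerivAt.scomp_hasDerivWithinAt t (hω t ht)
    have h1 := hfrozen lam hlam v hv
    simp only [ip_Pcadj] at h1
    have h2 := hasDerivWithinAt_ip_clm (T := Pc ν σ ∘ ω) dP hfc h1
    refine (h2.congr (fun s hs => ?_) ?_).congr_deriv ?_
    · rw [Function.comp, Pc_of_mem_Xc hν hσ hσ1 (hωpos s hs) (hf s hs)]
    · rw [Function.comp, Pc_of_mem_Xc hν hσ hσ1 hw (hf t ht)]
    · rw [smul_apply, ip_rsmul_left, dPc]
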